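/- **Setting.** Let $\Omega\subset\mathbb R^d$ be a compact convex polyhedron and let $\mu$ be a probability measure on $\Omega$ with a density $\rho$ with respect to the Lebesgue measure such that $0<\rho_{\min}\le\rho\le\rho_{\max}<\infty$ on $\Omega$. Let $x_1,\dots,x_n\in\Omega$ be pairwise distinct points and let $w_1,\dots,w_n>0$ with $\sum_i w_i=1$. For $\psi\in\mathbb R^n$ define the Laguerre cells $$\mathcal L_i(\psi)=\{y\in\Omega:\ \|y-x_i\|^2-\psi_i\le\|y-x_j\|^2-\psi_j\ \text{ for all } j\neq i\}$$ and the semi-discrete dual functional $$g(\psi)=\sum_{i=1}^n\int_{\mathcal L_i(\psi)}\bigl(\|x_i-y\|^2-\psi_i\bigr)\,d\mu(y)+\sum_{i=1}^n\psi_iw_i .$$ Put $f=-g$. A *run* of the regularized Newton method, for constants $0<c_1<c_2<1$, starts at a zero-mean vector $\psi_0\in\mathbb R^n$ and follows $$\psi_{k+1}=\psi_k+t_kp_k,\qquad p_k=-\bigl(A(\psi_k)+\|\nabla f(\psi_k)\|_2\,\mathrm{Id}\bigr)^{-1}\nabla f(\psi_k),\qquad t_k>0,$$ where $A(\psi)=\nabla^2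 f(\psi)$ if $f$ is twice differentiable at $\psi$ and $A(\psi)=0$ otherwise ($p_k=0$ if $\nabla f(\psi_k)=0$), and where $t_k$ satisfies the Wolfe conditions $$f(\psi_k+t_kp_k)\le f(\psi_k)+c_1t_k\langle\nabla f(\psi_k),p_k\rangle,\qquad \langle\nabla f(\psi_k+t_kp_k),p_k\rangle\ge c_2\langle\nabla f(\psi_k),p_k\rangle .$$ **Proposition.** The functional $g$ is differentiable on $\mathbb R^n$, and there is a unique zero-mean vector $\psi^*$ that maximizes $g$ over $\mathbb R^n$. Moreover: 1. (Well-posedness.) For all $0<c_1<c_2<1$ and every zero-mean $\psi\neq\psi^*$, the operator $A(\psi)+\|\nabla f(\psi)\|_2\mathrm{Id}$ is invertible, and there is a step $t>0$ from $\psi$ that satisfies the Wolfe conditions. 2. (Global convergence.) For all $0<c_1<c_2<1$, every run, from any zero-mean $\psi_0$, consists of zero-mean vectors and satisfies $\psi_k\to\psi^*$. 3. (Local quadratic convergence.) If in addition $\rho\in C^1(\Omega)$, there is a constant $C$ such that for all $0<c_1<c_2<1$ with $c_1<\tfrac12$ there is $r>0$ with the following property. In every run in which the unit step is taken whenever it satisfies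 the Wolfe conditions, for every $k$ with $\|\psi_k-\psi^*\|<r$ one has $t_k=1$ and $$\|\psi_{k+1}-\psi^*\|\le C\,\|\psi_k-\psi^*\|^2 .$$ By part 2, this applies to all sufficiently large $k$. -/

import Mathlib

open MeasureTheory Filter Topology

noncomputable section

/-! ## Semi-discrete optimal transport -/

/-- A (closed) convex polyhedron of `ℝ^d`: an intersection of finitely many closed half-spaces. -/
def IsConvexPolyhedron {d : ℕ} (Ω : Set (EuclideanSpace ℝ (Fin d))) : Prop :=
  ∃ (m : ℕ) (a : Fin m → EuclideanSpace ℝ (Fin d)) (b : Fin m → ℝ),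
    Ω = {y | ∀ j, inner ℝ (a j) y ≤ b j}

/-- The measure `μ` on `Ω` with density `ρ` with respect to the Lebesgue measure. -/
def sourceMeasure {d : ℕ} (Ω : Set (EuclideanSpace ℝ (Fin d)))
    (ρ : EuclideanSpace ℝ (Fin d) → ℝ) : Measure (EuclideanSpace ℝ (Fin d)) :=
  (volume.restrict Ω).withDensity fun y => ENNReal.ofReal (ρ y)

/-- The Laguerre cell `L_i(ψ, x)` in `Ω`. -/
def laguerreCell {d n : ℕ} (Ω : Set (EuclideanSpace ℝ (Fin d)))
    (x : Fin n → EuclideanSpace ℝ (Fin d)) (ψ : EuclideanSpace ℝ (Fin n)) (i : Fin n) :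
    Set (EuclideanSpace ℝ (Fin d)) :=
  {y | y ∈ Ω ∧ ∀ j, j ≠ i → ‖y - x i‖ ^ 2 - ψ i ≤ ‖y - x j‖ ^ 2 - ψ j}

/-- The semi-discrete dual functional `g(ψ, x, w)`. -/
def dualFunctional {d n : ℕ} (Ω : Set (EuclideanSpace ℝ (Fin d)))
    (ρ : EuclideanSpace ℝ (Fin d) → ℝ) (x : Fin n → EuclideanSpace ℝ (Fin d))
    (w : Fin n → ℝ) (ψ : EuclideanSpace ℝ (Fin n)) : ℝ :=
  (∑ i, ∫ y in laguerreCell Ω x ψ i, (‖x i - y‖ ^ 2 - ψ i) ∂(sourceMeasure Ω ρ))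
    + ∑ i, ψ i * w i

/-- The convex function `-g`, which the minimization method below is applied to. -/
def negDualFunctional {d n : ℕ} (Ω : Set (EuclideanSpace ℝ (Fin d)))
    (ρ : EuclideanSpace ℝ (Fin d) → ℝ) (x : Fin n → EuclideanSpace ℝ (Fin d))
    (w : Fin n → ℝ) (ψ : EuclideanSpace ℝ (Fin n)) : ℝ :=
  -dualFunctional Ω ρ x w ψ

/-- The vectors of `ℝ^n` with zero mean. -/
def IsZeroMean {n : ℕ} (ψ : EuclideanSpace ℝ (Fin n)) : Prop :=
  ∑ i, ψ i = 0

/-! ## The regularized Newton method for minimizing a function `f` -/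

section RegularizedNewton

variable {E : Type*} [NormedAddCommGroup E] [InnerProductSpace ℝ E] [CompleteSpace E]

open Classical in
/-- `A(ψ)`: the Hessian of `f` at `ψ`, as an operator, if it is defined there (`f` is
differentiable near `ψ` and its gradient is differentiable at `ψ`), and `0` otherwise. -/
def hessianOrZero (f : E → ℝ) (ψ : E) : E →L[ℝ] E :=
  if (∀ᶠ φ in 𝓝 ψ, DifferentiableAt ℝ f φ) ∧ DifferentiableAt ℝ (gradient f) ψ then
    fderiv ℝ (gradient f) ψ
  else 0

/-- The regularized Hessian `A(ψ) + ‖∇f(ψ)‖ Id`. -/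
def regularizedHessian (f : E → ℝ) (ψ : E) : E →L[ℝ] E :=
  hessianOrZero f ψ + ‖gradient f ψ‖ • ContinuousLinearMap.id ℝ E

/-- The search direction `-(A(ψ) + ‖∇f(ψ)‖ Id)⁻¹ ∇f(ψ)`. Where `∇f(ψ) = 0` it is `0`. -/
def newtonDirection (f : E → ℝ) (ψ : E) : E :=
  -(regularizedHessian f ψ).inverse (gradient f ψ)

/-- The Wolfe conditions, with constants `c₁` and `c₂`, for the step `t` from `ψ` in the
direction `p`: sufficient decrease and curvature. -/
def WolfeConditions (f : E → ℝ) (c₁ c₂ : ℝ) (ψ p : E) (t : ℝ) : Prop :=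
  f (ψ + t • p) ≤ f ψ + c₁ * t * inner ℝ (gradient f ψ) p ∧
    c₂ * inner ℝ (gradient f ψ) p ≤ inner ℝ (gradient f (ψ + t • p)) p

/-- `ψ` is a sequence of iterates of the regularized Newton method, with positive step sizes `t`
that satisfy the Wolfe conditions. -/
def IsRegularizedNewtonRun (f : E → ℝ) (c₁ c₂ : ℝ) (ψ : ℕ → E) (t : ℕ → ℝ) : Prop :=
  ∀ k, 0 < t k ∧ WolfeConditions f c₁ c₂ (ψ k) (newtonDirection f (ψ k)) (t k) ∧
    ψ (k + 1) = ψ k + t k • newtonDirection f (ψ k)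

end RegularizedNewton

end

/-! ## Volumes of intersections of slabs -/

/-- The part of a ball that lies in slabs with linearly independent normals has a volume of the
order of the product of the widths of the slabs. -/
theorem exists_volume_slabs_le {E : Type*} [NormedAddCommGroup E] [InnerProductSpace ℝ E]
    [FiniteDimensional ℝ E] [MeasurableSpace E] [BorelSpace E] {κ : Type*} [Fintype κ]
    {a : κ → E} (ha : LinearIndependent ℝ a) (R : ℝ) :
    ∃ C : ℝ, 0 ≤ C ∧ ∀ lo hi : κ → ℝ, (∀ k, lo k ≤ hi k) →
      volume {y : E | ‖y‖ ≤ R ∧ ∀ k, inner ℝ (a k) y ∈ Set.Icc (lo k) (hi k)} ≤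
        ENNReal.ofReal (C * ∏ k, (hi k - lo k)) := by
  classical
  let b := Module.Basis.sumExtend ha
  have hb : ∀ k, b (Sum.inl k) = a k := fun k => by
    simp only [b, Module.Basis.sumExtend, Module.Basis.reindex_apply, Module.Basis.coe_extend]
    rfl
  have hfin : Finite (κ ⊕ Module.Basis.sumExtendIndex ha) := Module.Finite.finite_basis b
  have hfin' : Finite (Module.Basis.sumExtendIndex ha) :=
    Finite.of_injective (Sum.inr : _ → κ ⊕ Module.Basis.sumExtendIndex ha) Sum.inr_injective
  let hft : Fintype (Module.Basis.sumExtendIndex ha) := Fintype.ofFinite _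
  let T₀ : E →ₗ[ℝ] (κ ⊕ Module.Basis.sumExtendIndex ha → ℝ) :=
    LinearMap.pi fun k => (innerSL ℝ (b k)).toLinearMap
  have hT₀ : ∀ y k, T₀ y k = inner ℝ (b k) y := fun y k => rfl
  have hinj : Function.Injective T₀ := by
    rw [← LinearMap.ker_eq_bot, LinearMap.ker_eq_bot']
    intro y hy
    have h : ∀ v : E, inner ℝ v y = 0 := by
      intro v
      rw [← b.sum_repr v, sum_inner]
      refine Finset.sum_eq_zero fun k _ => ?_
      rw [inner_smul_left, ← hT₀, hy]; simp
    exact inner_self_eq_zero.1 (h y)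
  have hdim : Module.finrank ℝ E = Module.finrank ℝ (κ ⊕ Module.Basis.sumExtendIndex ha → ℝ) := by
    rw [Module.finrank_eq_card_basis b, Module.finrank_fintype_fun_eq_card]
  let T : E ≃L[ℝ] (κ ⊕ Module.Basis.sumExtendIndex ha → ℝ) :=
    (LinearEquiv.ofInjectiveOfFinrankEq T₀ hinj hdim).toContinuousLinearEquiv
  have hT : ∀ y k, T y k = inner ℝ (b k) y := fun y k => by
    rw [← hT₀]; rfl
  have : (Measure.map T (volume : Measure E)).IsAddHaarMeasure := T.isAddHaarMeasure_map _
  let c := Measure.addHaarScalarFactor (Measure.map T (volume : Measure E)) volume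
  have hc : Measure.map T (volume : Measure E) = c • volume :=
    Measure.isAddLeftInvariant_eq_smul _ _
  refine ⟨c * ∏ k : Module.Basis.sumExtendIndex ha, (2 * (‖b (Sum.inr k)‖ * |R|)),
    by positivity, fun lo hi hlohi => ?_⟩
  let lo' : κ ⊕ Module.Basis.sumExtendIndex ha → ℝ := Sum.elim lo fun k => -(‖b (Sum.inr k)‖ * |R|)
  let hi' : κ ⊕ Module.Basis.sumExtendIndex ha → ℝ := Sum.elim hi fun k => ‖b (Sum.inr k)‖ * |R|
  have hsub : {y : E | ‖y‖ ≤ R ∧ ∀ k, inner ℝ (a k) y ∈ Set.Icc (lo k) (hi k)} ⊆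
      T ⁻¹' (Set.Icc lo' hi') := by
    rintro y ⟨hyR, hy⟩
    have hk : ∀ k, lo' k ≤ T y k ∧ T y k ≤ hi' k := by
      rintro (k | k)
      · rw [hT, hb]; exact hy k
      · rw [hT]
        have := abs_le.1 ((abs_real_inner_le_norm (b (Sum.inr k)) y).trans
          (mul_le_mul_of_nonneg_left (hyR.trans (le_abs_self R)) (norm_nonneg _)))
        exact this
    exact ⟨fun k => (hk k).1, fun k => (hk k).2⟩
  have hmeas : Measurable T := T.continuous.measurable
  calc _ ≤ volume (T ⁻¹' (Set.Icc lo' hi')) := measure_mono hsub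
    _ = Measure.map T volume (Set.Icc lo' hi') := (Measure.map_apply hmeas measurableSet_Icc).symm
    _ = c * ∏ k, ENNReal.ofReal (hi' k - lo' k) := by
        rw [hc, Measure.smul_apply, Real.volume_Icc_pi]; rfl
    _ = ENNReal.ofReal (c * ∏ k, (hi' k - lo' k)) := by
        rw [ENNReal.ofReal_mul c.coe_nonneg, ENNReal.ofReal_prod_of_nonneg]
        · simp
        · rintro (k | k) -
          · simpa [lo', hi'] using hlohi k
          · simp only [lo', hi', Sum.elim_inr]
            have : 0 ≤ ‖b (Sum.inr k)‖ * |R| := by positivity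
            linarith
    _ ≤ _ := by
        apply ENNReal.ofReal_le_ofReal
        rw [Fintype.prod_sum_type]
        simp only [lo', hi', Sum.elim_inl, Sum.elim_inr, sub_neg_eq_add, ← two_mul]
        apply le_of_eq; ring

theorem exists_volume_slab_le {E : Type*} [NormedAddCommGroup E] [InnerProductSpace ℝ E]
    [FiniteDimensional ℝ E] [MeasurableSpace E] [BorelSpace E] {a : E} (ha : a ≠ 0) (R : ℝ) :
    ∃ C : ℝ, 0 ≤ C ∧ ∀ lo hi : ℝ, lo ≤ hi →
      volume {y : E | ‖y‖ ≤ R ∧ inner ℝ a y ∈ Set.Icc lo hi} ≤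
        ENNReal.ofReal (C * (hi - lo)) := by
  have hli : LinearIndependent ℝ (fun _ : Unit => a) := by
    simpa using ha
  obtain ⟨C, hC, h⟩ := exists_volume_slabs_le hli R
  refine ⟨C, hC, fun lo hi hle => ?_⟩
  simpa using h (fun _ => lo) (fun _ => hi) (fun _ => hle)

theorem exists_volume_two_slabs_le {E : Type*} [NormedAddCommGroup E] [InnerProductSpace ℝ E]
    [FiniteDimensional ℝ E] [MeasurableSpace E] [BorelSpace E] {a c : E}
    (hac : LinearIndependent ℝ ![a, c]) (R : ℝ) :
    ∃ C : ℝ, 0 ≤ C ∧ ∀ lo hi lo' hi' : ℝ, lo ≤ hi → lo' ≤ hi' →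
      volume {y : E | ‖y‖ ≤ R ∧ inner ℝ a y ∈ Set.Icc lo hi ∧ inner ℝ c y ∈ Set.Icc lo' hi'} ≤
        ENNReal.ofReal (C * ((hi - lo) * (hi' - lo'))) := by
  obtain ⟨C, hC, h⟩ := exists_volume_slabs_le hac R
  refine ⟨C, hC, fun lo hi lo' hi' hle hle' => ?_⟩
  have := h ![lo, lo'] ![hi, hi'] (by simp [Fin.forall_fin_two, hle, hle'])
  simpa [Fin.forall_fin_two, Fin.prod_univ_two] using this

/-- Hyperplanes are null sets. -/
theorem volume_hyperplane_eq_zero {E : Type*} [NormedAddCommGroup E] [InnerProductSpace ℝ E]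
    [FiniteDimensional ℝ E] [MeasurableSpace E] [BorelSpace E] {a : E} (ha : a ≠ 0) (b : ℝ) :
    volume {y : E | inner ℝ a y = b} = 0 := by
  have hsub : {y : E | inner ℝ a y = b} ⊆
      ⋃ N : ℕ, {y : E | ‖y‖ ≤ N ∧ inner ℝ a y ∈ Set.Icc b b} := by
    intro y hy
    obtain ⟨N, hN⟩ := exists_nat_ge ‖y‖
    exact Set.mem_iUnion.2 ⟨N, hN, by simpa using hy⟩
  refine measure_mono_null hsub (measure_iUnion_null fun N => ?_)
  obtain ⟨C, -, h⟩ := exists_volume_slab_le ha (N : ℝ)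
  simpa using h b b le_rfl

/-! ## A criterion for Lipschitz derivatives -/

/-- If the second differences of `G` are of second order, then the increments of `G` at a point of
differentiability are approximated by its derivative to second order. -/
theorem norm_sub_fderiv_le_of_second_difference {E F : Type*} [NormedAddCommGroup E]
    [NormedSpace ℝ E] [NormedAddCommGroup F] [NormedSpace ℝ F] {G : E → F} {x v : E} {K : ℝ}
    (hG : DifferentiableAt ℝ G x) (hK : 0 ≤ K)
    (h : ∀ s ∈ Set.Icc (0 : ℝ) 1, ∀ t ∈ Set.Icc (0 : ℝ) 1,
      ‖(G (x + s • v + t • v) - G (x + s • v)) - (G (x + t • v) - G x)‖ ≤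
        K * ‖s • v‖ * ‖t • v‖) :
    ‖G (x + v) - G x - fderiv ℝ G x v‖ ≤ K * ‖v‖ ^ 2 := by
  have hlim : Tendsto (fun N : ℕ => ((N : ℝ) + 1) • (G (x + ((N : ℝ) + 1)⁻¹ • v) - G x)) atTop
      (𝓝 (fderiv ℝ G x v)) := by
    have h1 : Tendsto (fun N : ℕ => ((N : ℝ) + 1)) atTop atTop :=
      tendsto_atTop_add_const_right _ _ tendsto_natCast_atTop_atTop
    exact hG.hasFDerivAt.lim v (tendsto_abs_atTop_atTop.comp h1)
  have hN : ∀ N : ℕ, ‖G (x + v) - G x - ((N : ℝ) + 1) • (G (x + ((N : ℝ) + 1)⁻¹ • v) - G x)‖ ≤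
      K * ‖v‖ ^ 2 := by
    intro N
    set t : ℝ := ((N : ℝ) + 1)⁻¹ with ht
    have hN0 : (0 : ℝ) < (N : ℝ) + 1 := by positivity
    have htel : G (x + v) - G x - ((N : ℝ) + 1) • (G (x + t • v) - G x) =
        ∑ k ∈ Finset.range (N + 1), ((G (x + ((k : ℝ) * t) • v + t • v) - G (x + ((k : ℝ) * t) • v))
          - (G (x + t • v) - G x)) := by
      rw [Finset.sum_sub_distrib, Finset.sum_const, Finset.card_range, ← Nat.cast_smul_eq_nsmul ℝ]
      have : ∀ k : ℕ, G (x + ((k : ℝ) * t) • v + t • v) - G (x + ((k : ℝ) * t) • v) =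
          (fun k : ℕ => G (x + ((k : ℝ) * t) • v)) (k + 1) -
            (fun k : ℕ => G (x + ((k : ℝ) * t) • v)) k := by
        intro k
        simp only
        congr 2
        rw [add_assoc, ← add_smul]; push_cast; ring_nf
      rw [Finset.sum_congr rfl fun k _ => this k, Finset.sum_range_sub
        fun k : ℕ => G (x + ((k : ℝ) * t) • v)]
      push_cast
      rw [ht, mul_inv_cancel₀ hN0.ne']
      simp
    rw [htel]
    refine (norm_sum_le _ _).trans ?_
    have ht0 : 0 < t := by positivity
    have hNt : ((N : ℝ) + 1) * t = 1 := mul_inv_cancel₀ hN0.ne'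
    have : ∀ k ∈ Finset.range (N + 1), ‖(G (x + ((k : ℝ) * t) • v + t • v)
        - G (x + ((k : ℝ) * t) • v)) - (G (x + t • v) - G x)‖ ≤ K * ‖v‖ ^ 2 * t := by
      intro k hk
      have hk' : (k : ℝ) + 1 ≤ N + 1 := by exact_mod_cast Finset.mem_range.1 hk
      have hkt : (k : ℝ) * t ≤ 1 := by rw [← hNt]; gcongr; linarith
      have hkt0 : 0 ≤ (k : ℝ) * t := by positivity
      refine (h _ ⟨hkt0, hkt⟩ t ⟨ht0.le, ?_⟩).trans ?_
      · rw [← hNt]; nlinarith [(Nat.cast_nonneg N : (0 : ℝ) ≤ N)]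
      · rw [norm_smul, norm_smul, Real.norm_of_nonneg hkt0, Real.norm_of_nonneg ht0.le]
        have : (k : ℝ) * t * (K * ‖v‖ ^ 2 * t) ≤ 1 * (K * ‖v‖ ^ 2 * t) := by gcongr
        linarith
    refine (Finset.sum_le_sum this).trans (le_of_eq ?_)
    rw [Finset.sum_const, Finset.card_range, nsmul_eq_mul]
    push_cast
    rw [show ((N : ℝ) + 1) * (K * ‖v‖ ^ 2 * t) = K * ‖v‖ ^ 2 * (((N : ℝ) + 1) * t) by ring, hNt,
      mul_one]
  exact le_of_tendsto (tendsto_const_nhds.sub hlim).norm (Eventually.of_forall hN)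

/-- A Lipschitz function whose second differences on a ball are of second order is differentiable
there with a Lipschitz derivative. -/
theorem differentiableAt_and_lipschitz_fderiv_of_second_difference {E F : Type*}
    [NormedAddCommGroup E] [NormedSpace ℝ E] [FiniteDimensional ℝ E]
    [NormedAddCommGroup F] [NormedSpace ℝ F] [FiniteDimensional ℝ F] {G : E → F} {L : NNReal}
    (hL : LipschitzWith L G) {x₀ : E} {r K : ℝ} (hr : 0 < r) (hK : 0 ≤ K)
    (h : ∀ x ∈ Metric.ball x₀ r, ∀ y ∈ Metric.ball x₀ r, ∀ v : E, ‖v‖ < r →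
      ‖(G (x + v) - G x) - (G (y + v) - G y)‖ ≤ K * ‖x - y‖ * ‖v‖) :
    (∀ x ∈ Metric.ball x₀ r, DifferentiableAt ℝ G x) ∧
      ∀ x ∈ Metric.ball x₀ r, ∀ y ∈ Metric.ball x₀ r,
        ‖fderiv ℝ G x - fderiv ℝ G y‖ ≤ K * ‖x - y‖ := by
  borelize E
  have hdense : Dense {x | DifferentiableAt ℝ G x} :=
    Measure.dense_of_ae (hL.ae_differentiableAt (μ := Measure.addHaar))
  have hlip : ∀ x ∈ Metric.ball x₀ r, ∀ y ∈ Metric.ball x₀ r, DifferentiableAt ℝ G x →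
      DifferentiableAt ℝ G y → ‖fderiv ℝ G x - fderiv ℝ G y‖ ≤ K * ‖x - y‖ := by
    intro x hx y hy hdx hdy
    have hsub : HasFDerivAt (fun v => (G (x + v) - G x) - (G (y + v) - G y))
        (fderiv ℝ G x - fderiv ℝ G y) 0 := by
      have h1 : HasFDerivAt (fun v => G (x + v)) (fderiv ℝ G x) 0 := by
        rw [hasFDerivAt_comp_add_left]; simpa using hdx.hasFDerivAt
      have h2 : HasFDerivAt (fun v => G (y + v)) (fderiv ℝ G y) 0 := by
        rw [hasFDerivAt_comp_add_left]; simpa using hdy.hasFDerivAt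
      exact (h1.sub_const _).sub (h2.sub_const _)
    refine hsub.le_of_lip' (by positivity) ?_
    filter_upwards [Metric.ball_mem_nhds (0 : E) hr] with v hv
    simpa using h x hx y hy v (by simpa using hv)
  have key : ∀ x ∈ Metric.ball x₀ r, ∃ A : E →L[ℝ] F, HasFDerivAt G A x ∧
      ∃ u : ℕ → E, Tendsto u atTop (𝓝 x) ∧ (∀ n, DifferentiableAt ℝ G (u n)) ∧
        Tendsto (fun n => fderiv ℝ G (u n)) atTop (𝓝 A) := by
    intro x hx
    obtain ⟨u, hu, hux⟩ := mem_closure_iff_seq_limit.1 (hdense x)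
    have hub : ∀ᶠ n in atTop, u n ∈ Metric.ball x₀ r :=
      hux.eventually (Metric.isOpen_ball.mem_nhds hx)
    have hcau : CauchySeq fun n => fderiv ℝ G (u n) := by
      rw [Metric.cauchySeq_iff']
      intro ε hε
      obtain ⟨N₀, hN₀⟩ := eventually_atTop.1 hub
      obtain ⟨N₁, hN₁⟩ := Metric.cauchySeq_iff.1 hux.cauchySeq (ε / (K + 1)) (by positivity)
      refine ⟨max N₀ N₁, fun n hn => ?_⟩
      have h1 := hN₁ n (le_trans (le_max_right _ _) hn) (max N₀ N₁) (le_max_right _ _)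
      have h2 := hlip _ (hN₀ n (le_trans (le_max_left _ _) hn)) _ (hN₀ _ (le_max_left N₀ N₁))
        (hu n) (hu _)
      rw [dist_eq_norm] at h1 ⊢
      have : (K + 1) * ‖u n - u (max N₀ N₁)‖ < ε := by
        rw [lt_div_iff₀ (by positivity)] at h1; linarith
      nlinarith [norm_nonneg (u n - u (max N₀ N₁))]
    obtain ⟨A, hA⟩ := cauchySeq_tendsto_of_complete hcau
    refine ⟨A, ?_, u, hux, hu, hA⟩
    obtain ⟨r', hr', hr'x⟩ : ∃ r' > 0, r' ≤ r ∧ ∀ z, ‖z‖ ≤ r' → x + z ∈ Metric.ball x₀ (r) := by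
      obtain ⟨s, hs, hsx⟩ := Metric.nhds_basis_closedBall.mem_iff.1 (Metric.isOpen_ball.mem_nhds hx)
      refine ⟨min s r, by positivity, min_le_right _ _, fun z hz => hsx ?_⟩
      simpa using hz.trans (min_le_left _ _)
    have htay : ∀ v : E, ‖v‖ ≤ r' / 2 → ‖G (x + v) - G x - A v‖ ≤ K * ‖v‖ ^ 2 := by
      intro v hv
      have hlim : Tendsto (fun n => ‖G (u n + v) - G (u n) - fderiv ℝ G (u n) v‖) atTop
          (𝓝 ‖G (x + v) - G x - A v‖) := by
        refine (Tendsto.sub (Tendsto.sub ?_ ?_) ?_).norm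
        · exact (hL.continuous.tendsto _).comp (hux.add_const v)
        · exact (hL.continuous.tendsto _).comp hux
        · exact ((ContinuousLinearMap.apply ℝ F v).continuous.tendsto A).comp hA
      have hclose : ∀ᶠ n in atTop, ‖u n - x‖ < r' / 2 := by
        have := hux.eventually (Metric.ball_mem_nhds x (half_pos hr'))
        simpa [dist_eq_norm] using this
      refine le_of_tendsto hlim ?_
      filter_upwards [hub, hclose] with n hn hnx
      refine norm_sub_fderiv_le_of_second_difference (hu n) hK fun s hs t ht => ?_
      have hsv : ‖s • v‖ ≤ r' / 2 := by
        rw [norm_smul, Real.norm_of_nonneg hs.1]; nlinarith [hs.2, norm_nonneg v]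
      have htv : ‖t • v‖ ≤ r' / 2 := by
        rw [norm_smul, Real.norm_of_nonneg ht.1]; nlinarith [ht.2, norm_nonneg v]
      have hmem : u n + s • v ∈ Metric.ball x₀ r := by
        have := hr'x.2 ((u n - x) + s • v) ((norm_add_le _ _).trans (by linarith))
        rwa [show x + (u n - x + s • v) = u n + s • v by abel] at this
      have := h _ hmem _ hn (t • v) (by linarith [hr'x.1])
      simpa using this
    rw [hasFDerivAt_iff_isLittleO_nhds_zero]
    have hO : (fun v => G (x + v) - G x - A v) =O[𝓝 0] fun v => ‖v‖ ^ 2 := by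
      refine Asymptotics.IsBigO.of_bound K ?_
      filter_upwards [Metric.closedBall_mem_nhds (0 : E) (half_pos hr')] with v hv
      simpa using htay v (by simpa using hv)
    exact hO.trans_isLittleO (Asymptotics.isLittleO_norm_pow_id one_lt_two)
  have hdiff : ∀ x ∈ Metric.ball x₀ r, DifferentiableAt ℝ G x := fun x hx =>
    (key x hx).choose_spec.1.differentiableAt
  exact ⟨hdiff, fun x hx y hy => hlip x hx y hy (hdiff x hx) (hdiff y hy)⟩

/-! ## The regularized Newton method -/

section RegularizedNewtonTheory

variable {E : Type*} [NormedAddCommGroup E] [InnerProductSpace ℝ E]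

theorem fderiv_mem_of_forall_sub_mem {F G : Type*} [NormedAddCommGroup F] [NormedSpace ℝ F]
    [NormedAddCommGroup G] [NormedSpace ℝ G]
    {g : F → G} {x v : F} {s : Set G} (hs : IsClosed s) (h0 : (0 : G) ∈ s)
    (h : ∀ t : ℝ, 0 < t → t⁻¹ • (g (x + t • v) - g x) ∈ s) : fderiv ℝ g x v ∈ s := by
  by_cases hg : DifferentiableAt ℝ g x
  · have h1 : Tendsto (fun N : ℕ => ((N : ℝ) + 1)) atTop atTop :=
      tendsto_atTop_add_const_right _ _ tendsto_natCast_atTop_atTop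
    refine hs.mem_of_tendsto (hg.hasFDerivAt.lim v (tendsto_abs_atTop_atTop.comp h1))
      (Eventually.of_forall fun N => ?_)
    have := h ((N : ℝ) + 1)⁻¹ (by positivity)
    rwa [inv_inv] at this
  · simpa [fderiv_zero_of_not_differentiableAt hg] using h0

theorem inner_fderiv_nonneg_of_monotone {g : E → E}
    (h : ∀ φ ψ, 0 ≤ inner ℝ (g φ - g ψ) (φ - ψ)) (x v : E) : 0 ≤ inner ℝ (fderiv ℝ g x v) v := by
  have hs : IsClosed {u : E | 0 ≤ inner ℝ u v} :=
    isClosed_le continuous_const (continuous_id.inner continuous_const)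
  refine fderiv_mem_of_forall_sub_mem hs (by simp) fun t ht => ?_
  have := h (x + t • v) x
  rw [add_sub_cancel_left, inner_smul_right] at this
  simp only [Set.mem_ofPred_eq, inner_smul_left]
  have h2 := nonneg_of_mul_nonneg_right this ht
  exact mul_nonneg (by simp [ht.le]) h2

theorem isInvertible_of_inner_ge [FiniteDimensional ℝ E] {B : E →L[ℝ] E} {c : ℝ} (hc : 0 < c)
    (h : ∀ v, c * ‖v‖ ^ 2 ≤ inner ℝ (B v) v) : B.IsInvertible := by
  have hinj : Function.Injective B.toLinearMap := by
    rw [← LinearMap.ker_eq_bot, LinearMap.ker_eq_bot']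
    intro v hv
    have := h v
    rw [show B v = 0 from hv, inner_zero_left] at this
    have h2 : ‖v‖ ^ 2 ≤ 0 := nonpos_of_mul_nonpos_right this hc
    have h3 : ‖v‖ = 0 := by nlinarith [norm_nonneg v]
    exact norm_eq_zero.1 h3
  refine ⟨(LinearEquiv.ofInjectiveEndo B.toLinearMap hinj).toContinuousLinearEquiv, ?_⟩
  ext v; rfl

/-- Wolfe steps exist along a descent direction on which the function is bounded below. -/
theorem exists_wolfeConditions [CompleteSpace E] {f : E → ℝ} (hf : Differentiable ℝ f) {B : ℝ}
    (hB : ∀ φ, B ≤ f φ) {c₁ c₂ : ℝ} (hc₁ : 0 < c₁) (hc : c₁ < c₂) (hc₂ : c₂ < 1) {ψ p : E}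
    (hp : inner ℝ (gradient f ψ) p < 0) : ∃ t : ℝ, 0 < t ∧ WolfeConditions f c₁ c₂ ψ p t := by
  set m := inner ℝ (gradient f ψ) p with hm
  let η : ℝ → ℝ := fun t => f (ψ + t • p) - f ψ - c₁ * t * m
  have hder : ∀ t, HasDerivAt η (inner ℝ (gradient f (ψ + t • p)) p - c₁ * m) t := by
    intro t
    have h1 : HasDerivAt (fun t : ℝ => ψ + t • p) p t := by
      simpa using ((hasDerivAt_id t).smul_const p).const_add ψ
    have h2 := (hf (ψ + t • p)).hasGradientAt.hasFDerivAt.comp_hasDerivAt t h1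
    have h3 : HasDerivAt (fun t : ℝ => c₁ * t * m) (c₁ * m) t := by
      simpa using ((hasDerivAt_id t).const_mul c₁).mul_const m
    exact ((h2.sub_const (f ψ)).sub h3).congr_deriv (by simp)
  have hη0 : η 0 = 0 := by simp [η]
  have hcont : Continuous η := continuous_iff_continuousAt.2 fun t => (hder t).continuousAt
  obtain ⟨T, hT0, hT⟩ : ∃ T : ℝ, 0 < T ∧ ∀ t, T ≤ t → 0 < η t := by
    refine ⟨(|B - f ψ| + 1) / (c₁ * -m), by
      have : 0 < c₁ * -m := mul_pos hc₁ (by linarith)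
      positivity, fun t ht => ?_⟩
    have : 0 < c₁ * -m := mul_pos hc₁ (by linarith)
    rw [div_le_iff₀ this] at ht
    have h1 := hB (ψ + t • p)
    have h2 := neg_abs_le (B - f ψ)
    simp only [η]; nlinarith
  obtain ⟨t, ht, hmin⟩ := isCompact_Icc.exists_isMinOn (Set.nonempty_Icc.2 hT0.le)
    hcont.continuousOn (s := Set.Icc 0 T)
  have hneg : η t < 0 := by
    have hd : inner ℝ (gradient f (ψ + (0 : ℝ) • p)) p - c₁ * m < 0 := by
      rw [zero_smul, add_zero, ← hm]; nlinarith
    have hev := (hder 0).tendsto_slope_zero_right.eventually (gt_mem_nhds hd)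
    have hev2 : ∀ᶠ s in 𝓝[>] (0 : ℝ), s < T :=
      nhdsWithin_le_nhds (gt_mem_nhds hT0)
    obtain ⟨s, ⟨hs1, hs2⟩, hs3⟩ := ((hev.and hev2).and self_mem_nhdsWithin).exists
    have hs0 : 0 < s := hs3
    refine lt_of_le_of_lt (hmin ⟨hs0.le, hs2.le⟩) ?_
    rw [zero_add, hη0, sub_zero, smul_eq_mul] at hs1
    by_contra h
    exact absurd hs1 (not_lt.2 (mul_nonneg (inv_pos.2 hs0).le (not_lt.1 h)))
  have ht0 : 0 < t := lt_of_le_of_ne ht.1 fun h => by rw [← h, hη0] at hneg; exact lt_irrefl _ hneg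
  have htT : t < T := lt_of_le_of_ne ht.2 fun h => by
    have := hT t h.ge; linarith
  have hloc : IsLocalMin η t := by
    filter_upwards [Icc_mem_nhds ht0 htT] with s hs using hmin hs
  have hz := hloc.hasDerivAt_eq_zero (hder t)
  refine ⟨t, ht0, ?_, ?_⟩
  · simp only [η] at hneg; linarith
  · rw [← hm]; nlinarith

variable [FiniteDimensional ℝ E]

theorem hessianOrZero_eq_fderiv {f : E → ℝ} (hf : Differentiable ℝ f) (ψ : E) :
    hessianOrZero f ψ = fderiv ℝ (gradient f) ψ := by
  unfold hessianOrZero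
  by_cases h : DifferentiableAt ℝ (gradient f) ψ
  · rw [if_pos ⟨Eventually.of_forall fun φ => hf φ, h⟩]
  · rw [if_neg fun h' => h h'.2, fderiv_zero_of_not_differentiableAt h]

theorem regularizedHessian_apply {f : E → ℝ} (hf : Differentiable ℝ f) (ψ v : E) :
    regularizedHessian f ψ v = fderiv ℝ (gradient f) ψ v + ‖gradient f ψ‖ • v := by
  rw [regularizedHessian, hessianOrZero_eq_fderiv hf]; rfl

theorem inner_regularizedHessian_ge {f : E → ℝ} (hf : Differentiable ℝ f)
    (hmono : ∀ φ ψ, 0 ≤ inner ℝ (gradient f φ - gradient f ψ) (φ - ψ)) (ψ v : E) :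
    ‖gradient f ψ‖ * ‖v‖ ^ 2 ≤ inner ℝ (regularizedHessian f ψ v) v := by
  rw [regularizedHessian_apply hf, inner_add_left, inner_smul_left, real_inner_self_eq_norm_sq]
  have := inner_fderiv_nonneg_of_monotone hmono ψ v
  simpa using this

theorem regularizedHessian_isInvertible {f : E → ℝ} (hf : Differentiable ℝ f)
    (hmono : ∀ φ ψ, 0 ≤ inner ℝ (gradient f φ - gradient f ψ) (φ - ψ)) {ψ : E}
    (hψ : gradient f ψ ≠ 0) : (regularizedHessian f ψ).IsInvertible :=
  isInvertible_of_inner_ge (norm_pos_iff.2 hψ) (inner_regularizedHessian_ge hf hmono ψ)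

theorem newtonDirection_eq_zero {f : E → ℝ} {ψ : E} (hψ : gradient f ψ = 0) :
    newtonDirection f ψ = 0 := by
  simp [newtonDirection, hψ]

/-- The equation that defines the search direction. -/
theorem fderiv_gradient_newtonDirection {f : E → ℝ} (hf : Differentiable ℝ f)
    (hmono : ∀ φ ψ, 0 ≤ inner ℝ (gradient f φ - gradient f ψ) (φ - ψ)) (ψ : E) :
    fderiv ℝ (gradient f) ψ (newtonDirection f ψ) + ‖gradient f ψ‖ • newtonDirection f ψ =
      -gradient f ψ := by
  by_cases hψ : gradient f ψ = 0
  · simp [newtonDirection_eq_zero hψ, hψ]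
  rw [← regularizedHessian_apply hf, newtonDirection, map_neg]
  obtain ⟨e, he⟩ := regularizedHessian_isInvertible hf hmono hψ
  rw [← he, ContinuousLinearMap.inverse_equiv]
  simp

theorem newtonDirection_mem {f : E → ℝ} (hf : Differentiable ℝ f)
    (hmono : ∀ φ ψ, 0 ≤ inner ℝ (gradient f φ - gradient f ψ) (φ - ψ)) {Z : Submodule ℝ E}
    (hZ : ∀ ψ, gradient f ψ ∈ Z) (ψ : E) : newtonDirection f ψ ∈ Z := by
  by_cases hψ : gradient f ψ = 0
  · simp [newtonDirection_eq_zero hψ]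
  have h := fderiv_gradient_newtonDirection hf hmono ψ
  have hA : fderiv ℝ (gradient f) ψ (newtonDirection f ψ) ∈ Z :=
    fderiv_mem_of_forall_sub_mem Z.closed_of_finiteDimensional Z.zero_mem fun t _ =>
      Z.smul_mem _ (Z.sub_mem (hZ _) (hZ _))
  have h2 : ‖gradient f ψ‖ • newtonDirection f ψ ∈ Z := by
    rw [← add_sub_cancel_left (fderiv ℝ (gradient f) ψ (newtonDirection f ψ))
      (‖gradient f ψ‖ • newtonDirection f ψ), h]
    exact Z.sub_mem (Z.neg_mem (hZ _)) hA
  exact (Z.smul_mem_iff (norm_ne_zero_iff.2 hψ)).1 h2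

theorem inner_gradient_newtonDirection_le {f : E → ℝ} (hf : Differentiable ℝ f)
    (hmono : ∀ φ ψ, 0 ≤ inner ℝ (gradient f φ - gradient f ψ) (φ - ψ)) (ψ : E) :
    inner ℝ (gradient f ψ) (newtonDirection f ψ) ≤
      -(‖gradient f ψ‖ * ‖newtonDirection f ψ‖ ^ 2) := by
  have h := inner_regularizedHessian_ge hf hmono ψ (newtonDirection f ψ)
  rw [regularizedHessian_apply hf, fderiv_gradient_newtonDirection hf hmono, inner_neg_left] at h
  linarith

theorem norm_gradient_le_newtonDirection {f : E → ℝ} (hf : Differentiable ℝ f)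
    (hmono : ∀ φ ψ, 0 ≤ inner ℝ (gradient f φ - gradient f ψ) (φ - ψ)) {L : NNReal}
    (hL : LipschitzWith L (gradient f)) (ψ : E) :
    ‖gradient f ψ‖ ≤ (L + ‖gradient f ψ‖) * ‖newtonDirection f ψ‖ := by
  have h := fderiv_gradient_newtonDirection hf hmono ψ
  calc ‖gradient f ψ‖ = ‖fderiv ℝ (gradient f) ψ (newtonDirection f ψ)
      + ‖gradient f ψ‖ • newtonDirection f ψ‖ := by rw [h, norm_neg]
    _ ≤ L * ‖newtonDirection f ψ‖ + ‖gradient f ψ‖ * ‖newtonDirection f ψ‖ := by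
        refine (norm_add_le _ _).trans (add_le_add ?_ ?_)
        · exact (ContinuousLinearMap.le_opNorm _ _).trans
            (mul_le_mul_of_nonneg_right (norm_fderiv_le_of_lipschitz ℝ hL) (norm_nonneg _))
        · rw [norm_smul, norm_norm]
    _ = _ := by ring

theorem inner_gradient_newtonDirection_neg {f : E → ℝ} (hf : Differentiable ℝ f)
    (hmono : ∀ φ ψ, 0 ≤ inner ℝ (gradient f φ - gradient f ψ) (φ - ψ)) {L : NNReal}
    (hL : LipschitzWith L (gradient f)) {ψ : E} (hψ : gradient f ψ ≠ 0) :
    inner ℝ (gradient f ψ) (newtonDirection f ψ) < 0 := by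
  have h1 := inner_gradient_newtonDirection_le hf hmono ψ
  have h2 := norm_gradient_le_newtonDirection hf hmono hL ψ
  have h3 := norm_pos_iff.2 hψ
  have h4 : 0 < ‖newtonDirection f ψ‖ := by
    by_contra h
    have : ‖newtonDirection f ψ‖ = 0 := le_antisymm (not_lt.1 h) (norm_nonneg _)
    rw [this, mul_zero] at h2; linarith
  have : 0 < ‖gradient f ψ‖ * ‖newtonDirection f ψ‖ ^ 2 := by positivity
  linarith

/-- A Wolfe step decreases the function by an amount controlled by the gradient. -/
theorem wolfe_decrease {f : E → ℝ} (hf : Differentiable ℝ f)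
    (hmono : ∀ φ ψ, 0 ≤ inner ℝ (gradient f φ - gradient f ψ) (φ - ψ)) {L : NNReal}
    (hL0 : 0 < L) (hL : LipschitzWith L (gradient f)) {c₁ c₂ : ℝ} (hc₁ : 0 < c₁) (hc₂ : c₂ < 1)
    {ψ : E} {t : ℝ} (ht : 0 < t) (hw : WolfeConditions f c₁ c₂ ψ (newtonDirection f ψ) t) :
    c₁ * (1 - c₂) / L * (‖gradient f ψ‖ ^ 4 / (L + ‖gradient f ψ‖) ^ 2) ≤
      f ψ - f (ψ + t • newtonDirection f ψ) := by
  set p := newtonDirection f ψ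
  set g := gradient f ψ
  have hL0' : (0 : ℝ) < L := hL0
  have h1 := inner_gradient_newtonDirection_le hf hmono ψ
  have h2 := norm_gradient_le_newtonDirection hf hmono hL ψ
  change inner ℝ g p ≤ -(‖g‖ * ‖p‖ ^ 2) at h1
  change ‖g‖ ≤ (L + ‖g‖) * ‖p‖ at h2
  obtain ⟨hw1, hw2⟩ := hw
  change f (ψ + t • p) ≤ f ψ + c₁ * t * inner ℝ g p at hw1
  change c₂ * inner ℝ g p ≤ inner ℝ (gradient f (ψ + t • p)) p at hw2
  set q := -inner ℝ g p with hq
  have hq' : ‖g‖ * ‖p‖ ^ 2 ≤ q := by linarith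
  have hcurv : (1 - c₂) * q ≤ L * t * ‖p‖ ^ 2 := by
    have h3 : inner ℝ (gradient f (ψ + t • p) - g) p ≤ L * t * ‖p‖ ^ 2 := by
      refine (real_inner_le_norm _ _).trans ?_
      have h4 := hL.norm_sub_le (ψ + t • p) ψ
      rw [add_sub_cancel_left, norm_smul, Real.norm_of_nonneg ht.le] at h4
      calc _ ≤ L * (t * ‖p‖) * ‖p‖ := mul_le_mul_of_nonneg_right h4 (norm_nonneg _)
        _ = _ := by ring
    rw [inner_sub_left] at h3
    linarith
  have hlow : ‖g‖ ^ 2 / (L + ‖g‖) ^ 2 ≤ ‖p‖ ^ 2 := by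
    rw [← div_pow]
    refine pow_le_pow_left₀ (by positivity) ?_ 2
    rw [div_le_iff₀ (by positivity)]; linarith
  have htg : (1 - c₂) * ‖g‖ / L ≤ t ∨ ‖p‖ = 0 := by
    by_cases hp : ‖p‖ = 0
    · exact Or.inr hp
    refine Or.inl ?_
    have hp2 : 0 < ‖p‖ ^ 2 := by positivity
    rw [div_le_iff₀ hL0']
    have : (1 - c₂) * (‖g‖ * ‖p‖ ^ 2) ≤ (1 - c₂) * q :=
      mul_le_mul_of_nonneg_left hq' (by linarith)
    have : ((1 - c₂) * ‖g‖) * ‖p‖ ^ 2 ≤ (t * L) * ‖p‖ ^ 2 := by linarith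
    exact le_of_mul_le_mul_right this hp2
  have hdec : c₁ * t * q ≤ f ψ - f (ψ + t • p) := by
    have : c₁ * t * q = -(c₁ * t * inner ℝ g p) := by rw [hq]; ring
    linarith
  refine le_trans ?_ hdec
  have hc2' : 0 < 1 - c₂ := by linarith
  have e1 : c₁ * (1 - c₂) / L * (‖g‖ ^ 4 / (L + ‖g‖) ^ 2) =
      c₁ * ((1 - c₂) * ‖g‖ / L) * (‖g‖ * (‖g‖ ^ 2 / (L + ‖g‖) ^ 2)) := by ring
  rw [e1]
  have e2 : ‖g‖ * (‖g‖ ^ 2 / (L + ‖g‖) ^ 2) ≤ q :=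
    (mul_le_mul_of_nonneg_left hlow (norm_nonneg _)).trans hq'
  have e0 : 0 ≤ ‖g‖ * (‖g‖ ^ 2 / (L + ‖g‖) ^ 2) := by positivity
  rcases htg with h | h
  · gcongr
  · have : ‖g‖ = 0 := by
      rw [h, mul_zero] at h2; exact le_antisymm h2 (norm_nonneg _)
    rw [this] at e2 ⊢
    have hq0 : 0 ≤ q := by simpa using e2
    simp only [zero_mul, mul_zero]
    positivity

theorem IsRegularizedNewtonRun.mem {f : E → ℝ} (hf : Differentiable ℝ f)
    (hmono : ∀ φ ψ, 0 ≤ inner ℝ (gradient f φ - gradient f ψ) (φ - ψ)) {Z : Submodule ℝ E}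
    (hZ : ∀ ψ, gradient f ψ ∈ Z) {c₁ c₂ : ℝ} {ψ : ℕ → E} {t : ℕ → ℝ}
    (hrun : IsRegularizedNewtonRun f c₁ c₂ ψ t) (h0 : ψ 0 ∈ Z) (k : ℕ) : ψ k ∈ Z := by
  induction k with
  | zero => exact h0
  | succ k ih =>
    rw [(hrun k).2.2]
    exact Z.add_mem ih (Z.smul_mem _ (newtonDirection_mem hf hmono hZ _))

/-- Global convergence of the regularized Newton method in a subspace that contains all gradients,
when the sublevel sets in the subspace are bounded and the critical point is unique. -/
theorem IsRegularizedNewtonRun.tendsto {f : E → ℝ} (hf : Differentiable ℝ f)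
    (hmono : ∀ φ ψ, 0 ≤ inner ℝ (gradient f φ - gradient f ψ) (φ - ψ)) {L : NNReal}
    (hL : LipschitzWith L (gradient f)) {Z : Submodule ℝ E}
    (hZ : ∀ ψ, gradient f ψ ∈ Z) {B : ℝ} (hB : ∀ φ, B ≤ f φ)
    (hcoer : ∀ a : ℝ, ∃ R : ℝ, ∀ φ ∈ Z, f φ ≤ a → ‖φ‖ ≤ R) {ψopt : E}
    (huniq : ∀ φ ∈ Z, gradient f φ = 0 → φ = ψopt)
    {c₁ c₂ : ℝ} (hc₁ : 0 < c₁) (hc₂ : c₂ < 1) {ψ : ℕ → E} {t : ℕ → ℝ}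
    (hrun : IsRegularizedNewtonRun f c₁ c₂ ψ t) (h0 : ψ 0 ∈ Z) :
    Tendsto ψ atTop (𝓝 ψopt) := by
  have hL' : LipschitzWith (L + 1) (gradient f) := hL.weaken (by simp)
  have hmem := hrun.mem hf hmono hZ h0
  set Λ : ℝ := ((L + 1 : NNReal) : ℝ) with hΛ
  have hΛ0 : 0 < Λ := by positivity
  let F : E → ℝ := fun φ => ‖gradient f φ‖ ^ 4 / (Λ + ‖gradient f φ‖) ^ 2
  have hdec : ∀ k, c₁ * (1 - c₂) / Λ * F (ψ k) ≤ f (ψ k) - f (ψ (k + 1)) := by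
    intro k
    rw [(hrun k).2.2]
    exact wolfe_decrease hf hmono (by positivity) hL' hc₁ hc₂ (hrun k).1 (hrun k).2.1
  have hF0 : ∀ φ, 0 ≤ F φ := fun φ => by positivity
  have hconst : 0 < c₁ * (1 - c₂) / Λ := by
    have : 0 < 1 - c₂ := by linarith
    positivity
  have hanti : Antitone fun k => f (ψ k) := antitone_nat_of_succ_le fun k => by
    have := hdec k
    have := mul_nonneg hconst.le (hF0 (ψ k))
    linarith
  obtain ⟨l, hl⟩ : ∃ l, Tendsto (fun k => f (ψ k)) atTop (𝓝 l) :=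
    ⟨_, tendsto_atTop_ciInf hanti ⟨B, by rintro _ ⟨k, rfl⟩; exact hB _⟩⟩
  have hFlim : Tendsto (fun k => F (ψ k)) atTop (𝓝 0) := by
    have h1 : Tendsto (fun k => (c₁ * (1 - c₂) / Λ)⁻¹ * (f (ψ k) - f (ψ (k + 1)))) atTop (𝓝 0) := by
      simpa using (hl.sub ((tendsto_add_atTop_iff_nat 1).2 hl)).const_mul (c₁ * (1 - c₂) / Λ)⁻¹
    refine squeeze_zero (fun k => hF0 _) (fun k => ?_) h1
    rw [inv_mul_eq_div, le_div_iff₀ hconst]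
    linarith [hdec k]
  have hFcont : Continuous F := by
    have := hL.continuous
    exact (this.norm.pow 4).div ((continuous_const.add this.norm).pow 2) fun φ => by positivity
  obtain ⟨R, hR⟩ := hcoer (f (ψ 0))
  have hcpt : IsCompact (Metric.closedBall (0 : E) R) := isCompact_closedBall 0 R
  refine hcpt.tendsto_nhds_of_unique_mapClusterPt (Eventually.of_forall fun k => ?_)
    fun φ _ hφ => ?_
  · simpa using hR _ (hmem k) (hanti (Nat.zero_le k))
  · have hφZ : φ ∈ Z := Z.closed_of_finiteDimensional.mem_of_mapClusterPt hφ
      (Eventually.of_forall hmem)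
    obtain ⟨u, hu, huφ⟩ := hφ.tendsto_subseq
    have hFφ : F φ = 0 := tendsto_nhds_unique ((hFcont.tendsto φ).comp huφ)
      (hFlim.comp hu.tendsto_atTop)
    refine huniq φ hφZ ?_
    have h2 : (Λ + ‖gradient f φ‖) ^ 2 ≠ 0 := by positivity
    have h3 : ‖gradient f φ‖ ^ 4 = 0 := by
      simpa [F, h2] using hFφ
    simpa using h3

/-- Second-order Taylor bound for a function whose gradient has a first-order expansion. -/
theorem le_taylor_of_gradient {f : E → ℝ} (hf : Differentiable ℝ f) {ψ p : E} {K : ℝ}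
    {A : E →L[ℝ] E} (hK : ∀ t ∈ Set.Icc (0 : ℝ) 1,
      ‖gradient f (ψ + t • p) - gradient f ψ - A (t • p)‖ ≤ K * ‖t • p‖ ^ 2) (hK0 : 0 ≤ K) :
    f (ψ + p) ≤ f ψ + inner ℝ (gradient f ψ) p + 1 / 2 * inner ℝ (A p) p + K * ‖p‖ ^ 3 := by
  let χ : ℝ → ℝ := fun t => t * inner ℝ (gradient f ψ) p + t ^ 2 * (1 / 2 * inner ℝ (A p) p) +
    t * (K * ‖p‖ ^ 3) - f (ψ + t • p)
  have hder : ∀ t, HasDerivAt χ (inner ℝ (gradient f ψ) p + t * inner ℝ (A p) p + K * ‖p‖ ^ 3 -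
      inner ℝ (gradient f (ψ + t • p)) p) t := by
    intro t
    have h1 : HasDerivAt (fun t : ℝ => ψ + t • p) p t := by
      simpa using ((hasDerivAt_id t).smul_const p).const_add ψ
    have h2 := (hf (ψ + t • p)).hasGradientAt.hasFDerivAt.comp_hasDerivAt t h1
    have h3 := (hasDerivAt_id t).mul_const (inner ℝ (gradient f ψ) p)
    have h4 := ((hasDerivAt_id t).pow 2).mul_const (1 / 2 * inner ℝ (A p) p)
    have h5 := (hasDerivAt_id t).mul_const (K * ‖p‖ ^ 3)
    exact (((h3.add h4).add h5).sub h2).congr_deriv (by simp; ring)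
  have hmono : MonotoneOn χ (Set.Icc 0 1) := by
    refine monotoneOn_of_deriv_nonneg (convex_Icc 0 1)
      (fun t _ => (hder t).continuousAt.continuousWithinAt)
      (fun t _ => (hder t).differentiableAt.differentiableWithinAt) fun t ht => ?_
    rw [interior_Icc] at ht
    rw [(hder t).deriv]
    have h1 := hK t ⟨ht.1.le, ht.2.le⟩
    have h2 := (real_inner_le_norm (gradient f (ψ + t • p) - gradient f ψ - A (t • p)) p).trans
      (mul_le_mul_of_nonneg_right h1 (norm_nonneg p))
    rw [inner_sub_left, inner_sub_left, map_smul, inner_smul_left, norm_smul,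
      Real.norm_of_nonneg ht.1.le] at h2
    simp only [conj_trivial] at h2
    have h3 : K * (t * ‖p‖) ^ 2 * ‖p‖ ≤ K * ‖p‖ ^ 3 := by
      have : t ^ 2 ≤ 1 := pow_le_one₀ ht.1.le ht.2.le
      have : t ^ 2 * (K * ‖p‖ ^ 3) ≤ 1 * (K * ‖p‖ ^ 3) := by gcongr
      linarith
    linarith
  have := hmono (Set.left_mem_Icc.2 zero_le_one) (Set.right_mem_Icc.2 zero_le_one) zero_le_one
  simp only [χ, zero_mul, zero_smul, add_zero, one_mul, one_smul, one_pow] at this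
  linarith

/-- Local analysis of the regularized Newton step near a critical point at which the Hessian is
positive definite on a subspace that contains all gradients. -/
theorem exists_newton_quadratic {f : E → ℝ} (hf : Differentiable ℝ f)
    (hmono : ∀ φ ψ, 0 ≤ inner ℝ (gradient f φ - gradient f ψ) (φ - ψ)) {L : NNReal}
    (hL : LipschitzWith L (gradient f)) {Z : Submodule ℝ E} (hZ : ∀ ψ, gradient f ψ ∈ Z)
    {ψopt : E} (hopt : gradient f ψopt = 0) (hoptZ : ψopt ∈ Z) {r₀ K m : ℝ} (hr₀ : 0 < r₀)
    (hK : 0 ≤ K) (hm : 0 < m)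
    (htay : ∀ ψ ∈ Metric.ball ψopt r₀, ∀ φ ∈ Metric.ball ψopt r₀,
      ‖gradient f φ - gradient f ψ - fderiv ℝ (gradient f) ψ (φ - ψ)‖ ≤ K * ‖φ - ψ‖ ^ 2)
    (hpos : ∀ ψ ∈ Metric.ball ψopt r₀, ∀ v ∈ Z,
      m * ‖v‖ ^ 2 ≤ inner ℝ (fderiv ℝ (gradient f) ψ v) v) :
    ∃ C : ℝ, ∀ c₁ c₂ : ℝ, c₁ < 1 / 2 → 0 < c₂ → ∃ r : ℝ, 0 < r ∧
      ∀ ψ ∈ Z, ‖ψ - ψopt‖ < r →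
        WolfeConditions f c₁ c₂ ψ (newtonDirection f ψ) 1 ∧
          ‖ψ + newtonDirection f ψ - ψopt‖ ≤ C * ‖ψ - ψopt‖ ^ 2 := by
  refine ⟨(K + L) / m, fun c₁ c₂ hc₁ hc₂ => ?_⟩
  set C := (K + L) / m with hC
  have hC0 : 0 ≤ C := by positivity
  let D : ℝ := K + 2 * L + 1
  have hD : 0 < D := by positivity
  refine ⟨min (r₀ / 4) (min (1 / (2 * (C + 1))) (min ((1 / 2 - c₁) * m / (2 * D))
    (c₂ * m / (2 * D)))), ?_, fun ψ hψ hψr => ?_⟩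
  · have : 0 < 1 / 2 - c₁ := by linarith
    positivity
  simp only [lt_min_iff] at hψr
  obtain ⟨hr1, hr2, hr3, hr4⟩ := hψr
  set e := ‖ψ - ψopt‖ with he
  have he0 : 0 ≤ e := norm_nonneg _
  have hψb : ψ ∈ Metric.ball ψopt r₀ := by
    rw [mem_ball_iff_norm]; linarith
  have hoptb : ψopt ∈ Metric.ball ψopt r₀ := Metric.mem_ball_self hr₀
  set p := newtonDirection f ψ with hp
  set g := gradient f ψ with hg
  set A := fderiv ℝ (gradient f) ψ with hA
  have hpZ : p ∈ Z := newtonDirection_mem hf hmono hZ ψ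
  have heq : A p + ‖g‖ • p = -g := fderiv_gradient_newtonDirection hf hmono ψ
  have hgL : ‖g‖ ≤ L * e := by
    have := hL.norm_sub_le ψ ψopt
    rwa [hopt, sub_zero] at this
  have hquad : ‖ψ + p - ψopt‖ ≤ C * e ^ 2 := by
    set u := ψ + p - ψopt with hu
    have huZ : u ∈ Z := Z.sub_mem (Z.add_mem hψ hpZ) hoptZ
    have h1 : A u + ‖g‖ • u = (gradient f ψopt - g - A (ψopt - ψ)) + ‖g‖ • (ψ - ψopt) := by
      have hAu : A u = A p - A (ψopt - ψ) := by rw [← map_sub, hu]; congr 1; abel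
      have hu2 : ‖g‖ • u = ‖g‖ • p + ‖g‖ • (ψ - ψopt) := by rw [← smul_add, hu]; congr 1; abel
      rw [hAu, hu2, hopt, zero_sub, ← heq]; abel
    have h2 : ‖A u + ‖g‖ • u‖ ≤ (K + L) * e ^ 2 := by
      rw [h1]
      refine (norm_add_le _ _).trans ?_
      have h3 := htay ψ hψb ψopt hoptb
      rw [norm_sub_rev ψopt ψ] at h3
      rw [norm_smul, norm_norm]
      have : ‖g‖ * ‖ψ - ψopt‖ ≤ L * e * e := mul_le_mul_of_nonneg_right hgL he0
      change _ ≤ K * e ^ 2 at h3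
      linarith
    have h3 : m * ‖u‖ ^ 2 ≤ (K + L) * e ^ 2 * ‖u‖ := by
      calc m * ‖u‖ ^ 2 ≤ inner ℝ (A u) u := hpos ψ hψb u huZ
        _ ≤ inner ℝ (A u + ‖g‖ • u) u := by
            rw [inner_add_left, inner_smul_left, real_inner_self_eq_norm_sq]
            have : 0 ≤ ‖g‖ * ‖u‖ ^ 2 := by positivity
            simpa using this
        _ ≤ _ := (real_inner_le_norm _ _).trans (mul_le_mul_of_nonneg_right h2 (norm_nonneg _))
    by_cases hu0 : ‖u‖ = 0
    · rw [hu0]; positivity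
    · have hu1 : 0 < ‖u‖ := lt_of_le_of_ne (norm_nonneg _) (Ne.symm hu0)
      have h4 : m * ‖u‖ ≤ (K + L) * e ^ 2 :=
        le_of_mul_le_mul_right (by linarith) hu1
      rw [hC, div_mul_eq_mul_div, le_div_iff₀ hm]; linarith
  refine ⟨?_, hquad⟩
  have hCe : C * e ^ 2 ≤ e / 2 := by
    rw [lt_div_iff₀ (by positivity)] at hr2
    nlinarith
  have hp1 : ‖p‖ ≤ 2 * e := by
    have : p = (ψ + p - ψopt) - (ψ - ψopt) := by abel
    rw [this]
    refine (norm_sub_le _ _).trans ?_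
    linarith
  have hp2 : e ≤ 2 * ‖p‖ := by
    have : ψ - ψopt = (ψ + p - ψopt) - p := by abel
    have h1 : e ≤ ‖ψ + p - ψopt‖ + ‖p‖ := by
      rw [he]; nth_rewrite 1 [this]; exact norm_sub_le _ _
    linarith
  have hball : ∀ t ∈ Set.Icc (0 : ℝ) 1, ψ + t • p ∈ Metric.ball ψopt r₀ := by
    intro t ht
    rw [mem_ball_iff_norm, show ψ + t • p - ψopt = (ψ - ψopt) + t • p by abel]
    refine lt_of_le_of_lt (norm_add_le _ _) ?_
    rw [norm_smul, Real.norm_of_nonneg ht.1]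
    have : t * ‖p‖ ≤ 1 * ‖p‖ := mul_le_mul_of_nonneg_right ht.2 (norm_nonneg _)
    linarith
  have htay' : ∀ t ∈ Set.Icc (0 : ℝ) 1,
      ‖gradient f (ψ + t • p) - gradient f ψ - A (t • p)‖ ≤ K * ‖t • p‖ ^ 2 := by
    intro t ht
    have := htay ψ hψb _ (hball t ht)
    rwa [add_sub_cancel_left] at this
  have hAp : inner ℝ (A p) p = -inner ℝ g p - ‖g‖ * ‖p‖ ^ 2 := by
    have : A p = -g - ‖g‖ • p := eq_sub_of_add_eq heq
    rw [this, inner_sub_left, inner_neg_left, inner_smul_left, real_inner_self_eq_norm_sq]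
    simp
  have hposp := hpos ψ hψb p hpZ
  change m * ‖p‖ ^ 2 ≤ inner ℝ (A p) p at hposp
  have hgp : 0 ≤ ‖g‖ * ‖p‖ ^ 2 := by positivity
  have hsmall : ∀ c : ℝ, 0 < c → e < c * m / (2 * D) → D * ‖p‖ ^ 3 ≤ c * (m * ‖p‖ ^ 2) := by
    intro c hc hce
    rw [lt_div_iff₀ (by positivity)] at hce
    have h1 : D * ‖p‖ ≤ c * m := by nlinarith
    have : D * ‖p‖ * ‖p‖ ^ 2 ≤ c * m * ‖p‖ ^ 2 := by gcongr
    linarith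
  have hgp3 : ‖g‖ * ‖p‖ ^ 2 ≤ 2 * L * ‖p‖ ^ 3 := by
    have hL0 : (0 : ℝ) ≤ L := L.coe_nonneg
    have h1 : ‖g‖ ≤ 2 * L * ‖p‖ := by nlinarith
    calc ‖g‖ * ‖p‖ ^ 2 ≤ 2 * L * ‖p‖ * ‖p‖ ^ 2 := by gcongr
      _ = _ := by ring
  have hp3 : 0 ≤ ‖p‖ ^ 3 := by positivity
  have hLp : 0 ≤ 2 * L * ‖p‖ ^ 3 := by positivity
  have hKp : 0 ≤ K * ‖p‖ ^ 3 := by positivity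
  have hDe : D * ‖p‖ ^ 3 = K * ‖p‖ ^ 3 + 2 * L * ‖p‖ ^ 3 + ‖p‖ ^ 3 := by ring
  constructor
  · have h1 := le_taylor_of_gradient hf htay' hK
    have h2 := hsmall (1 / 2 - c₁) (by linarith) hr3
    rw [one_smul, mul_one]
    change f (ψ + p) ≤ f ψ + c₁ * inner ℝ g p
    change f (ψ + p) ≤ f ψ + inner ℝ g p + _ + _ at h1
    have h3 : (1 / 2 - c₁) * (m * ‖p‖ ^ 2) ≤ (1 / 2 - c₁) * -inner ℝ g p :=
      mul_le_mul_of_nonneg_left (by linarith) (by linarith)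
    nlinarith
  · have h1 := htay' 1 (Set.right_mem_Icc.2 zero_le_one)
    rw [one_smul] at h1 ⊢
    have h2 := hsmall c₂ hc₂ hr4
    change c₂ * inner ℝ g p ≤ _
    have h3 := (abs_le.1 ((abs_real_inner_le_norm _ p).trans
      (mul_le_mul_of_nonneg_right h1 (norm_nonneg p)))).1
    rw [inner_sub_left, inner_sub_left] at h3
    change _ ≤ _ - inner ℝ g p - _ at h3
    have h4 : c₂ * (m * ‖p‖ ^ 2) ≤ c₂ * -inner ℝ g p :=
      mul_le_mul_of_nonneg_left (by linarith) hc₂.le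
    nlinarith

end RegularizedNewtonTheory

/-! ## Differentiability and coercivity of the dual functional -/

/-- The cell `L_i(ψ)` is cut out of `Ω` by the inequalities `⟪x j - x i, y⟫ ≤ b` with these `b`. -/
noncomputable def cellThreshold {d n : ℕ} (x : Fin n → EuclideanSpace ℝ (Fin d))
    (ψ : EuclideanSpace ℝ (Fin n)) (i j : Fin n) : ℝ :=
  (‖x j‖ ^ 2 - ‖x i‖ ^ 2 + ψ i - ψ j) / 2

/-- The gradient of the convex function `-g`: the excess masses of the Laguerre cells. -/
noncomputable def excessMass {d n : ℕ} (Ω : Set (EuclideanSpace ℝ (Fin d)))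
    (ρ : EuclideanSpace ℝ (Fin d) → ℝ) (x : Fin n → EuclideanSpace ℝ (Fin d))
    (w : Fin n → ℝ) (ψ : EuclideanSpace ℝ (Fin n)) : EuclideanSpace ℝ (Fin n) :=
  WithLp.toLp 2 fun i => (sourceMeasure Ω ρ).real (laguerreCell Ω x ψ i) - w i

/-- The subspace of zero-mean vectors. -/
def zeroMeanSubmodule (n : ℕ) : Submodule ℝ (EuclideanSpace ℝ (Fin n)) where
  carrier := {ψ | IsZeroMean ψ}
  add_mem' := fun {a b} ha hb => by
    change ∑ i, (a + b) i = 0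
    have ha' : ∑ i, a i = 0 := ha
    have hb' : ∑ i, b i = 0 := hb
    simp [Finset.sum_add_distrib, ha', hb']
  zero_mem' := by
    change ∑ i, (0 : EuclideanSpace ℝ (Fin n)) i = 0
    simp
  smul_mem' := fun c a ha => by
    change ∑ i, (c • a) i = 0
    have ha' : ∑ i, a i = 0 := ha
    simp [← Finset.mul_sum, ha']

/-- A function with a Lipschitz field of subgradients is differentiable. -/
theorem hasGradientAt_of_subgradient {E : Type*} [NormedAddCommGroup E] [InnerProductSpace ℝ E]
    [CompleteSpace E] {f : E → ℝ} {G : E → E} {L : NNReal} (hL : LipschitzWith L G)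
    (h : ∀ φ ψ, f ψ + inner ℝ (G ψ) (φ - ψ) ≤ f φ) (ψ : E) : HasGradientAt f (G ψ) ψ := by
  rw [hasGradientAt_iff_isLittleO]
  have hO : (fun φ => f φ - f ψ - inner ℝ (G ψ) (φ - ψ)) =O[𝓝 ψ] fun φ => ‖φ - ψ‖ ^ 2 := by
    refine Asymptotics.IsBigO.of_bound L (Eventually.of_forall fun φ => ?_)
    have h1 := h φ ψ
    have h2 := h ψ φ
    have h3 := (real_inner_le_norm (G φ - G ψ) (φ - ψ)).trans
      (mul_le_mul_of_nonneg_right (hL.norm_sub_le φ ψ) (norm_nonneg _))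
    rw [inner_sub_left] at h3
    rw [← neg_sub φ ψ, inner_neg_right] at h2
    rw [Real.norm_of_nonneg (by linarith), norm_pow, norm_norm]
    linarith
  refine hO.trans_isLittleO ?_
  have h0 : Tendsto (fun φ => φ - ψ) (𝓝 ψ) (𝓝 0) := by
    simpa using (continuous_id.sub continuous_const).tendsto ψ (f := fun φ => φ - ψ)
  exact (Asymptotics.isLittleO_norm_pow_id one_lt_two).comp_tendsto h0

section LaguerreCells

variable {d n : ℕ} {Ω : Set (EuclideanSpace ℝ (Fin d))} {ρ : EuclideanSpace ℝ (Fin d) → ℝ}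
  {x : Fin n → EuclideanSpace ℝ (Fin d)} {w : Fin n → ℝ}

theorem cost_le_iff (ψ : EuclideanSpace ℝ (Fin n)) (i j : Fin n) (y : EuclideanSpace ℝ (Fin d)) :
    ‖y - x i‖ ^ 2 - ψ i ≤ ‖y - x j‖ ^ 2 - ψ j ↔ inner ℝ (x j - x i) y ≤ cellThreshold x ψ i j := by
  rw [cellThreshold, norm_sub_sq_real, norm_sub_sq_real, inner_sub_left, real_inner_comm (x i) y,
    real_inner_comm (x j) y, le_div_iff₀ two_pos]
  constructor <;> intro h <;> linarith

theorem mem_laguerreCell_iff {ψ : EuclideanSpace ℝ (Fin n)} {i : Fin n}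
    {y : EuclideanSpace ℝ (Fin d)} :
    y ∈ laguerreCell Ω x ψ i ↔
      y ∈ Ω ∧ ∀ j, j ≠ i → inner ℝ (x j - x i) y ≤ cellThreshold x ψ i j := by
  simp only [laguerreCell, cost_le_iff]
  rfl

theorem isClosed_laguerreCell (hΩ : IsClosed Ω) (ψ : EuclideanSpace ℝ (Fin n)) (i : Fin n) :
    IsClosed (laguerreCell Ω x ψ i) := by
  have : laguerreCell Ω x ψ i =
      Ω ∩ ⋂ j, ⋂ (_ : j ≠ i), {y | ‖y - x i‖ ^ 2 - ψ i ≤ ‖y - x j‖ ^ 2 - ψ j} := by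
    ext y; simp [laguerreCell]
  rw [this]
  refine hΩ.inter (isClosed_iInter fun j => isClosed_iInter fun _ => isClosed_le ?_ ?_) <;> fun_prop

theorem sourceMeasure_le {ρmax : ℝ} (hΩ : MeasurableSet Ω) (hρ : ∀ y ∈ Ω, ρ y ≤ ρmax)
    (S : Set (EuclideanSpace ℝ (Fin d))) :
    sourceMeasure Ω ρ S ≤ ENNReal.ofReal ρmax * volume (Ω ∩ S) := by
  calc sourceMeasure Ω ρ S
      ≤ ((volume.restrict Ω).withDensity fun _ => ENNReal.ofReal ρmax) S := by
        refine Measure.le_iff'.1 (withDensity_mono ?_) S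
        filter_upwards [ae_restrict_mem hΩ] with y hy using ENNReal.ofReal_le_ofReal (hρ y hy)
    _ = _ := by
        rw [withDensity_const, Measure.smul_apply, Measure.restrict_apply' hΩ, Set.inter_comm,
          smul_eq_mul]

theorem le_sourceMeasure {ρmin : ℝ} (hΩ : MeasurableSet Ω) (hρ : ∀ y ∈ Ω, ρmin ≤ ρ y)
    (S : Set (EuclideanSpace ℝ (Fin d))) :
    ENNReal.ofReal ρmin * volume (Ω ∩ S) ≤ sourceMeasure Ω ρ S := by
  calc _ = ((volume.restrict Ω).withDensity fun _ => ENNReal.ofReal ρmin) S := by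
        rw [withDensity_const, Measure.smul_apply, Measure.restrict_apply' hΩ, Set.inter_comm,
          smul_eq_mul]
    _ ≤ sourceMeasure Ω ρ S := by
        refine Measure.le_iff'.1 (withDensity_mono ?_) S
        filter_upwards [ae_restrict_mem hΩ] with y hy using ENNReal.ofReal_le_ofReal (hρ y hy)

theorem ae_sourceMeasure_mem (hΩ : MeasurableSet Ω) : ∀ᵐ y ∂sourceMeasure Ω ρ, y ∈ Ω :=
  (withDensity_absolutelyContinuous _ _).ae_le (ae_restrict_mem hΩ)

theorem sourceMeasure_absolutelyContinuous : sourceMeasure Ω ρ ≪ volume :=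
  (withDensity_absolutelyContinuous _ _).trans Measure.absolutelyContinuous_restrict

/-- Almost every point of `Ω` lies in exactly one cell. -/
theorem ae_existsUnique_mem_laguerreCell (hΩ : MeasurableSet Ω) (hx : Function.Injective x)
    [Nonempty (Fin n)] (ψ : EuclideanSpace ℝ (Fin n)) :
    ∀ᵐ y ∂sourceMeasure Ω ρ, y ∈ Ω ∧
      ∃ a, y ∈ laguerreCell Ω x ψ a ∧ ∀ i, i ≠ a → y ∉ laguerreCell Ω x ψ i := by
  have hties : ∀ i j, i ≠ j → ∀ᵐ y ∂sourceMeasure Ω ρ,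
      inner ℝ (x j - x i) y ≠ cellThreshold x ψ i j := by
    intro i j hij
    refine sourceMeasure_absolutelyContinuous.ae_le ?_
    exact measure_eq_zero_iff_ae_notMem.1
      (volume_hyperplane_eq_zero (sub_ne_zero.2 fun h => hij (hx h).symm) _)
  have hall : ∀ᵐ y ∂sourceMeasure Ω ρ, ∀ i j, i ≠ j →
      inner ℝ (x j - x i) y ≠ cellThreshold x ψ i j :=
    by
    simp only [ae_all_iff]
    exact hties
  filter_upwards [ae_sourceMeasure_mem hΩ, hall] with y hy hyt
  refine ⟨hy, ?_⟩
  obtain ⟨a, -, ha⟩ := Finset.exists_min_image Finset.univ (fun i => ‖y - x i‖ ^ 2 - ψ i)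
    Finset.univ_nonempty
  refine ⟨a, ⟨hy, fun j _ => ha j (Finset.mem_univ _)⟩, fun i hia hi => ?_⟩
  have h1 := hi.2 a hia.symm
  have h2 := ha i (Finset.mem_univ _)
  have h3 := (cost_le_iff ψ i a y).1 h1
  have h5 : cellThreshold x ψ i a ≤ inner ℝ (x a - x i) y := by
    have := (cost_le_iff (x := x) ψ a i y).1 h2
    rw [cellThreshold] at this ⊢
    rw [inner_sub_left] at this ⊢
    linarith
  exact hyt i a hia (le_antisymm h3 h5)

theorem continuous_cost (ψ : EuclideanSpace ℝ (Fin n)) (i : Fin n) :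
    Continuous fun y : EuclideanSpace ℝ (Fin d) => ‖x i - y‖ ^ 2 - ψ i := by fun_prop

theorem integrable_cost (hΩ : IsCompact Ω) [IsFiniteMeasure (sourceMeasure Ω ρ)]
    (ψ : EuclideanSpace ℝ (Fin n)) (i : Fin n) :
    Integrable (fun y => ‖x i - y‖ ^ 2 - ψ i) (sourceMeasure Ω ρ) := by
  obtain ⟨C, hC⟩ := hΩ.exists_bound_of_continuousOn (continuous_cost (x := x) ψ i).continuousOn
  refine Integrable.of_bound (continuous_cost ψ i).aestronglyMeasurable C ?_
  filter_upwards [ae_sourceMeasure_mem hΩ.measurableSet] with y hy using hC y hy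

theorem sum_setIntegral_eq (hΩ : IsCompact Ω) [IsFiniteMeasure (sourceMeasure Ω ρ)]
    (φ ψ : EuclideanSpace ℝ (Fin n)) :
    ∑ i, ∫ y in laguerreCell Ω x ψ i, (‖x i - y‖ ^ 2 - φ i) ∂(sourceMeasure Ω ρ) =
      ∫ y, ∑ i, (laguerreCell Ω x ψ i).indicator (fun y => ‖x i - y‖ ^ 2 - φ i) y
        ∂(sourceMeasure Ω ρ) := by
  have hm : ∀ i, MeasurableSet (laguerreCell Ω x ψ i) := fun i =>
    (isClosed_laguerreCell hΩ.isClosed ψ i).measurableSet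
  rw [integral_finsetSum _ fun i _ => (integrable_cost hΩ φ i).indicator (hm i)]
  exact Finset.sum_congr rfl fun i _ => (integral_indicator (hm i)).symm

theorem integrable_sum_indicator (hΩ : IsCompact Ω) [IsFiniteMeasure (sourceMeasure Ω ρ)]
    (φ ψ : EuclideanSpace ℝ (Fin n)) :
    Integrable (fun y => ∑ i, (laguerreCell Ω x ψ i).indicator (fun y => ‖x i - y‖ ^ 2 - φ i) y)
      (sourceMeasure Ω ρ) :=
  integrable_finsetSum _ fun i _ => (integrable_cost hΩ φ i).indicator
    (isClosed_laguerreCell hΩ.isClosed ψ i).measurableSet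

/-- The cells of `φ` are an optimal partition for the costs given by `φ`. -/
theorem sum_setIntegral_cell_le (hΩ : IsCompact Ω) [IsFiniteMeasure (sourceMeasure Ω ρ)]
    (hx : Function.Injective x) [Nonempty (Fin n)] (φ ψ : EuclideanSpace ℝ (Fin n)) :
    ∑ i, ∫ y in laguerreCell Ω x φ i, (‖x i - y‖ ^ 2 - φ i) ∂(sourceMeasure Ω ρ) ≤
      ∑ i, ∫ y in laguerreCell Ω x ψ i, (‖x i - y‖ ^ 2 - φ i) ∂(sourceMeasure Ω ρ) := by
  classical
  rw [sum_setIntegral_eq hΩ, sum_setIntegral_eq hΩ]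
  refine integral_mono_ae (integrable_sum_indicator hΩ _ _) (integrable_sum_indicator hΩ _ _) ?_
  filter_upwards [ae_existsUnique_mem_laguerreCell hΩ.measurableSet hx φ,
    ae_existsUnique_mem_laguerreCell hΩ.measurableSet hx ψ] with y ⟨hy, a, ha, ha'⟩ ⟨_, b, hb, hb'⟩
  rw [Finset.sum_eq_single a (fun i _ hi => Set.indicator_of_notMem (ha' i hi) _) (by simp),
    Finset.sum_eq_single b (fun i _ hi => Set.indicator_of_notMem (hb' i hi) _) (by simp),
    Set.indicator_of_mem ha, Set.indicator_of_mem hb, norm_sub_rev, norm_sub_rev (x b)]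
  by_cases hab : b = a
  · rw [hab]
  · exact ha.2 b hab

/-- The masses of the cells add up to the total mass. -/
theorem sum_measureReal_laguerreCell (hΩ : IsCompact Ω) [IsProbabilityMeasure (sourceMeasure Ω ρ)]
    (hx : Function.Injective x) [Nonempty (Fin n)] (ψ : EuclideanSpace ℝ (Fin n)) :
    ∑ i, (sourceMeasure Ω ρ).real (laguerreCell Ω x ψ i) = 1 := by
  classical
  have hm : ∀ i, MeasurableSet (laguerreCell Ω x ψ i) := fun i =>
    (isClosed_laguerreCell hΩ.isClosed ψ i).measurableSet
  have h1 : ∑ i, (sourceMeasure Ω ρ).real (laguerreCell Ω x ψ i) =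
      ∫ y, ∑ i, (laguerreCell Ω x ψ i).indicator (fun _ => (1 : ℝ)) y ∂sourceMeasure Ω ρ := by
    rw [integral_finsetSum _ fun i _ => (integrable_const _).indicator (hm i)]
    exact Finset.sum_congr rfl fun i _ => by rw [integral_indicator (hm i)]; simp
  rw [h1, integral_congr_ae (g := fun _ => 1)]
  · simp
  · filter_upwards [ae_existsUnique_mem_laguerreCell hΩ.measurableSet hx ψ] with y ⟨hy, a, ha, ha'⟩
    rw [Finset.sum_eq_single a (fun i _ hi => Set.indicator_of_notMem (ha' i hi) _) (by simp),
      Set.indicator_of_mem ha]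

theorem sum_excessMass (hΩ : IsCompact Ω) [IsProbabilityMeasure (sourceMeasure Ω ρ)]
    (hx : Function.Injective x) [Nonempty (Fin n)] (hw : ∑ i, w i = 1)
    (ψ : EuclideanSpace ℝ (Fin n)) : excessMass Ω ρ x w ψ ∈ zeroMeanSubmodule n := by
  change ∑ i, ((sourceMeasure Ω ρ).real (laguerreCell Ω x ψ i) - w i) = 0
  rw [Finset.sum_sub_distrib, sum_measureReal_laguerreCell hΩ hx, hw, sub_self]

theorem negDualFunctional_subgradient (hΩ : IsCompact Ω)
    [IsProbabilityMeasure (sourceMeasure Ω ρ)] (hx : Function.Injective x) [Nonempty (Fin n)]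
    (φ ψ : EuclideanSpace ℝ (Fin n)) :
    negDualFunctional Ω ρ x w ψ + inner ℝ (excessMass Ω ρ x w ψ) (φ - ψ) ≤
      negDualFunctional Ω ρ x w φ := by
  have h1 := sum_setIntegral_cell_le (ρ := ρ) hΩ hx φ ψ
  have h2 : ∑ i, ∫ y in laguerreCell Ω x ψ i, (‖x i - y‖ ^ 2 - φ i) ∂(sourceMeasure Ω ρ) =
      ∑ i, ∫ y in laguerreCell Ω x ψ i, (‖x i - y‖ ^ 2 - ψ i) ∂(sourceMeasure Ω ρ) -
      ∑ i, (φ i - ψ i) * (sourceMeasure Ω ρ).real (laguerreCell Ω x ψ i) := by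
    rw [← Finset.sum_sub_distrib]
    refine Finset.sum_congr rfl fun i _ => ?_
    have h3 : ∀ y, ‖x i - y‖ ^ 2 - φ i = (‖x i - y‖ ^ 2 - ψ i) - (φ i - ψ i) := fun y => by ring
    simp_rw [h3]
    rw [integral_sub (integrable_cost hΩ ψ i).integrableOn (integrable_const _).integrableOn]
    simp [mul_comm]
  have h3 : inner ℝ (excessMass Ω ρ x w ψ) (φ - ψ) =
      ∑ i, (φ i - ψ i) * (sourceMeasure Ω ρ).real (laguerreCell Ω x ψ i) -
        (∑ i, φ i * w i - ∑ i, ψ i * w i) := by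
    rw [PiLp.inner_apply, ← Finset.sum_sub_distrib, ← Finset.sum_sub_distrib]
    refine Finset.sum_congr rfl fun i _ => ?_
    simp [excessMass]
    ring
  rw [h3]
  simp only [negDualFunctional, dualFunctional]
  linarith

/-- The masses of the cells depend on `ψ` in a Lipschitz way. -/
theorem exists_measureReal_laguerreCell_le (hΩ : IsCompact Ω)
    [IsProbabilityMeasure (sourceMeasure Ω ρ)] (hx : Function.Injective x) {ρmax : ℝ}
    (hρ : ∀ y ∈ Ω, ρ y ≤ ρmax) (i : Fin n) :
    ∃ C : ℝ, 0 ≤ C ∧ ∀ φ ψ : EuclideanSpace ℝ (Fin n),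
      (sourceMeasure Ω ρ).real (laguerreCell Ω x φ i) ≤
        (sourceMeasure Ω ρ).real (laguerreCell Ω x ψ i) + C * ‖φ - ψ‖ := by
  classical
  obtain ⟨R, hR⟩ := hΩ.exists_bound_of_continuousOn (f := fun y => y) continuousOn_id
  have hslab : ∀ j, ∃ C : ℝ, 0 ≤ C ∧ (j ≠ i → ∀ lo hi : ℝ, lo ≤ hi →
      volume {y : EuclideanSpace ℝ (Fin d) | ‖y‖ ≤ R ∧ inner ℝ (x j - x i) y ∈ Set.Icc lo hi} ≤
        ENNReal.ofReal (C * (hi - lo))) := by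
    intro j
    by_cases hj : j = i
    · exact ⟨0, le_rfl, fun h => absurd hj h⟩
    · obtain ⟨C, hC, h⟩ := exists_volume_slab_le (sub_ne_zero.2 fun h => hj (hx h)) R
      exact ⟨C, hC, fun _ => h⟩
  choose C hC0 hC using hslab
  refine ⟨∑ j, |ρmax| * C j,
    Finset.sum_nonneg fun j _ => mul_nonneg (abs_nonneg _) (hC0 j), fun φ ψ => ?_⟩
  let S : Fin n → Set (EuclideanSpace ℝ (Fin d)) := fun j =>
    if j = i then ∅ else {y | ‖y‖ ≤ R ∧ inner ℝ (x j - x i) y ∈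
      Set.Icc (cellThreshold x ψ i j) (max (cellThreshold x φ i j) (cellThreshold x ψ i j))}
  have hsub : laguerreCell Ω x φ i ⊆ laguerreCell Ω x ψ i ∪ ⋃ j, S j := by
    intro y hy
    rw [mem_laguerreCell_iff] at hy
    by_cases hyψ : y ∈ laguerreCell Ω x ψ i
    · exact Or.inl hyψ
    · rw [mem_laguerreCell_iff] at hyψ
      push Not at hyψ
      obtain ⟨j, hji, hj⟩ := hyψ hy.1
      refine Or.inr (Set.mem_iUnion.2 ⟨j, ?_⟩)
      simp only [S, if_neg hji]
      exact ⟨hR y hy.1, hj.le, (hy.2 j hji).trans (le_max_left _ _)⟩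
  have hS : ∀ j, (sourceMeasure Ω ρ).real (S j) ≤ |ρmax| * C j * ‖φ - ψ‖ := by
    intro j
    by_cases hj : j = i
    · simp only [S, if_pos hj, measureReal_empty]
      have := hC0 j
      positivity
    · have hw : max (cellThreshold x φ i j) (cellThreshold x ψ i j) - cellThreshold x ψ i j ≤
          ‖φ - ψ‖ := by
        have h1 := PiLp.norm_apply_le (φ - ψ) i
        have h2 := PiLp.norm_apply_le (φ - ψ) j
        rw [Real.norm_eq_abs] at h1 h2
        have h1' := (abs_le.1 h1)
        have h2' := (abs_le.1 h2)
        simp only [PiLp.sub_apply] at h1' h2'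
        rw [sub_le_iff_le_add]
        refine max_le ?_ (by linarith [norm_nonneg (φ - ψ)])
        simp only [cellThreshold]
        linarith
      have hvol := hC j hj _ _ (le_max_right (cellThreshold x φ i j) (cellThreshold x ψ i j))
      refine ENNReal.toReal_le_of_le_ofReal (by have := hC0 j; positivity) ?_
      calc sourceMeasure Ω ρ (S j)
          ≤ ENNReal.ofReal ρmax * volume (Ω ∩ S j) := sourceMeasure_le hΩ.measurableSet hρ _
        _ ≤ ENNReal.ofReal |ρmax| * ENNReal.ofReal (C j * ‖φ - ψ‖) := by
            refine mul_le_mul' (ENNReal.ofReal_le_ofReal (le_abs_self _)) ?_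
            refine (measure_mono Set.inter_subset_right).trans ?_
            simp only [S, if_neg hj]
            exact hvol.trans (ENNReal.ofReal_le_ofReal (mul_le_mul_of_nonneg_left hw (hC0 j)))
        _ = _ := by rw [← ENNReal.ofReal_mul (abs_nonneg _), mul_assoc]
  calc (sourceMeasure Ω ρ).real (laguerreCell Ω x φ i)
      ≤ (sourceMeasure Ω ρ).real (laguerreCell Ω x ψ i ∪ ⋃ j, S j) := measureReal_mono hsub
    _ ≤ (sourceMeasure Ω ρ).real (laguerreCell Ω x ψ i) + (sourceMeasure Ω ρ).real (⋃ j, S j) :=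
        measureReal_union_le _ _
    _ ≤ _ := by
        gcongr
        refine (measureReal_iUnion_fintype_le _).trans ?_
        rw [Finset.sum_mul]
        exact Finset.sum_le_sum fun j _ => hS j

theorem exists_lipschitzWith_excessMass (hΩ : IsCompact Ω)
    [IsProbabilityMeasure (sourceMeasure Ω ρ)] (hx : Function.Injective x) {ρmax : ℝ}
    (hρ : ∀ y ∈ Ω, ρ y ≤ ρmax) : ∃ L : NNReal, LipschitzWith L (excessMass Ω ρ x w) := by
  choose C hC0 hC using fun i => exists_measureReal_laguerreCell_le hΩ hx hρ i
  have h : LipschitzWith ⟨∑ i, C i, Finset.sum_nonneg fun i _ => hC0 i⟩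
      (fun ψ i => (sourceMeasure Ω ρ).real (laguerreCell Ω x ψ i) - w i) := by
    refine LipschitzWith.of_dist_le_mul fun φ ψ => ?_
    rw [dist_eq_norm φ ψ]
    refine (dist_pi_le_iff (by
      exact mul_nonneg (NNReal.coe_nonneg _) (norm_nonneg _))).2 fun i => ?_
    have h1 := hC i φ ψ
    have h2 := hC i ψ φ
    rw [norm_sub_rev] at h2
    have h3 : C i * ‖φ - ψ‖ ≤ (∑ i, C i) * ‖φ - ψ‖ :=
      mul_le_mul_of_nonneg_right (Finset.single_le_sum (fun i _ => hC0 i) (Finset.mem_univ i))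
        (norm_nonneg _)
    change _ ≤ (∑ i, C i) * ‖φ - ψ‖
    rw [Real.dist_eq, abs_le]
    constructor <;> linarith
  exact ⟨_, (PiLp.lipschitzWith_toLp 2 fun _ : Fin n => ℝ).comp h⟩

theorem hasGradientAt_negDualFunctional (hΩ : IsCompact Ω)
    [IsProbabilityMeasure (sourceMeasure Ω ρ)] (hx : Function.Injective x) [Nonempty (Fin n)]
    {ρmax : ℝ} (hρ : ∀ y ∈ Ω, ρ y ≤ ρmax) (ψ : EuclideanSpace ℝ (Fin n)) :
    HasGradientAt (negDualFunctional Ω ρ x w) (excessMass Ω ρ x w ψ) ψ := by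
  obtain ⟨L, hL⟩ := exists_lipschitzWith_excessMass (w := w) hΩ hx hρ
  exact hasGradientAt_of_subgradient hL (negDualFunctional_subgradient hΩ hx) ψ

theorem excessMass_monotone (hΩ : IsCompact Ω)
    [IsProbabilityMeasure (sourceMeasure Ω ρ)] (hx : Function.Injective x) [Nonempty (Fin n)]
    (φ ψ : EuclideanSpace ℝ (Fin n)) :
    0 ≤ inner ℝ (excessMass Ω ρ x w φ - excessMass Ω ρ x w ψ) (φ - ψ) := by
  have h1 := negDualFunctional_subgradient (ρ := ρ) (w := w) hΩ hx φ ψ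
  have h2 := negDualFunctional_subgradient (ρ := ρ) (w := w) hΩ hx ψ φ
  rw [← neg_sub φ ψ, inner_neg_right] at h2
  rw [inner_sub_left]
  linarith

/-- Lower bound that yields coercivity. -/
theorem exists_le_negDualFunctional (hΩ : IsCompact Ω)
    [IsProbabilityMeasure (sourceMeasure Ω ρ)] (hx : Function.Injective x) [Nonempty (Fin n)]
    (hwsum : ∑ i, w i = 1) :
    ∃ D : ℝ, ∀ (φ : EuclideanSpace ℝ (Fin n)) (a : Fin n),
      ∑ i, w i * (φ a - φ i) - D ≤ negDualFunctional Ω ρ x w φ := by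
  classical
  choose I hI using fun a : Fin n =>
    (⟨_, rfl⟩ : ∃ I : ℝ, ∫ y, (‖x a - y‖ ^ 2 - (0 : EuclideanSpace ℝ (Fin n)) a)
      ∂(sourceMeasure Ω ρ) = I)
  refine ⟨∑ a, |I a|, fun φ a => ?_⟩
  have h1 : ∑ i, ∫ y in laguerreCell Ω x φ i, (‖x i - y‖ ^ 2 - φ i) ∂(sourceMeasure Ω ρ) ≤
      ∫ y, (‖x a - y‖ ^ 2 - φ a) ∂(sourceMeasure Ω ρ) := by
    rw [sum_setIntegral_eq hΩ]
    refine integral_mono_ae (integrable_sum_indicator hΩ _ _) (integrable_cost hΩ _ _) ?_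
    filter_upwards [ae_existsUnique_mem_laguerreCell hΩ.measurableSet hx φ]
      with y ⟨hy, b, hb, hb'⟩
    rw [Finset.sum_eq_single b (fun i _ hi => Set.indicator_of_notMem (hb' i hi) _) (by simp),
      Set.indicator_of_mem hb, norm_sub_rev, norm_sub_rev (x a)]
    by_cases hab : a = b
    · rw [hab]
    · exact hb.2 a hab
  have h2 : ∫ y, (‖x a - y‖ ^ 2 - φ a) ∂(sourceMeasure Ω ρ) = I a - φ a := by
    have h3 : ∀ y, ‖x a - y‖ ^ 2 - φ a =
        (‖x a - y‖ ^ 2 - (0 : EuclideanSpace ℝ (Fin n)) a) - φ a := fun y => by simp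
    simp_rw [h3]
    rw [integral_sub (integrable_cost hΩ 0 a) (integrable_const _), hI]
    simp
  have h3 : I a ≤ ∑ a, |I a| := (le_abs_self _).trans
    (Finset.single_le_sum (f := fun a => |I a|) (fun i _ => abs_nonneg _) (Finset.mem_univ a))
  have h4 : ∑ i, w i * (φ a - φ i) = φ a - ∑ i, φ i * w i := by
    simp_rw [mul_sub]
    rw [Finset.sum_sub_distrib, ← Finset.sum_mul, hwsum, one_mul]
    simp_rw [mul_comm]
  rw [h4]
  simp only [negDualFunctional, dualFunctional]
  linarith

/-- Coercivity on the zero-mean vectors. -/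
theorem exists_norm_le_of_negDualFunctional_le (hΩ : IsCompact Ω)
    [IsProbabilityMeasure (sourceMeasure Ω ρ)] (hx : Function.Injective x) [Nonempty (Fin n)]
    (hw : ∀ i, 0 < w i) (hwsum : ∑ i, w i = 1) (b : ℝ) :
    ∃ R : ℝ, ∀ φ ∈ zeroMeanSubmodule n, negDualFunctional Ω ρ x w φ ≤ b → ‖φ‖ ≤ R := by
  classical
  obtain ⟨D, hD⟩ := exists_le_negDualFunctional (ρ := ρ) hΩ hx hwsum
  let M : ℝ := ∑ i, |b + D| / w i
  have hM0 : ∀ i, 0 ≤ |b + D| / w i := fun i => by have := hw i; positivity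
  have hM : 0 ≤ M := Finset.sum_nonneg fun i _ => hM0 i
  refine ⟨Real.sqrt (∑ _i : Fin n, M ^ 2), fun φ hφ hφb => ?_⟩
  obtain ⟨a, -, ha⟩ := Finset.exists_max_image Finset.univ (fun i => φ i) Finset.univ_nonempty
  have hsum : ∑ i, φ i = 0 := hφ
  have hgap : ∀ i, φ a - φ i ≤ |b + D| / w i := by
    intro i
    rw [le_div_iff₀ (hw i)]
    have h1 : w i * (φ a - φ i) ≤ ∑ i, w i * (φ a - φ i) :=
      Finset.single_le_sum (f := fun i => w i * (φ a - φ i))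
        (fun j _ => mul_nonneg (hw j).le (sub_nonneg.2 (ha j (Finset.mem_univ _))))
        (Finset.mem_univ i)
    have h2 := hD φ a
    have h3 := le_abs_self (b + D)
    linarith
  have hgapM : ∀ i, φ a - φ i ≤ M := fun i =>
    (hgap i).trans (Finset.single_le_sum (fun i _ => hM0 i) (Finset.mem_univ i))
  obtain ⟨i₀, hi₀⟩ : ∃ i, φ i ≤ 0 := by
    by_contra! h
    have := Finset.sum_pos (fun i _ => h i) (Finset.univ_nonempty (α := Fin n))
    linarith
  obtain ⟨i₁, hi₁⟩ : ∃ i, 0 ≤ φ i := by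
    by_contra! h
    have := Finset.sum_neg (fun i _ => h i) (Finset.univ_nonempty (α := Fin n))
    linarith
  have h5 := hgapM i₀
  have h6 := ha i₁ (Finset.mem_univ _)
  rw [EuclideanSpace.norm_eq]
  refine Real.sqrt_le_sqrt (Finset.sum_le_sum fun i _ => ?_)
  have h7 := ha i (Finset.mem_univ _)
  have h8 := hgapM i
  have h9 : |φ i| ≤ M := abs_le.2 ⟨by linarith, by linarith⟩
  rw [Real.norm_eq_abs]
  exact pow_le_pow_left₀ (abs_nonneg _) h9 2

/-- There is a zero-mean minimizer of `-g`. -/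
theorem exists_isMinOn_negDualFunctional (hΩ : IsCompact Ω)
    [IsProbabilityMeasure (sourceMeasure Ω ρ)] (hx : Function.Injective x) [Nonempty (Fin n)]
    {ρmax : ℝ} (hρ : ∀ y ∈ Ω, ρ y ≤ ρmax)
    (hw : ∀ i, 0 < w i) (hwsum : ∑ i, w i = 1) :
    ∃ ψ ∈ zeroMeanSubmodule n, ∀ φ, negDualFunctional Ω ρ x w ψ ≤ negDualFunctional Ω ρ x w φ := by
  have hcont : Continuous (negDualFunctional Ω ρ x w) := continuous_iff_continuousAt.2 fun ψ =>
    (hasGradientAt_negDualFunctional hΩ hx hρ ψ).continuousAt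
  obtain ⟨R, hR⟩ := exists_norm_le_of_negDualFunctional_le (ρ := ρ) hΩ hx hw hwsum
    (negDualFunctional Ω ρ x w 0)
  have hK : IsCompact (Metric.closedBall (0 : EuclideanSpace ℝ (Fin n)) R ∩
      (zeroMeanSubmodule n : Set _)) :=
    (isCompact_closedBall _ R).inter_right (zeroMeanSubmodule n).closed_of_finiteDimensional
  have h0 : (0 : EuclideanSpace ℝ (Fin n)) ∈
      Metric.closedBall 0 R ∩ (zeroMeanSubmodule n : Set _) :=
    ⟨by simpa using hR 0 (Submodule.zero_mem _) le_rfl, Submodule.zero_mem _⟩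
  obtain ⟨ψ, hψ, hmin⟩ := hK.exists_isMinOn ⟨0, h0⟩ hcont.continuousOn
  have hminZ : ∀ φ ∈ zeroMeanSubmodule n,
      negDualFunctional Ω ρ x w ψ ≤ negDualFunctional Ω ρ x w φ := by
    intro φ hφ
    by_cases h : negDualFunctional Ω ρ x w φ ≤ negDualFunctional Ω ρ x w 0
    · exact hmin ⟨by simpa using hR φ hφ h, hφ⟩
    · exact (hmin h0).trans (not_le.1 h).le
  refine ⟨ψ, hψ.2, fun φ => ?_⟩
  let c : ℝ := (∑ i, φ i) / n
  let one : EuclideanSpace ℝ (Fin n) := WithLp.toLp 2 fun _ => 1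
  have hn : (n : ℝ) ≠ 0 := by
    have : 0 < n := Fin.pos_iff_nonempty.2 inferInstance
    positivity
  have hmean : φ - c • one ∈ zeroMeanSubmodule n := by
    change ∑ i, (φ i - c * 1) = 0
    rw [Finset.sum_sub_distrib]
    simp [c]
    field_simp
    simp
  refine (hminZ _ hmean).trans ?_
  have h := negDualFunctional_subgradient (ρ := ρ) (w := w) hΩ hx φ (φ - c • one)
  have h2 : inner ℝ (excessMass Ω ρ x w (φ - c • one)) (φ - (φ - c • one)) = 0 := by
    have h3 : ∑ i, excessMass Ω ρ x w (φ - c • one) i = 0 := sum_excessMass hΩ hx hwsum _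
    rw [sub_sub_cancel, inner_smul_right, PiLp.inner_apply]
    simp [one, h3]
  linarith

end LaguerreCells

/-! ## Strict monotonicity of the cell masses -/

/-- If a Lipschitz function takes both signs in the interior of a convex set, then the volume of
the part of the set where it lies in `(0, ε]` is at least of the order of `ε`. -/
theorem exists_le_volume_level {E : Type*} [NormedAddCommGroup E] [InnerProductSpace ℝ E]
    [FiniteDimensional ℝ E] [MeasurableSpace E] [BorelSpace E] {Ω : Set E} (hΩ : Convex ℝ Ω)
    {h : E → ℝ} {K : NNReal} (hK : LipschitzWith K h) {y₀ y₁ : E}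
    (hy₀ : y₀ ∈ interior Ω) (hy₁ : y₁ ∈ interior Ω) (h₀ : h y₀ < 0) (h₁ : 0 < h y₁) :
    ∃ c : ℝ, 0 < c ∧ ∀ ε ∈ Set.Icc (0 : ℝ) 1,
      ENNReal.ofReal (c * ε) ≤ volume {y | y ∈ Ω ∧ 0 < h y ∧ h y ≤ ε} := by
  have hcont := hK.continuous
  obtain ⟨r, hr, hr0⟩ : ∃ r > 0, ∀ u : E, ‖u‖ < r → (y₀ + u ∈ Ω ∧ h (y₀ + u) < 0) ∧
      (y₁ + u ∈ Ω ∧ h y₁ / 2 < h (y₁ + u)) := by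
    have e0 : ∀ᶠ y in 𝓝 y₀, y ∈ Ω ∧ h y < 0 :=
      Filter.Eventually.and (mem_interior_iff_mem_nhds.1 hy₀)
        ((hcont.tendsto y₀).eventually (gt_mem_nhds h₀))
    have e1 : ∀ᶠ y in 𝓝 y₁, y ∈ Ω ∧ h y₁ / 2 < h y :=
      Filter.Eventually.and (mem_interior_iff_mem_nhds.1 hy₁)
        ((hcont.tendsto y₁).eventually (lt_mem_nhds (by linarith)))
    obtain ⟨r₀, hr₀, H₀⟩ := Metric.eventually_nhds_iff.1 e0
    obtain ⟨r₁, hr₁, H₁⟩ := Metric.eventually_nhds_iff.1 e1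
    refine ⟨min r₀ r₁, lt_min hr₀ hr₁, fun u hu => ⟨H₀ ?_, H₁ ?_⟩⟩
    · simpa using hu.trans_le (min_le_left _ _)
    · simpa using hu.trans_le (min_le_right _ _)
  set e := y₁ - y₀ with he
  let ε₀ : ℝ := min (h y₁ / 2) 1
  have hε₀ : 0 < ε₀ := lt_min (by linarith) one_pos
  let K' : NNReal := K * ‖e‖₊ + 1
  have hline : ∀ z : E, LipschitzWith K' fun t : ℝ => h (z + t • e) := by
    intro z
    have h1 : LipschitzWith ‖e‖₊ fun t : ℝ => z + t • e := by
      refine LipschitzWith.of_dist_le_mul fun s t => ?_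
      rw [dist_add_left, dist_eq_norm, ← sub_smul, norm_smul, mul_comm, Real.dist_eq,
        Real.norm_eq_abs]
      rfl
    exact (hK.comp h1).weaken (by simp [K'])
  have hK' : (0 : ℝ) < K' := by positivity
  let v : ℝ := (volume (Metric.ball y₀ r)).toReal
  have hvtop : volume (Metric.ball y₀ r) ≠ ⊤ := measure_ball_lt_top.ne
  have hv : 0 < v := ENNReal.toReal_pos (Metric.measure_ball_pos _ _ hr).ne' hvtop
  have key : ∀ ε, 0 ≤ ε → ε ≤ ε₀ →
      ENNReal.ofReal (v / K' * ε) ≤ volume {y | y ∈ Ω ∧ 0 < h y ∧ h y ≤ ε} := by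
    intro ε hε hεε
    let P : Set (E × ℝ) := {q | q.1 ∈ Metric.ball y₀ r ∧ q.2 ∈ Set.Icc (0 : ℝ) 1 ∧
      h (q.1 + q.2 • e) ∈ Set.Ioc 0 ε}
    have hq : Continuous fun q : E × ℝ => h (q.1 + q.2 • e) := by fun_prop
    have hP : MeasurableSet P :=
      (measurable_fst measurableSet_ball).inter
        ((measurable_snd measurableSet_Icc).inter (hq.measurable measurableSet_Ioc))
    have hmem : ∀ z ∈ Metric.ball y₀ r, ∀ t ∈ Set.Icc (0 : ℝ) 1, z + t • e ∈ Ω := by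
      intro z hz t ht
      have hu : ‖z - y₀‖ < r := by simpa [dist_eq_norm] using hz
      have h1 := (hr0 _ hu).1.1
      have h2 := (hr0 _ hu).2.1
      have h3 := hΩ h1 h2 (sub_nonneg.2 ht.2) ht.1 (by ring)
      have : (1 - t) • (y₀ + (z - y₀)) + t • (y₁ + (z - y₀)) = z + t • e := by
        rw [he]; module
      rwa [this] at h3
    have hupper : (volume.prod volume) P ≤ volume {y | y ∈ Ω ∧ 0 < h y ∧ h y ≤ ε} := by
      rw [Measure.prod_apply_symm hP]
      calc ∫⁻ t, volume ((fun z => (z, t)) ⁻¹' P)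
          ≤ ∫⁻ t, (Set.Icc (0 : ℝ) 1).indicator
              (fun _ => volume {y | y ∈ Ω ∧ 0 < h y ∧ h y ≤ ε}) t := by
            refine lintegral_mono fun t => ?_
            by_cases ht : t ∈ Set.Icc (0 : ℝ) 1
            · rw [Set.indicator_of_mem ht, ← measure_preimage_add_right volume (t • e)
                {y | y ∈ Ω ∧ 0 < h y ∧ h y ≤ ε}]
              exact measure_mono fun z hz => ⟨hmem z hz.1 t ht, hz.2.2.1, hz.2.2.2⟩
            · rw [Set.indicator_of_notMem ht]
              refine le_of_eq (measure_mono_null (t := ∅) (fun z hz => ht hz.2.1) measure_empty)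
        _ = _ := by
            rw [lintegral_indicator measurableSet_Icc, setLIntegral_const]
            simp
    have hlower : ENNReal.ofReal (v / K' * ε) ≤ (volume.prod volume) P := by
      rw [Measure.prod_apply hP]
      calc ENNReal.ofReal (v / K' * ε)
          = ∫⁻ z, (Metric.ball y₀ r).indicator (fun _ => ENNReal.ofReal (ε / K')) z := by
            rw [lintegral_indicator measurableSet_ball, setLIntegral_const,
              ← ENNReal.ofReal_toReal hvtop, ← ENNReal.ofReal_mul (by positivity)]
            congr 1
            change v / K' * ε = ε / K' * v
            ring
        _ ≤ _ := by
            refine lintegral_mono fun z => ?_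
            by_cases hz : z ∈ Metric.ball y₀ r
            · rw [Set.indicator_of_mem hz]
              have hu : ‖z - y₀‖ < r := by simpa [dist_eq_norm] using hz
              have h1 := (hr0 _ hu).1.2
              have h2 := (hr0 _ hu).2.2
              rw [add_sub_cancel] at h1
              rw [show y₁ + (z - y₀) = z + (1 : ℝ) • e by rw [he]; module] at h2
              have hsub : Set.Ioc 0 ε ⊆
                  (fun t : ℝ => h (z + t • e)) '' (Prod.mk z ⁻¹' P) := by
                intro s hs
                have hivt := intermediate_value_Icc (zero_le_one (α := ℝ))
                  (hline z).continuous.continuousOn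
                have hs' : s ∈ Set.Icc (h (z + (0 : ℝ) • e)) (h (z + (1 : ℝ) • e)) := by
                  rw [zero_smul, add_zero]
                  exact ⟨by linarith [hs.1], by
                    have := min_le_left (h y₁ / 2) 1
                    linarith [hs.2]⟩
                obtain ⟨t, ht, hts⟩ := hivt hs'
                have hts' : h (z + t • e) = s := hts
                exact ⟨t, ⟨hz, ht, by simpa only [hts'] using hs⟩, hts⟩
              have h3 := ((hline z).lipschitzOnWith (s := Prod.mk z ⁻¹' P)).hausdorffMeasure_image_le
                (d := 1) zero_le_one
              rw [hausdorffMeasure_real] at h3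
              have h4 := (measure_mono hsub).trans h3
              rw [Real.volume_Ioc, sub_zero, ENNReal.rpow_one] at h4
              rw [ENNReal.ofReal_div_of_pos hK', ENNReal.ofReal_coe_nnreal]
              exact ENNReal.div_le_of_le_mul' h4
            · rw [Set.indicator_of_notMem hz]; exact zero_le
    exact hlower.trans hupper
  refine ⟨v / K' * ε₀, by positivity, fun ε hε => ?_⟩
  have h1 := key (ε₀ * ε) (mul_nonneg hε₀.le hε.1) (mul_le_of_le_one_right hε₀.le hε.2)
  rw [← mul_assoc] at h1
  refine h1.trans (measure_mono fun y hy => ⟨hy.1, hy.2.1, hy.2.2.trans ?_⟩)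
  exact mul_le_of_le_one_left hε.1 (min_le_right _ _)

theorem lipschitzWith_finset_inf' {α ι : Type*} [PseudoMetricSpace α] {s : Finset ι}
    (hs : s.Nonempty) {f : ι → α → ℝ} {K : NNReal} (hf : ∀ i ∈ s, LipschitzWith K (f i)) :
    LipschitzWith K fun a => s.inf' hs fun i => f i a := by
  refine LipschitzWith.of_le_add_mul K fun a b => ?_
  rw [← sub_le_iff_le_add, Finset.le_inf'_iff]
  intro i hi
  have h1 := (hf i hi).le_add_mul a b
  have h2 := Finset.inf'_le (fun i => f i a) hi
  linarith

section Monotonicity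

variable {d n : ℕ} {Ω : Set (EuclideanSpace ℝ (Fin d))} {ρ : EuclideanSpace ℝ (Fin d) → ℝ}
  {x : Fin n → EuclideanSpace ℝ (Fin d)} {w : Fin n → ℝ}

/-- The shifted cost `‖y - x i‖ ^ 2 - ψ i` without the term `‖y‖ ^ 2`. -/
noncomputable def affineCost (x : Fin n → EuclideanSpace ℝ (Fin d)) (ψ : EuclideanSpace ℝ (Fin n))
    (i : Fin n) (y : EuclideanSpace ℝ (Fin d)) : ℝ :=
  ‖x i‖ ^ 2 - 2 * inner ℝ (x i) y - ψ i

theorem cost_eq_affineCost (ψ : EuclideanSpace ℝ (Fin n)) (i : Fin n)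
    (y : EuclideanSpace ℝ (Fin d)) : ‖y - x i‖ ^ 2 - ψ i = ‖y‖ ^ 2 + affineCost x ψ i y := by
  rw [affineCost, norm_sub_sq_real, real_inner_comm]; ring

theorem mem_laguerreCell_iff_affineCost {ψ : EuclideanSpace ℝ (Fin n)} {i : Fin n}
    {y : EuclideanSpace ℝ (Fin d)} :
    y ∈ laguerreCell Ω x ψ i ↔ y ∈ Ω ∧ ∀ j, affineCost x ψ i y ≤ affineCost x ψ j y := by
  simp only [laguerreCell, cost_eq_affineCost, add_le_add_iff_left]
  refine and_congr_right fun _ => ⟨fun h j => ?_, fun h j _ => h j⟩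
  by_cases hj : j = i
  · rw [hj]
  · exact h j hj

theorem exists_lipschitzWith_affineCost (x : Fin n → EuclideanSpace ℝ (Fin d))
    (ψ : EuclideanSpace ℝ (Fin n)) : ∃ K : NNReal, ∀ i, LipschitzWith K (affineCost x ψ i) := by
  refine ⟨∑ i, 2 * ‖x i‖₊, fun i => ?_⟩
  have h : LipschitzWith (2 * ‖x i‖₊) (affineCost x ψ i) := by
    refine LipschitzWith.of_dist_le_mul fun y z => ?_
    rw [Real.dist_eq, dist_eq_norm]
    have h1 : affineCost x ψ i y - affineCost x ψ i z = -(2 * inner ℝ (x i) (y - z)) := by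
      simp only [affineCost, inner_sub_right]; ring
    rw [h1, abs_neg, abs_mul, abs_two]
    have := abs_real_inner_le_norm (x i) (y - z)
    push_cast
    linarith
  exact h.weaken (Finset.single_le_sum (f := fun i => 2 * ‖x i‖₊) (fun _ _ => zero_le)
    (Finset.mem_univ i))

theorem volume_affineCost_tie (hx : Function.Injective x) (ψ : EuclideanSpace ℝ (Fin n))
    {i j : Fin n} (hij : i ≠ j) :
    volume {y | affineCost x ψ i y = affineCost x ψ j y} = 0 := by
  refine measure_mono_null (fun y hy => ?_)
    (volume_hyperplane_eq_zero (sub_ne_zero.2 fun h => hij (hx h).symm : x j - x i ≠ 0)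
      (cellThreshold x ψ i j))
  have hy' : affineCost x ψ i y = affineCost x ψ j y := hy
  change inner ℝ (x j - x i) y = cellThreshold x ψ i j
  simp only [affineCost] at hy'
  rw [cellThreshold, inner_sub_left]
  linarith

/-- Cells of positive mass contain interior points at which they strictly win. -/
theorem exists_mem_interior_inf'_lt (hΩc : Convex ℝ Ω) (hx : Function.Injective x)
    {ψ : EuclideanSpace ℝ (Fin n)} {i : Fin n} (hi : 0 < volume (laguerreCell Ω x ψ i))
    {I J : Finset (Fin n)} (hiI : i ∈ I) (hiJ : i ∉ J) (hJ : J.Nonempty) :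
    ∃ y ∈ interior Ω, I.inf' ⟨i, hiI⟩ (fun k => affineCost x ψ k y) <
      J.inf' hJ (fun k => affineCost x ψ k y) := by
  by_contra! hcon
  have hsub : laguerreCell Ω x ψ i ⊆
      frontier Ω ∪ ⋃ j ∈ J, {y | affineCost x ψ i y = affineCost x ψ j y} := by
    intro y hy
    rw [mem_laguerreCell_iff_affineCost] at hy
    by_cases hyi : y ∈ interior Ω
    · right
      obtain ⟨j, hj, hjy⟩ := Finset.exists_mem_eq_inf' hJ fun k => affineCost x ψ k y
      refine Set.mem_iUnion₂.2 ⟨j, hj, le_antisymm (hy.2 j) ?_⟩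
      rw [← hjy]
      exact (hcon y hyi).trans (Finset.inf'_le _ hiI)
    · exact Or.inl ⟨subset_closure hy.1, hyi⟩
  refine hi.ne' (measure_mono_null hsub (measure_union_null (hΩc.addHaar_frontier volume) ?_))
  refine (measure_biUnion_null_iff J.countable_toSet).2 fun j hj => ?_
  exact volume_affineCost_tie hx ψ fun h => hiJ (h ▸ hj)

theorem aedisjoint_laguerreCell (hx : Function.Injective x) (ψ : EuclideanSpace ℝ (Fin n))
    {i j : Fin n} (hij : i ≠ j) :
    AEDisjoint (sourceMeasure Ω ρ) (laguerreCell Ω x ψ i) (laguerreCell Ω x ψ j) := by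
  refine measure_mono_null (fun y hy => ?_)
    (sourceMeasure_absolutelyContinuous (volume_affineCost_tie hx ψ hij))
  obtain ⟨h1, h2⟩ := hy
  rw [mem_laguerreCell_iff_affineCost] at h1 h2
  exact le_antisymm (h1.2 j) (h2.2 i)

theorem sum_measureReal_laguerreCell_eq (hΩ : IsCompact Ω)
    [IsFiniteMeasure (sourceMeasure Ω ρ)] (hx : Function.Injective x)
    (ψ : EuclideanSpace ℝ (Fin n)) (I : Finset (Fin n)) :
    ∑ i ∈ I, (sourceMeasure Ω ρ).real (laguerreCell Ω x ψ i) =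
      (sourceMeasure Ω ρ).real (⋃ i ∈ I, laguerreCell Ω x ψ i) := by
  rw [measureReal_def, measure_biUnion_finset₀ (fun i _ j _ hij => aedisjoint_laguerreCell hx ψ hij)
    fun i _ => (isClosed_laguerreCell hΩ.isClosed ψ i).measurableSet.nullMeasurableSet,
    ENNReal.toReal_sum fun i _ => measure_ne_top _ _]
  rfl

/-- Moving `ψ` in a non-constant direction moves mass, at a linear rate, into the cells for which
the direction has the largest components. -/
theorem exists_mass_growth (hΩ : IsCompact Ω) (hΩc : Convex ℝ Ω)
    [IsProbabilityMeasure (sourceMeasure Ω ρ)] (hx : Function.Injective x) {ρmin : ℝ}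
    (hρmin : 0 < ρmin) (hρ : ∀ y ∈ Ω, ρmin ≤ ρ y) {ψ δ : EuclideanSpace ℝ (Fin n)}
    (hψ : ∀ i, 0 < (sourceMeasure Ω ρ).real (laguerreCell Ω x ψ i))
    (hδ : ∃ i j, δ i < δ j) :
    ∃ (I : Finset (Fin n)) (c : ℝ), 0 < c ∧ ∀ t ∈ Set.Icc (0 : ℝ) 1,
      c * t ≤ ∑ i ∈ I, ((sourceMeasure Ω ρ).real (laguerreCell Ω x (ψ + t • δ) i) -
        (sourceMeasure Ω ρ).real (laguerreCell Ω x ψ i)) := by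
  classical
  obtain ⟨i₀, j₀, hij₀⟩ := hδ
  obtain ⟨a, -, ha⟩ := Finset.exists_max_image Finset.univ (fun i => δ i) ⟨i₀, Finset.mem_univ _⟩
  let I : Finset (Fin n) := Finset.univ.filter fun i => δ i = δ a
  let J : Finset (Fin n) := Finset.univ.filter fun i => δ i ≠ δ a
  have haI : a ∈ I := by simp [I]
  have haJ : a ∉ J := by simp [J]
  have hi₀J : i₀ ∈ J := by
    have := ha j₀ (Finset.mem_univ _)
    simp only [J, Finset.mem_filter, Finset.mem_univ, true_and]
    intro h; linarith
  have hi₀I : i₀ ∉ I := by simpa [I, J] using hi₀J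
  have hIJ : ∀ i, i ∈ I ∨ i ∈ J := fun i => by simp [I, J, em]
  have hI : I.Nonempty := ⟨a, haI⟩
  have hJ : J.Nonempty := ⟨i₀, hi₀J⟩
  obtain ⟨γ, hγ0, hγ1, hγ⟩ : ∃ γ : ℝ, 0 < γ ∧ γ ≤ 1 ∧ ∀ j ∈ J, γ ≤ δ a - δ j := by
    obtain ⟨b, hb, hbmin⟩ := Finset.exists_min_image J (fun j => δ a - δ j) hJ
    have hb' : δ b ≠ δ a := (Finset.mem_filter.1 hb).2
    have hba : δ b < δ a := lt_of_le_of_ne (ha b (Finset.mem_univ _)) hb'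
    exact ⟨min (δ a - δ b) 1, lt_min (by linarith) one_pos, min_le_right _ _,
      fun j hj => (min_le_left _ _).trans (hbmin j hj)⟩
  let h : EuclideanSpace ℝ (Fin d) → ℝ := fun y =>
    I.inf' hI (fun k => affineCost x ψ k y) - J.inf' hJ (fun k => affineCost x ψ k y)
  obtain ⟨K, hK⟩ := exists_lipschitzWith_affineCost x ψ
  have hLip : LipschitzWith (K + K) h :=
    (lipschitzWith_finset_inf' hI fun i _ => hK i).sub (lipschitzWith_finset_inf' hJ fun i _ => hK i)
  have hvol : ∀ i, 0 < volume (laguerreCell Ω x ψ i) := fun i => by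
    refine pos_iff_ne_zero.2 fun h0 => ?_
    have := hψ i
    rw [measureReal_def, sourceMeasure_absolutelyContinuous h0] at this
    simp at this
  obtain ⟨y₀, hy₀, hlt₀⟩ := exists_mem_interior_inf'_lt hΩc hx (hvol a) haI haJ hJ
  obtain ⟨y₁, hy₁, hlt₁⟩ := exists_mem_interior_inf'_lt hΩc hx (hvol i₀) hi₀J hi₀I hI
  obtain ⟨c, hc, hcvol⟩ := exists_le_volume_level hΩc hLip hy₀ hy₁ (sub_neg.2 hlt₀) (sub_pos.2 hlt₁)
  refine ⟨I, ρmin * (c * γ), by positivity, fun t ht => ?_⟩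
  have htγ : t * γ ∈ Set.Icc (0 : ℝ) 1 :=
    ⟨mul_nonneg ht.1 hγ0.le, mul_le_one₀ ht.2 hγ0.le hγ1⟩
  rw [Finset.sum_sub_distrib, sum_measureReal_laguerreCell_eq hΩ hx,
    sum_measureReal_laguerreCell_eq hΩ hx]
  set U := ⋃ i ∈ I, laguerreCell Ω x ψ i with hU
  set V := ⋃ i ∈ I, laguerreCell Ω x (ψ + t • δ) i with hV
  set S := {y | y ∈ Ω ∧ 0 < h y ∧ h y ≤ t * γ} with hS
  have hshift : ∀ i y, affineCost x (ψ + t • δ) i y = affineCost x ψ i y - t * δ i := by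
    intro i y
    simp only [affineCost, PiLp.add_apply, PiLp.smul_apply, smul_eq_mul]; ring
  have hUV : U ⊆ V := by
    refine Set.iUnion₂_mono fun i hi y hy => ?_
    rw [mem_laguerreCell_iff_affineCost] at hy ⊢
    refine ⟨hy.1, fun j => ?_⟩
    rw [hshift, hshift, (Finset.mem_filter.1 hi).2]
    have h1 := mul_le_mul_of_nonneg_left (ha j (Finset.mem_univ _)) ht.1
    have h2 := hy.2 j
    linarith
  have hSV : S ⊆ V := by
    rintro y ⟨hyΩ, -, hy⟩
    obtain ⟨i, hi, hiy⟩ := Finset.exists_mem_eq_inf' hI fun k => affineCost x ψ k y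
    have hy' : affineCost x ψ i y - J.inf' hJ (fun k => affineCost x ψ k y) ≤ t * γ := by
      rw [← hiy]; exact hy
    refine Set.mem_iUnion₂.2 ⟨i, hi, ?_⟩
    rw [mem_laguerreCell_iff_affineCost]
    refine ⟨hyΩ, fun j => ?_⟩
    rw [hshift, hshift, (Finset.mem_filter.1 hi).2]
    rcases hIJ j with hj | hj
    · rw [(Finset.mem_filter.1 hj).2]
      have : affineCost x ψ i y ≤ affineCost x ψ j y := by
        rw [← hiy]; exact Finset.inf'_le _ hj
      linarith
    · have h1 := Finset.inf'_le (fun k => affineCost x ψ k y) hj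
      have h2 := mul_le_mul_of_nonneg_left (hγ j hj) ht.1
      linarith
  have hUS : Disjoint U S := by
    rw [Set.disjoint_left]
    intro y hyU hyS
    obtain ⟨i, hi, hy⟩ := Set.mem_iUnion₂.1 hyU
    rw [mem_laguerreCell_iff_affineCost] at hy
    have h1 := Finset.inf'_le (fun k => affineCost x ψ k y) hi
    have h2 : affineCost x ψ i y ≤ J.inf' hJ (fun k => affineCost x ψ k y) :=
      Finset.le_inf' _ _ fun j _ => hy.2 j
    have h3 : 0 < I.inf' hI (fun k => affineCost x ψ k y) -
      J.inf' hJ (fun k => affineCost x ψ k y) := hyS.2.1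
    linarith
  have hUm : MeasurableSet U := Finset.measurableSet_biUnion _ fun i _ =>
    (isClosed_laguerreCell hΩ.isClosed ψ i).measurableSet
  have hsum : (sourceMeasure Ω ρ).real U + (sourceMeasure Ω ρ).real S ≤
      (sourceMeasure Ω ρ).real V := by
    rw [← measureReal_union' hUS hUm (measure_ne_top _ _) (measure_ne_top _ _)]
    exact measureReal_mono (h₂ := measure_ne_top _ _) (Set.union_subset hUV hSV)
  have hSm : ρmin * (c * γ) * t ≤ (sourceMeasure Ω ρ).real S := by
    refine (ENNReal.ofReal_le_iff_le_toReal (measure_ne_top _ _)).1 ?_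
    refine le_trans ?_ (le_sourceMeasure hΩ.measurableSet hρ S)
    rw [show ρmin * (c * γ) * t = ρmin * (c * (t * γ)) by ring, ENNReal.ofReal_mul hρmin.le]
    refine mul_le_mul' le_rfl ((hcvol _ htγ).trans (measure_mono fun y hy => ⟨hy.1, hy⟩))
  linarith

theorem exists_lt_of_mem_zeroMeanSubmodule {δ : EuclideanSpace ℝ (Fin n)}
    (hδ : δ ∈ zeroMeanSubmodule n) (h0 : δ ≠ 0) : ∃ i j, δ i < δ j := by
  by_contra! h
  refine h0 ?_
  ext i
  have hsum : ∑ j, δ j = 0 := hδ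
  rw [Finset.sum_congr rfl fun j _ => le_antisymm (h i j) (h j i)] at hsum
  have hn : (n : ℝ) ≠ 0 := by
    have : 0 < n := Fin.pos i
    positivity
  simpa [hn] using hsum

/-- Zero-mean vectors with the same prescribed cell masses coincide. -/
theorem eq_of_excessMass_eq_zero (hΩ : IsCompact Ω) (hΩc : Convex ℝ Ω)
    [IsProbabilityMeasure (sourceMeasure Ω ρ)] (hx : Function.Injective x) {ρmin : ℝ}
    (hρmin : 0 < ρmin) (hρ : ∀ y ∈ Ω, ρmin ≤ ρ y) (hw : ∀ i, 0 < w i)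
    {φ ψ : EuclideanSpace ℝ (Fin n)} (hφ : φ ∈ zeroMeanSubmodule n)
    (hψ : ψ ∈ zeroMeanSubmodule n) (hGφ : excessMass Ω ρ x w φ = 0)
    (hGψ : excessMass Ω ρ x w ψ = 0) : φ = ψ := by
  have hmass : ∀ χ, excessMass Ω ρ x w χ = 0 →
      ∀ i, (sourceMeasure Ω ρ).real (laguerreCell Ω x χ i) = w i := by
    intro χ hχ i
    have : excessMass Ω ρ x w χ i = 0 := by rw [hχ]; rfl
    exact sub_eq_zero.1 this
  by_contra hne
  obtain ⟨I, c, hc, h⟩ := exists_mass_growth hΩ hΩc hx hρmin hρ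
    (fun i => by rw [hmass ψ hGψ i]; exact hw i)
    (exists_lt_of_mem_zeroMeanSubmodule (Submodule.sub_mem _ hφ hψ) (sub_ne_zero.2 hne))
  have h1 := h 1 (Set.right_mem_Icc.2 zero_le_one)
  rw [one_smul, add_sub_cancel] at h1
  simp only [hmass _ hGφ, hmass _ hGψ, sub_self, Finset.sum_const_zero] at h1
  linarith

/-- The derivative of the excess mass is injective on zero-mean vectors. -/
theorem fderiv_excessMass_ne_zero (hΩ : IsCompact Ω) (hΩc : Convex ℝ Ω)
    [IsProbabilityMeasure (sourceMeasure Ω ρ)] (hx : Function.Injective x) {ρmin : ℝ}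
    (hρmin : 0 < ρmin) (hρ : ∀ y ∈ Ω, ρmin ≤ ρ y) {ψ δ : EuclideanSpace ℝ (Fin n)}
    (hψ : ∀ i, 0 < (sourceMeasure Ω ρ).real (laguerreCell Ω x ψ i))
    (hdiff : DifferentiableAt ℝ (excessMass Ω ρ x w) ψ)
    (hδ : δ ∈ zeroMeanSubmodule n) (h0 : δ ≠ 0) : fderiv ℝ (excessMass Ω ρ x w) ψ δ ≠ 0 := by
  obtain ⟨I, c, hc, h⟩ := exists_mass_growth hΩ hΩc hx hρmin hρ hψ
    (exists_lt_of_mem_zeroMeanSubmodule hδ h0)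
  have h1 : Tendsto (fun N : ℕ => ((N : ℝ) + 1)) atTop atTop :=
    tendsto_atTop_add_const_right _ _ tendsto_natCast_atTop_atTop
  have hlim := hdiff.hasFDerivAt.lim δ (tendsto_abs_atTop_atTop.comp h1)
  have hcl : IsClosed {u : EuclideanSpace ℝ (Fin n) | c ≤ ∑ i ∈ I, u i} :=
    isClosed_le continuous_const (by fun_prop)
  have hmem := hcl.mem_of_tendsto hlim (Eventually.of_forall fun N => by
    have hN : (0 : ℝ) < (N : ℝ) + 1 := by positivity
    have h2 := h ((N : ℝ) + 1)⁻¹ ⟨by positivity, inv_le_one_of_one_le₀ (by simp)⟩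
    rw [← div_eq_mul_inv, div_le_iff₀' hN, Finset.mul_sum] at h2
    simpa [excessMass] using h2)
  intro hz
  rw [hz] at hmem
  have : c ≤ ∑ i ∈ I, (0 : EuclideanSpace ℝ (Fin n)) i := hmem
  simp at this
  linarith

end Monotonicity

/-! ## Second differences of the cell masses -/

/-- Integrals of a Lipschitz density over thin slabs of a polyhedron: the dependence on the
position of the slab and on the right-hand sides `β` of the inequalities is Lipschitz, with a
constant proportional to the width of the slab, as long as no face of the polyhedron that is
parallel to the slab comes close to it. -/
theorem exists_slab_integral_sub_le {E : Type*} [NormedAddCommGroup E] [InnerProductSpace ℝ E]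
    [FiniteDimensional ℝ E] [MeasurableSpace E] [BorelSpace E] {κ : Type*} [Fintype κ]
    {a : E} (ha : a ≠ 0) (c : κ → E) {D : E → ℝ} {KD : NNReal} (hD : LipschitzWith KD D) (R : ℝ) :
    ∃ C : ℝ, 0 ≤ C ∧ ∀ (α α' s η : ℝ) (β β' : κ → ℝ), 0 ≤ s → η ≤ 1 → |α' - α| ≤ η →
      (∀ k, |β' k - β k| ≤ η) → (∀ y, (∀ k, inner ℝ (c k) y ≤ β k) → ‖y‖ ≤ R) →
      (∀ y, (∀ k, inner ℝ (c k) y ≤ β' k) → ‖y‖ ≤ R) →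
      (∀ k, ¬LinearIndependent ℝ ![a, c k] → ∀ y, inner ℝ a y ∈ Set.Ioc (α - s) α →
        (inner ℝ (c k) y ≤ β k ↔
          inner ℝ (c k) (y + ((α' - α) / ‖a‖ ^ 2) • a) ≤ β' k)) →
      |(∫ y in {y | inner ℝ a y ∈ Set.Ioc (α - s) α ∧ ∀ k, inner ℝ (c k) y ≤ β k}, D y) -
        ∫ y in {y | inner ℝ a y ∈ Set.Ioc (α' - s) α' ∧ ∀ k, inner ℝ (c k) y ≤ β' k}, D y| ≤
        C * s * η := by
  classical
  have ha0 : 0 < ‖a‖ := norm_pos_iff.2 ha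
  let R' : ℝ := R + 1 / ‖a‖
  obtain ⟨C₀, hC₀, hslab⟩ := exists_volume_slab_le ha R'
  have hdouble : ∀ k, ∃ C : ℝ, 0 ≤ C ∧ (LinearIndependent ℝ ![a, c k] →
      ∀ lo hi lo' hi' : ℝ, lo ≤ hi → lo' ≤ hi' →
      volume {y : E | ‖y‖ ≤ R' ∧ inner ℝ a y ∈ Set.Icc lo hi ∧
        inner ℝ (c k) y ∈ Set.Icc lo' hi'} ≤ ENNReal.ofReal (C * ((hi - lo) * (hi' - lo')))) := by
    intro k
    by_cases hk : LinearIndependent ℝ ![a, c k]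
    · obtain ⟨C, hC, h⟩ := exists_volume_two_slabs_le hk R'
      exact ⟨C, hC, fun _ => h⟩
    · exact ⟨0, le_rfl, fun h => absurd h hk⟩
  choose C₁ hC₁ hslab₂ using hdouble
  obtain ⟨M, hM⟩ := (isCompact_closedBall (0 : E) (R' + 1 / ‖a‖)).exists_bound_of_continuousOn
    hD.continuous.continuousOn
  have hq : ∀ k, 0 ≤ 1 + ‖c k‖ / ‖a‖ := fun k => by positivity
  refine ⟨KD / ‖a‖ * C₀ + ∑ k, |M| * (C₁ k * (2 * (1 + ‖c k‖ / ‖a‖))),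
    add_nonneg (by positivity) (Finset.sum_nonneg fun k _ => mul_nonneg (abs_nonneg _)
      (mul_nonneg (hC₁ k) (by linarith [hq k]))),
    fun α α' s η β β' hs hη hα hβ hP hP' hpar => ?_⟩
  have hη0 : 0 ≤ η := (abs_nonneg _).trans hα
  set τ : E := ((α' - α) / ‖a‖ ^ 2) • a with hτ
  have haτ : inner ℝ a τ = α' - α := by
    rw [hτ, inner_smul_right, real_inner_self_eq_norm_sq]
    field_simp
  have hτn : ‖τ‖ ≤ η / ‖a‖ := by
    rw [hτ, norm_smul, Real.norm_eq_abs, abs_div, abs_of_nonneg (sq_nonneg ‖a‖)]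
    calc |α' - α| / ‖a‖ ^ 2 * ‖a‖ = |α' - α| / ‖a‖ := by field_simp
      _ ≤ _ := by gcongr
  have hτ1 : ‖τ‖ ≤ 1 / ‖a‖ := hτn.trans (by gcongr)
  have hclosed : ∀ b : κ → ℝ, MeasurableSet {y : E | ∀ k, inner ℝ (c k) y ≤ b k} := fun b => by
    have : {y : E | ∀ k, inner ℝ (c k) y ≤ b k} = ⋂ k, {y | inner ℝ (c k) y ≤ b k} := by
      ext y; simp
    rw [this]
    exact (isClosed_iInter fun k => isClosed_le (by fun_prop) (by fun_prop)).measurableSet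
  have hmeas : ∀ (t : ℝ) (b : κ → ℝ), MeasurableSet {y : E | inner ℝ a y ∈ Set.Ioc (t - s) t ∧
      ∀ k, inner ℝ (c k) y ≤ b k} := fun t b =>
    ((Continuous.measurable (by fun_prop : Continuous fun y : E => (inner ℝ a y : ℝ)))
      measurableSet_Ioc).inter (hclosed b)
  set A := {y : E | inner ℝ a y ∈ Set.Ioc (α - s) α ∧ ∀ k, inner ℝ (c k) y ≤ β k} with hA
  set A' := {y : E | inner ℝ a y ∈ Set.Ioc (α' - s) α' ∧ ∀ k, inner ℝ (c k) y ≤ β' k} with hA'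
  set B := {y : E | y + τ ∈ A'} with hB
  have hAm : MeasurableSet A := hmeas α β
  have hA'm : MeasurableSet A' := hmeas α' β'
  have hBm : MeasurableSet B := (measurable_add_const τ) hA'm
  have hBslab : ∀ y ∈ B, inner ℝ a y ∈ Set.Ioc (α - s) α := by
    intro y hy
    have := hy.1
    rw [inner_add_right, haτ] at this
    exact ⟨by linarith [this.1], by linarith [this.2]⟩
  have hAR : ∀ y ∈ A, ‖y‖ ≤ R' := fun y hy => (hP y hy.2).trans (by
    have : 0 ≤ 1 / ‖a‖ := by positivity
    simp only [R']; linarith)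
  have hBR : ∀ y ∈ B, ‖y‖ ≤ R' := fun y hy => by
    have h1 := hP' _ hy.2
    have h2 : ‖y‖ ≤ ‖y + τ‖ + ‖τ‖ := by
      simpa using norm_sub_le (y + τ) τ
    simp only [R']; linarith
  have hshift : ∫ y in A', D y = ∫ y in B, D (y + τ) := by
    rw [← integral_indicator hA'm, ← integral_indicator hBm,
      ← integral_add_right_eq_self (fun y => A'.indicator D y) τ]
    rfl
  have hbound : ∀ y, ‖y‖ ≤ R' → |D (y + τ)| ≤ |M| := fun y hy => by
    refine (hM (y + τ) ?_).trans (le_abs_self M)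
    rw [mem_closedBall_zero_iff]
    exact (norm_add_le _ _).trans (by linarith)
  let S : Set E := {y | ‖y‖ ≤ R' ∧ inner ℝ a y ∈ Set.Icc (α - s) α}
  let T : κ → Set E := fun k => {y | ‖y‖ ≤ R' ∧ inner ℝ a y ∈ Set.Icc (α - s) α ∧
    inner ℝ (c k) y ∈ Set.Icc (β k - (1 + ‖c k‖ / ‖a‖) * η) (β k + (1 + ‖c k‖ / ‖a‖) * η)}
  let κ' : Finset κ := Finset.univ.filter fun k => LinearIndependent ℝ ![a, c k]
  have hSm : MeasurableSet S :=
    ((isClosed_le continuous_norm continuous_const).inter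
      (isClosed_Icc.preimage (by fun_prop : Continuous fun y : E => (inner ℝ a y : ℝ)))).measurableSet
  have hTm : ∀ k, MeasurableSet (T k) := fun k =>
    ((isClosed_le continuous_norm continuous_const).inter
      ((isClosed_Icc.preimage (by fun_prop : Continuous fun y : E => (inner ℝ a y : ℝ))).inter
      (isClosed_Icc.preimage
        (by fun_prop : Continuous fun y : E => (inner ℝ (c k) y : ℝ))))).measurableSet
  have hSvol : volume S ≤ ENNReal.ofReal (C₀ * s) := by
    have := hslab (α - s) α (by linarith)
    rwa [sub_sub_cancel] at this
  have hTvol : ∀ k ∈ κ', volume (T k) ≤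
      ENNReal.ofReal (C₁ k * (2 * (1 + ‖c k‖ / ‖a‖)) * s * η) := by
    intro k hk
    have := hslab₂ k (Finset.mem_filter.1 hk).2 (α - s) α
      (β k - (1 + ‖c k‖ / ‖a‖) * η) (β k + (1 + ‖c k‖ / ‖a‖) * η) (by linarith)
      (by have := mul_nonneg (hq k) hη0; linarith)
    refine this.trans (le_of_eq ?_)
    congr 1; ring
  have hcτ : ∀ k, |inner ℝ (c k) τ| ≤ ‖c k‖ / ‖a‖ * η := fun k =>
    (abs_real_inner_le_norm _ _).trans (by
      calc ‖c k‖ * ‖τ‖ ≤ ‖c k‖ * (η / ‖a‖) := by gcongr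
        _ = _ := by ring)
  have hcover : ∀ y, inner ℝ a y ∈ Set.Ioc (α - s) α → ‖y‖ ≤ R' →
      ¬((y ∈ A) ↔ (y ∈ B)) → ∃ k ∈ κ', y ∈ T k := by
    intro y hy hyR hAB
    have hex : ∃ k, ¬(inner ℝ (c k) y ≤ β k ↔ inner ℝ (c k) (y + τ) ≤ β' k) := by
      by_contra! hall
      refine hAB ⟨fun h => ⟨?_, fun k => (hall k).1 (h.2 k)⟩,
        fun h => ⟨hy, fun k => (hall k).2 (h.2 k)⟩⟩
      rw [inner_add_right, haτ]
      exact ⟨by linarith [hy.1], by linarith [hy.2]⟩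
    obtain ⟨k, hk⟩ := hex
    have hki : LinearIndependent ℝ ![a, c k] := by
      by_contra h
      exact hk (hpar k h y hy)
    refine ⟨k, by simp [κ', hki], hyR, ⟨hy.1.le, hy.2⟩, ?_⟩
    have h1 := abs_le.1 (hcτ k)
    have h2 := abs_le.1 (hβ k)
    rw [inner_add_right] at hk
    have h3 : 0 ≤ ‖c k‖ / ‖a‖ * η := by positivity
    rw [add_mul, one_mul]
    by_cases h4 : inner ℝ (c k) y ≤ β k
    · have h5 : ¬(inner ℝ (c k) y + inner ℝ (c k) τ ≤ β' k) := fun h => hk ⟨fun _ => h, fun _ => h4⟩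
      push Not at h5
      constructor <;> linarith [h1.1, h1.2, h2.1, h2.2]
    · have h5 : inner ℝ (c k) y + inner ℝ (c k) τ ≤ β' k := by
        by_contra h
        exact hk ⟨fun h' => absurd h' h4, fun h' => absurd h' h⟩
      push Not at h4
      constructor <;> linarith [h1.1, h1.2, h2.1, h2.2]
  have hfin : ∀ {U : Set E}, (∀ y ∈ U, ‖y‖ ≤ R') → volume U ≠ ⊤ := fun {U} hU =>
    ((measure_mono fun y hy => mem_closedBall_zero_iff.2 (hU y hy)).trans_lt
      (measure_closedBall_lt_top (x := (0 : E)) (r := R'))).ne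
  have hintA : IntegrableOn D A := by
    refine Measure.integrableOn_of_bounded (M := M) (hfin hAR)
      hD.continuous.aestronglyMeasurable ?_
    filter_upwards [ae_restrict_mem hAm] with y hy
    refine hM y (mem_closedBall_zero_iff.2 ((hAR y hy).trans ?_))
    have : 0 ≤ 1 / ‖a‖ := by positivity
    linarith
  have hintB : IntegrableOn (fun y => D (y + τ)) B := by
    refine Measure.integrableOn_of_bounded (M := |M|) (hfin hBR)
      (hD.continuous.comp (continuous_add_const τ)).aestronglyMeasurable ?_
    filter_upwards [ae_restrict_mem hBm] with y hy using hbound y (hBR y hy)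
  have hSint : Integrable (S.indicator fun _ => (KD : ℝ) * ‖τ‖) :=
    (integrable_indicator_iff hSm).2 (integrableOn_const (hfin fun y hy => hy.1))
  have hTint : ∀ k, Integrable ((T k).indicator fun _ => |M|) := fun k =>
    (integrable_indicator_iff (hTm k)).2 (integrableOn_const (hfin fun y hy => hy.1))
  have hpt : ∀ y, ‖A.indicator D y - B.indicator (fun y => D (y + τ)) y‖ ≤
      S.indicator (fun _ => (KD : ℝ) * ‖τ‖) y + ∑ k ∈ κ', (T k).indicator (fun _ => |M|) y := by
    intro y
    have hS0 : 0 ≤ S.indicator (fun _ => (KD : ℝ) * ‖τ‖) y :=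
      Set.indicator_nonneg (fun _ _ => by positivity) y
    have hT0 : ∀ k, 0 ≤ (T k).indicator (fun _ => |M|) y := fun k =>
      Set.indicator_nonneg (fun _ _ => abs_nonneg _) y
    have hT1 : 0 ≤ ∑ k ∈ κ', (T k).indicator (fun _ => |M|) y := Finset.sum_nonneg fun k _ => hT0 k
    have hTk : (∃ k ∈ κ', y ∈ T k) → |M| ≤ ∑ k ∈ κ', (T k).indicator (fun _ => |M|) y := by
      rintro ⟨k, hk, hyk⟩
      refine le_trans ?_ (Finset.single_le_sum (fun k _ => hT0 k) hk)
      rw [Set.indicator_of_mem hyk]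
    by_cases hyA : y ∈ A <;> by_cases hyB : y ∈ B
    · have hyS : y ∈ S := ⟨hAR y hyA, hyA.1.1.le, hyA.1.2⟩
      rw [Set.indicator_of_mem hyA, Set.indicator_of_mem hyB, Set.indicator_of_mem hyS]
      have := hD.norm_sub_le y (y + τ)
      rw [sub_add_cancel_left, norm_neg] at this
      linarith
    · have h := hTk (hcover y hyA.1 (hAR y hyA) fun h => hyB (h.1 hyA))
      rw [Set.indicator_of_mem hyA, Set.indicator_of_notMem hyB, sub_zero]
      have := (hM y (mem_closedBall_zero_iff.2 ((hAR y hyA).trans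
        (by have : 0 ≤ 1 / ‖a‖ := by positivity
            linarith)))).trans (le_abs_self M)
      linarith
    · have h := hTk (hcover y (hBslab y hyB) (hBR y hyB) fun h => hyA (h.2 hyB))
      rw [Set.indicator_of_notMem hyA, Set.indicator_of_mem hyB, zero_sub, norm_neg,
        Real.norm_eq_abs]
      have := hbound y (hBR y hyB)
      linarith
    · rw [Set.indicator_of_notMem hyA, Set.indicator_of_notMem hyB, sub_zero, norm_zero]
      linarith
  rw [hshift, ← integral_indicator hAm, ← integral_indicator hBm,
    ← integral_sub ((integrable_indicator_iff hAm).2 hintA) ((integrable_indicator_iff hBm).2 hintB)]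
  have hint := norm_integral_le_of_norm_le
    (hSint.add (integrable_finsetSum κ' fun k _ => hTint k)) (Eventually.of_forall hpt)
  refine hint.trans ?_
  rw [integral_add' hSint (integrable_finsetSum κ' fun k _ => hTint k)]
  have e1 : ∫ y, S.indicator (fun _ => (KD : ℝ) * ‖τ‖) y ≤ KD / ‖a‖ * C₀ * s * η := by
    rw [integral_indicator hSm, setIntegral_const, smul_eq_mul]
    have : volume.real S ≤ C₀ * s := ENNReal.toReal_le_of_le_ofReal (by positivity) hSvol
    calc volume.real S * (KD * ‖τ‖) ≤ C₀ * s * (KD * (η / ‖a‖)) := by gcongr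
      _ = _ := by ring
  have e2 : ∫ y, ∑ k ∈ κ', (T k).indicator (fun _ => |M|) y ≤
      (∑ k, |M| * (C₁ k * (2 * (1 + ‖c k‖ / ‖a‖)))) * s * η := by
    rw [integral_finsetSum _ fun k _ => hTint k, Finset.sum_mul, Finset.sum_mul]
    have hterm : ∀ k, 0 ≤ C₁ k * (2 * (1 + ‖c k‖ / ‖a‖)) * s * η := fun k =>
      mul_nonneg (mul_nonneg (mul_nonneg (hC₁ k) (by linarith [hq k])) hs) hη0
    refine (Finset.sum_le_sum fun k hk => ?_).trans (Finset.sum_le_sum_of_subset_of_nonneg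
      (Finset.subset_univ κ') fun k _ _ => ?_)
    · rw [integral_indicator (hTm k), setIntegral_const, smul_eq_mul]
      have : volume.real (T k) ≤ C₁ k * (2 * (1 + ‖c k‖ / ‖a‖)) * s * η :=
        ENNReal.toReal_le_of_le_ofReal (hterm k) (hTvol k hk)
      calc _ ≤ C₁ k * (2 * (1 + ‖c k‖ / ‖a‖)) * s * η * |M| :=
            mul_le_mul_of_nonneg_right this (abs_nonneg _)
        _ = _ := by ring
    · have := mul_nonneg (abs_nonneg M) (hterm k)
      linarith
  calc _ ≤ KD / ‖a‖ * C₀ * s * η + (∑ k, |M| * (C₁ k * (2 * (1 + ‖c k‖ / ‖a‖)))) * s * η :=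
        add_le_add e1 e2
    _ = _ := by ring

theorem exists_pos_forall_le {ι : Type*} [Fintype ι] {f : ι → ℝ} (hf : ∀ i, 0 < f i) :
    ∃ r : ℝ, 0 < r ∧ ∀ i, r ≤ f i := by
  rcases isEmpty_or_nonempty ι with h | h
  · exact ⟨1, one_pos, fun i => h.elim i⟩
  · obtain ⟨i, -, hi⟩ := Finset.exists_min_image Finset.univ f Finset.univ_nonempty
    exact ⟨f i, hf i, fun j => hi j (Finset.mem_univ j)⟩

section SecondDifferencesOfCells

variable {d n : ℕ} {Ω : Set (EuclideanSpace ℝ (Fin d))} {ρ : EuclideanSpace ℝ (Fin d) → ℝ}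
  {x : Fin n → EuclideanSpace ℝ (Fin d)} {w : Fin n → ℝ}

/-- The bisectors of `i` with two other points do not coincide if all cells have mass. -/
theorem cellThreshold_ne_of_parallel (hx : Function.Injective x) {ψ : EuclideanSpace ℝ (Fin n)}
    (hψ : ∀ i, 0 < volume (laguerreCell Ω x ψ i)) {i j l : Fin n} (hji : j ≠ i) (hli : l ≠ i)
    (hlj : l ≠ j) {γ : ℝ} (hγ : x l - x i = γ • (x j - x i)) :
    γ * cellThreshold x ψ i j ≠ cellThreshold x ψ i l := by
  intro hcoin
  have ha : x j - x i ≠ 0 := sub_ne_zero.2 fun h => hji (hx h)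
  have hnull := volume_hyperplane_eq_zero ha (cellThreshold x ψ i j)
  have hj : ∀ y, affineCost x ψ j y - affineCost x ψ i y =
      2 * (cellThreshold x ψ i j - inner ℝ (x j - x i) y) := fun y => by
    simp only [affineCost, cellThreshold, inner_sub_left]; ring
  have hl : ∀ y, affineCost x ψ l y - affineCost x ψ i y =
      2 * (γ * (cellThreshold x ψ i j - inner ℝ (x j - x i) y)) := fun y => by
    have h1 : inner ℝ (x l - x i) y = γ * inner ℝ (x j - x i) y := by
      rw [hγ, inner_smul_left]; simp
    have h2 : affineCost x ψ l y - affineCost x ψ i y =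
        2 * (cellThreshold x ψ i l - inner ℝ (x l - x i) y) := by
      simp only [affineCost, cellThreshold, inner_sub_left]; ring
    rw [h2, h1, ← hcoin]; ring
  have hγ0 : γ ≠ 0 := fun h => hli (hx (sub_eq_zero.1 (by rw [hγ, h, zero_smul])))
  have hγ1 : γ ≠ 1 := fun h => hlj (hx (sub_left_injective (b := x i) (by
    change x l - x i = x j - x i
    rw [hγ, h, one_smul])))
  have hcell : ∀ k, (∀ y ∈ laguerreCell Ω x ψ k,
      inner ℝ (x j - x i) y = cellThreshold x ψ i j) → False := fun k hk =>
    (hψ k).ne' (measure_mono_null hk hnull)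
  rcases lt_or_gt_of_ne hγ0 with hneg | hpos
  · refine hcell i fun y hy => ?_
    rw [mem_laguerreCell_iff_affineCost] at hy
    have h1 := hy.2 j
    have h2 := hy.2 l
    have h3 := hj y
    have h4 := hl y
    have h5 : cellThreshold x ψ i j - inner ℝ (x j - x i) y ≤ 0 :=
      nonpos_of_mul_nonneg_right (by linarith) hneg
    linarith
  · rcases lt_or_gt_of_ne hγ1 with hlt | hgt
    · refine hcell l fun y hy => ?_
      rw [mem_laguerreCell_iff_affineCost] at hy
      have h1 := hy.2 j
      have h2 := hy.2 i
      have h3 := hj y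
      have h4 := hl y
      have h5 : cellThreshold x ψ i j - inner ℝ (x j - x i) y ≤ 0 :=
        nonpos_of_mul_nonpos_right (by linarith) hpos
      have h6 : 0 ≤ cellThreshold x ψ i j - inner ℝ (x j - x i) y :=
        nonneg_of_mul_nonneg_right (a := 1 - γ) (by linarith) (by linarith)
      linarith
    · refine hcell j fun y hy => ?_
      rw [mem_laguerreCell_iff_affineCost] at hy
      have h1 := hy.2 l
      have h2 := hy.2 i
      have h3 := hj y
      have h4 := hl y
      have h6 : 0 ≤ cellThreshold x ψ i j - inner ℝ (x j - x i) y :=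
        nonneg_of_mul_nonneg_right (a := γ - 1) (by linarith) (by linarith)
      linarith

/-- The bisector of two points does not contain a face of `Ω` if all cells have mass. -/
theorem faceThreshold_ne_of_parallel (hx : Function.Injective x) {ψ : EuclideanSpace ℝ (Fin n)}
    (hψ : ∀ i, 0 < volume (laguerreCell Ω x ψ i)) {i j : Fin n} (hji : j ≠ i)
    {c : EuclideanSpace ℝ (Fin d)} {b γ : ℝ} (hc : c ≠ 0) (hΩc : ∀ y ∈ Ω, inner ℝ c y ≤ b)
    (hγ : c = γ • (x j - x i)) : γ * cellThreshold x ψ i j ≠ b := by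
  intro hcoin
  have ha : x j - x i ≠ 0 := sub_ne_zero.2 fun h => hji (hx h)
  have hnull := volume_hyperplane_eq_zero ha (cellThreshold x ψ i j)
  have hγ0 : γ ≠ 0 := fun h => hc (by rw [hγ, h, zero_smul])
  have hcell : ∀ k, (∀ y ∈ laguerreCell Ω x ψ k,
      inner ℝ (x j - x i) y = cellThreshold x ψ i j) → False := fun k hk =>
    (hψ k).ne' (measure_mono_null hk hnull)
  have hj : ∀ y, affineCost x ψ j y - affineCost x ψ i y =
      2 * (cellThreshold x ψ i j - inner ℝ (x j - x i) y) := fun y => by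
    simp only [affineCost, cellThreshold, inner_sub_left]; ring
  have hface : ∀ y ∈ Ω, 0 ≤ γ * (cellThreshold x ψ i j - inner ℝ (x j - x i) y) := by
    intro y hy
    have h1 := hΩc y hy
    rw [hγ, inner_smul_left] at h1
    simp only [conj_trivial] at h1
    linarith
  rcases lt_or_gt_of_ne hγ0 with hneg | hpos
  · refine hcell i fun y hy => ?_
    rw [mem_laguerreCell_iff_affineCost] at hy
    have h5 := nonpos_of_mul_nonneg_right (hface y hy.1) hneg
    have h1 := hy.2 j
    have h2 := hj y
    linarith
  · refine hcell j fun y hy => ?_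
    rw [mem_laguerreCell_iff_affineCost] at hy
    have h5 := nonneg_of_mul_nonneg_right (hface y hy.1) hpos
    have h1 := hy.2 i
    have h2 := hj y
    linarith

theorem measureReal_sourceMeasure_eq (hρ0 : ∀ y ∈ Ω, 0 ≤ ρ y)
    {D : EuclideanSpace ℝ (Fin d) → ℝ} (hD : Continuous D) (hρD : Set.EqOn ρ D Ω)
    {S : Set (EuclideanSpace ℝ (Fin d))} (hS : MeasurableSet S) (hSΩ : S ⊆ Ω) :
    (sourceMeasure Ω ρ).real S = ∫ y in S, D y := by
  rw [measureReal_def, sourceMeasure, withDensity_apply _ hS, Measure.restrict_restrict hS,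
    Set.inter_eq_left.2 hSΩ, integral_eq_lintegral_of_nonneg_ae]
  · congr 1
    refine setLIntegral_congr_fun hS fun y hy => ?_
    simp only [hρD (hSΩ hy)]
  · filter_upwards [ae_restrict_mem hS] with y hy
    have := hρ0 y (hSΩ hy)
    rwa [hρD (hSΩ hy)] at this
  · exact hD.aestronglyMeasurable

/-- Raising `ψ j` removes a slab from the cell `i`. -/
theorem laguerreCell_diff_eq {m : ℕ} {a : Fin m → EuclideanSpace ℝ (Fin d)} {b : Fin m → ℝ}
    (hΩ : Ω = {y | ∀ j, inner ℝ (a j) y ≤ b j}) (ψ : EuclideanSpace ℝ (Fin n)) {i j : Fin n}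
    (hji : j ≠ i) {s : ℝ} (hs : 0 ≤ s) :
    laguerreCell Ω x (ψ + EuclideanSpace.single j s) i ⊆ laguerreCell Ω x ψ i ∧
    laguerreCell Ω x ψ i \ laguerreCell Ω x (ψ + EuclideanSpace.single j s) i =
      {y | inner ℝ (x j - x i) y ∈
          Set.Ioc (cellThreshold x ψ i j - s / 2) (cellThreshold x ψ i j) ∧
        ∀ k : Fin n ⊕ Fin m,
          inner ℝ (Sum.elim (fun l => if l = i ∨ l = j then 0 else x l - x i) a k) y ≤
            Sum.elim (fun l => if l = i ∨ l = j then 0 else cellThreshold x ψ i l) b k} := by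
  have ht : ∀ l, l ≠ i → cellThreshold x (ψ + EuclideanSpace.single j s) i l =
      cellThreshold x ψ i l - if l = j then s / 2 else 0 := by
    intro l hl
    have h1 : (EuclideanSpace.single j s : EuclideanSpace ℝ (Fin n)) i = 0 := by
      simp [hji.symm]
    simp only [cellThreshold, PiLp.add_apply, h1]
    by_cases hlj : l = j
    · rw [if_pos hlj, hlj]; simp; ring
    · rw [if_neg hlj]; simp [hlj]
  have hmem : ∀ y, y ∈ laguerreCell Ω x (ψ + EuclideanSpace.single j s) i ↔
      y ∈ laguerreCell Ω x ψ i ∧ inner ℝ (x j - x i) y ≤ cellThreshold x ψ i j - s / 2 := by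
    intro y
    rw [mem_laguerreCell_iff, mem_laguerreCell_iff]
    constructor
    · rintro ⟨hy, h⟩
      refine ⟨⟨hy, fun l hl => ?_⟩, ?_⟩
      · have := h l hl
        rw [ht l hl] at this
        split_ifs at this <;> linarith
      · have := h j hji
        rwa [ht j hji, if_pos rfl] at this
    · rintro ⟨⟨hy, h⟩, hj⟩
      refine ⟨hy, fun l hl => ?_⟩
      rw [ht l hl]
      split_ifs with hlj
      · rw [hlj]; exact hj
      · rw [sub_zero]; exact h l hl
  refine ⟨fun y hy => ((hmem y).1 hy).1, ?_⟩
  ext y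
  rw [Set.mem_sdiff, hmem, mem_laguerreCell_iff]
  simp only [Set.mem_ofPred_eq, Set.mem_Ioc, Sum.forall, Sum.elim_inl, Sum.elim_inr]
  constructor
  · rintro ⟨⟨hy, h⟩, hn⟩
    refine ⟨⟨not_le.1 fun h' => hn ⟨⟨hy, h⟩, h'⟩, h j hji⟩, fun l => ?_, by rw [hΩ] at hy; exact hy⟩
    split_ifs with hl
    · simp
    · exact h l fun h' => hl (Or.inl h')
  · rintro ⟨⟨h1, h2⟩, h3, h4⟩
    refine ⟨⟨by rw [hΩ]; exact h4, fun l hl => ?_⟩, fun h => absurd h.2 (not_le.2 h1)⟩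
    by_cases hlj : l = j
    · rw [hlj]; exact h2
    · have := h3 l
      rwa [if_neg (by simp [hl, hlj]), if_neg (by simp [hl, hlj])] at this

theorem abs_cellThreshold_sub_le (φ ψ : EuclideanSpace ℝ (Fin n)) (i j : Fin n) :
    |cellThreshold x φ i j - cellThreshold x ψ i j| ≤ ‖φ - ψ‖ := by
  have h1 := PiLp.norm_apply_le (φ - ψ) i
  have h2 := PiLp.norm_apply_le (φ - ψ) j
  rw [Real.norm_eq_abs] at h1 h2
  have h1' := (abs_le.1 h1)
  have h2' := (abs_le.1 h2)
  simp only [PiLp.sub_apply] at h1' h2'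
  simp only [cellThreshold]
  rw [abs_le]
  constructor <;> linarith

/-- Second differences of the mass of the cell `i` in the direction of another coordinate. -/
theorem exists_second_difference_le_of_ne (hΩ : IsCompact Ω) {m : ℕ}
    {a : Fin m → EuclideanSpace ℝ (Fin d)} {b : Fin m → ℝ}
    (hΩpoly : Ω = {y | ∀ j, inner ℝ (a j) y ≤ b j}) [IsProbabilityMeasure (sourceMeasure Ω ρ)]
    (hx : Function.Injective x) (hρ0 : ∀ y ∈ Ω, 0 ≤ ρ y)
    {D : EuclideanSpace ℝ (Fin d) → ℝ} {KD : NNReal} (hD : LipschitzWith KD D)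
    (hρD : Set.EqOn ρ D Ω) {ψ₀ : EuclideanSpace ℝ (Fin n)}
    (hψ₀ : ∀ i, 0 < volume (laguerreCell Ω x ψ₀ i)) {i j : Fin n} (hji : j ≠ i) :
    ∃ r C : ℝ, 0 < r ∧ 0 ≤ C ∧ ∀ φ ∈ Metric.ball ψ₀ r, ∀ ψ ∈ Metric.ball ψ₀ r,
      ∀ s ∈ Set.Icc 0 r,
      |((sourceMeasure Ω ρ).real (laguerreCell Ω x (φ + EuclideanSpace.single j s) i) -
          (sourceMeasure Ω ρ).real (laguerreCell Ω x φ i)) -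
        ((sourceMeasure Ω ρ).real (laguerreCell Ω x (ψ + EuclideanSpace.single j s) i) -
          (sourceMeasure Ω ρ).real (laguerreCell Ω x ψ i))| ≤ C * s * ‖φ - ψ‖ := by
  classical
  obtain ⟨R, hR⟩ := hΩ.exists_bound_of_continuousOn (f := fun y => y) continuousOn_id
  have ha : x j - x i ≠ 0 := sub_ne_zero.2 fun h => hji (hx h)
  let c : Fin n ⊕ Fin m → EuclideanSpace ℝ (Fin d) :=
    Sum.elim (fun l => if l = i ∨ l = j then 0 else x l - x i) a
  let β : EuclideanSpace ℝ (Fin n) → Fin n ⊕ Fin m → ℝ := fun ψ =>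
    Sum.elim (fun l => if l = i ∨ l = j then 0 else cellThreshold x ψ i l) b
  have hβ : ∀ φ ψ k, |β φ k - β ψ k| ≤ ‖φ - ψ‖ := by
    rintro φ ψ (l | k)
    · simp only [β, Sum.elim_inl]
      split_ifs
      · simp
      · exact abs_cellThreshold_sub_le φ ψ i l
    · simp [β]
  have hβc : ∀ φ ψ k, c k = 0 → β φ k = β ψ k := by
    rintro φ ψ (l | k) hk
    · simp only [β, c, Sum.elim_inl] at hk ⊢
      split_ifs at hk ⊢ with h
      · rfl
      · exact absurd (hx (sub_eq_zero.1 hk)) fun h' => h (Or.inl h')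
    · rfl
  have hpar : ∀ k, ∃ η : ℝ, 0 < η ∧ (¬LinearIndependent ℝ ![x j - x i, c k] → c k ≠ 0 →
      ∃ γ : ℝ, c k = γ • (x j - x i) ∧
        (|γ| + 1) * (2 * η) < |γ * cellThreshold x ψ₀ i j - β ψ₀ k|) := by
    intro k
    by_cases hk : ¬LinearIndependent ℝ ![x j - x i, c k] ∧ c k ≠ 0
    · obtain ⟨hk1, hk2⟩ := hk
      rw [LinearIndependent.pair_iff' ha] at hk1
      push Not at hk1
      obtain ⟨γ, hγ⟩ := hk1
      have hne : γ * cellThreshold x ψ₀ i j ≠ β ψ₀ k := by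
        rcases k with l | k
        · simp only [c, β, Sum.elim_inl] at hγ hk2 ⊢
          split_ifs at hγ hk2 ⊢ with h
          · exact absurd rfl hk2
          · push Not at h
            exact cellThreshold_ne_of_parallel hx hψ₀ hji h.1 h.2 hγ.symm
        · refine faceThreshold_ne_of_parallel hx hψ₀ hji hk2 (fun y hy => ?_) hγ.symm
          rw [hΩpoly] at hy
          exact hy k
      have hpos := abs_pos.2 (sub_ne_zero.2 hne)
      have hγ0 : 0 < |γ| + 1 := by positivity
      refine ⟨|γ * cellThreshold x ψ₀ i j - β ψ₀ k| / (|γ| + 1) / 4, by positivity,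
        fun _ _ => ⟨γ, hγ.symm, ?_⟩⟩
      have : (|γ| + 1) * (2 * (|γ * cellThreshold x ψ₀ i j - β ψ₀ k| / (|γ| + 1) / 4)) =
          |γ * cellThreshold x ψ₀ i j - β ψ₀ k| / 2 := by field_simp; norm_num
      rw [this]
      linarith
    · exact ⟨1, one_pos, fun h1 h2 => absurd ⟨h1, h2⟩ hk⟩
  choose η hη0 hη using hpar
  obtain ⟨r, hr0, hr1, hr⟩ : ∃ r : ℝ, 0 < r ∧ 2 * r ≤ 1 ∧ ∀ k, r ≤ η k := by
    obtain ⟨r, hr0, hr⟩ := exists_pos_forall_le hη0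
    exact ⟨min r (1 / 2), by positivity, by linarith [min_le_right r (1 / 2)],
      fun k => (min_le_left _ _).trans (hr k)⟩
  obtain ⟨C, hC, hslab⟩ := exists_slab_integral_sub_le ha c hD R
  refine ⟨r, C, hr0, hC, fun φ hφ ψ hψ s hs => ?_⟩
  rw [mem_ball_iff_norm] at hφ hψ
  have hm : ∀ χ, MeasurableSet (laguerreCell Ω x χ i) := fun χ =>
    (isClosed_laguerreCell hΩ.isClosed χ i).measurableSet
  have hdiff : ∀ χ, (sourceMeasure Ω ρ).real (laguerreCell Ω x (χ + EuclideanSpace.single j s) i) -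
      (sourceMeasure Ω ρ).real (laguerreCell Ω x χ i) =
      -∫ y in {y | inner ℝ (x j - x i) y ∈
          Set.Ioc (cellThreshold x χ i j - s / 2) (cellThreshold x χ i j) ∧
          ∀ k, inner ℝ (c k) y ≤ β χ k}, D y := by
    intro χ
    obtain ⟨h1, h2⟩ := laguerreCell_diff_eq (x := x) hΩpoly χ hji hs.1
    rw [← h2, ← measureReal_sourceMeasure_eq hρ0 hD.continuous hρD ((hm _).diff (hm _))
      (Set.sdiff_subset.trans fun y hy => hy.1), measureReal_sdiff h1 (hm _)]
    ring
  rw [hdiff, hdiff]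
  have hbdd : ∀ (χ : EuclideanSpace ℝ (Fin n)) y, (∀ k, inner ℝ (c k) y ≤ β χ k) → ‖y‖ ≤ R := by
    intro χ y hy
    refine hR y ?_
    rw [hΩpoly]
    exact fun k => hy (Sum.inr k)
  have hnorm : ‖ψ - φ‖ ≤ 1 := by
    have := norm_sub_le (ψ - ψ₀) (φ - ψ₀)
    rw [sub_sub_sub_cancel_right] at this
    linarith
  have key := hslab (cellThreshold x φ i j) (cellThreshold x ψ i j) (s / 2) ‖ψ - φ‖ (β φ) (β ψ)
    (by linarith [hs.1]) hnorm (abs_cellThreshold_sub_le ψ φ i j) (fun k => hβ ψ φ k)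
    (hbdd φ) (hbdd ψ) ?_
  · rw [neg_sub_neg, abs_sub_comm, norm_sub_rev φ ψ]
    refine key.trans ?_
    have h1 : 0 ≤ C * ‖ψ - φ‖ := by positivity
    have h2 := mul_le_mul_of_nonneg_left (by linarith [hs.1] : s / 2 ≤ s) h1
    linarith
  · intro k hk y hy
    by_cases hck : c k = 0
    · rw [hck, inner_zero_left, inner_zero_left, hβc φ ψ k hck]
    · obtain ⟨γ, hγ, hgap⟩ := hη k hk hck
      set α₀ := cellThreshold x ψ₀ i j with hα₀
      have hin : inner ℝ (x j - x i) (y + ((cellThreshold x ψ i j - cellThreshold x φ i j) /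
          ‖x j - x i‖ ^ 2) • (x j - x i)) =
          inner ℝ (x j - x i) y + (cellThreshold x ψ i j - cellThreshold x φ i j) := by
        rw [inner_add_right, inner_smul_right, real_inner_self_eq_norm_sq]
        have : ‖x j - x i‖ ≠ 0 := norm_ne_zero_iff.2 ha
        field_simp
      rw [hγ, inner_smul_left, inner_smul_left, hin]
      simp only [conj_trivial]
      have hφα := abs_le.1 ((abs_cellThreshold_sub_le (x := x) φ ψ₀ i j).trans hφ.le)
      have hψα := abs_le.1 ((abs_cellThreshold_sub_le (x := x) ψ ψ₀ i j).trans hψ.le)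
      have hφβ := (hβ φ ψ₀ k).trans hφ.le
      have hψβ := (hβ ψ ψ₀ k).trans hψ.le
      have hrk := hr k
      have hclose : ∀ u v : ℝ, |u - α₀| ≤ 2 * r → |v - β ψ₀ k| ≤ r →
          (γ * u ≤ v ↔ γ * α₀ ≤ β ψ₀ k) := by
        intro u v hu hv
        have h1 : |γ * u - γ * α₀| ≤ |γ| * (2 * r) := by
          rw [← mul_sub, abs_mul]
          exact mul_le_mul_of_nonneg_left hu (abs_nonneg _)
        have h2 : (|γ| + 1) * (2 * r) ≤ (|γ| + 1) * (2 * η k) := by gcongr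
        have h3 := abs_le.1 h1
        have h4 := abs_le.1 hv
        constructor
        · intro h
          by_contra h5
          push Not at h5
          rw [abs_of_pos (show 0 < γ * α₀ - β ψ₀ k by linarith)] at hgap
          linarith [h3.1, h4.2]
        · intro h
          rw [abs_of_nonpos (show γ * α₀ - β ψ₀ k ≤ 0 by linarith)] at hgap
          linarith [h3.2, h4.1]
      have hs2 := hs.2
      rw [hclose _ _ (abs_le.2 ⟨by linarith [hy.1, hφα.1], by linarith [hy.2, hφα.2]⟩) hφβ,
        hclose _ _ (abs_le.2 ⟨by linarith [hy.1, hψα.1], by linarith [hy.2, hψα.2]⟩) hψβ]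

end SecondDifferencesOfCells

section SecondDifferencesOfMasses

variable {d n : ℕ} {Ω : Set (EuclideanSpace ℝ (Fin d))} {ρ : EuclideanSpace ℝ (Fin d) → ℝ}
  {x : Fin n → EuclideanSpace ℝ (Fin d)} {w : Fin n → ℝ}

theorem EuclideanSpace.norm_le_sum_abs (v : EuclideanSpace ℝ (Fin n)) : ‖v‖ ≤ ∑ i, |v i| := by
  rw [EuclideanSpace.norm_eq]
  refine Real.sqrt_le_iff.2 ⟨Finset.sum_nonneg fun i _ => abs_nonneg _, ?_⟩
  simp_rw [Real.norm_eq_abs]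
  exact Finset.sum_sq_le_sq_sum_of_nonneg fun i _ => abs_nonneg _

/-- Second differences in coordinate directions control second differences in all directions. -/
theorem second_difference_le_of_single {F : Type*} [NormedAddCommGroup F]
    {G : EuclideanSpace ℝ (Fin n) → F} {ψ₀ : EuclideanSpace ℝ (Fin n)} {r C : ℝ}
    (h : ∀ j, ∀ φ ∈ Metric.ball ψ₀ r, ∀ ψ ∈ Metric.ball ψ₀ r, ∀ s : ℝ, |s| ≤ r →
      ‖(G (φ + EuclideanSpace.single j s) - G φ) - (G (ψ + EuclideanSpace.single j s) - G ψ)‖ ≤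
        C * |s| * ‖φ - ψ‖)
    {φ ψ v : EuclideanSpace ℝ (Fin n)} (hφ : φ ∈ Metric.ball ψ₀ (r / 2))
    (hψ : ψ ∈ Metric.ball ψ₀ (r / 2)) (hv : ∑ i, |v i| ≤ r / 2) :
    ‖(G (φ + v) - G φ) - (G (ψ + v) - G ψ)‖ ≤ C * (∑ i, |v i|) * ‖φ - ψ‖ := by
  classical
  have hpart : ∀ T : Finset (Fin n), ‖∑ j ∈ T, EuclideanSpace.single j (v j)‖ ≤ r / 2 := by
    intro T
    refine (norm_sum_le _ _).trans (le_trans ?_ hv)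
    simp only [PiLp.norm_single, Real.norm_eq_abs]
    exact Finset.sum_le_sum_of_subset_of_nonneg (Finset.subset_univ T) fun _ _ _ => abs_nonneg _
  have hall : ∀ T : Finset (Fin n),
      ‖(G (φ + ∑ j ∈ T, EuclideanSpace.single j (v j)) - G φ) -
        (G (ψ + ∑ j ∈ T, EuclideanSpace.single j (v j)) - G ψ)‖ ≤
        C * (∑ j ∈ T, |v j|) * ‖φ - ψ‖ := by
    intro T
    induction T using Finset.induction_on with
    | empty => simp
    | insert j T hj ih =>
      rw [Finset.sum_insert hj, Finset.sum_insert hj, add_comm (EuclideanSpace.single j (v j))]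
      set u := ∑ j ∈ T, EuclideanSpace.single j (v j) with hu
      have hmem : ∀ χ ∈ Metric.ball ψ₀ (r / 2), χ + u ∈ Metric.ball ψ₀ r := by
        intro χ hχ
        rw [mem_ball_iff_norm] at hχ ⊢
        rw [add_sub_right_comm]
        exact (norm_add_le _ _).trans_lt (by linarith [hpart T])
      have hvj : |v j| ≤ r := by
        have h1 := Finset.single_le_sum (f := fun i => |v i|) (fun i _ => abs_nonneg _)
          (Finset.mem_univ j)
        have h2 : 0 ≤ |v j| := abs_nonneg _
        simp only at h1
        linarith
      have h1 := h j _ (hmem φ hφ) _ (hmem ψ hψ) (v j) hvj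
      rw [add_sub_add_right_eq_sub] at h1
      have h2 : (G (φ + (u + EuclideanSpace.single j (v j))) - G φ) -
          (G (ψ + (u + EuclideanSpace.single j (v j))) - G ψ) =
          ((G (φ + u + EuclideanSpace.single j (v j)) - G (φ + u)) -
            (G (ψ + u + EuclideanSpace.single j (v j)) - G (ψ + u))) +
          ((G (φ + u) - G φ) - (G (ψ + u) - G ψ)) := by
        rw [add_assoc, add_assoc]; abel
      rw [h2]
      refine (norm_add_le _ _).trans ((add_le_add h1 ih).trans (le_of_eq ?_))
      ring
  have hvsum : ∑ j, EuclideanSpace.single j (v j) = v := by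
    ext i
    simp [Finset.sum_apply, Pi.single_apply]
  have := hall Finset.univ
  rwa [hvsum] at this

/-- Second differences of the excess masses near a point at which all cells have mass. -/
theorem exists_second_difference_excessMass_le (hΩ : IsCompact Ω) (hΩpoly : IsConvexPolyhedron Ω)
    [IsProbabilityMeasure (sourceMeasure Ω ρ)] [Nonempty (Fin n)]
    (hx : Function.Injective x) (hwsum : ∑ i, w i = 1) (hρ0 : ∀ y ∈ Ω, 0 ≤ ρ y) {KD : NNReal}
    (hρL : LipschitzOnWith KD ρ Ω) {ψ₀ : EuclideanSpace ℝ (Fin n)}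
    (hψ₀ : ∀ i, 0 < volume (laguerreCell Ω x ψ₀ i)) :
    ∃ r C : ℝ, 0 < r ∧ 0 ≤ C ∧ ∀ φ ∈ Metric.ball ψ₀ r, ∀ ψ ∈ Metric.ball ψ₀ r,
      ∀ v : EuclideanSpace ℝ (Fin n), ‖v‖ < r →
      ‖(excessMass Ω ρ x w (φ + v) - excessMass Ω ρ x w φ) -
        (excessMass Ω ρ x w (ψ + v) - excessMass Ω ρ x w ψ)‖ ≤ C * ‖φ - ψ‖ * ‖v‖ := by
  classical
  obtain ⟨m, a, b, hab⟩ := hΩpoly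
  obtain ⟨D, hD, hρD⟩ := hρL.extend_real
  set G := excessMass Ω ρ x w with hG
  let Δ : EuclideanSpace ℝ (Fin n) → EuclideanSpace ℝ (Fin n) → EuclideanSpace ℝ (Fin n) →
    EuclideanSpace ℝ (Fin n) := fun φ ψ v => (G (φ + v) - G φ) - (G (ψ + v) - G ψ)
  have hoff : ∀ q : Fin n × Fin n, ∃ r C : ℝ, 0 < r ∧ 0 ≤ C ∧ (q.2 ≠ q.1 →
      ∀ φ ∈ Metric.ball ψ₀ r, ∀ ψ ∈ Metric.ball ψ₀ r, ∀ s ∈ Set.Icc 0 r,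
        |Δ φ ψ (EuclideanSpace.single q.2 s) q.1| ≤ C * s * ‖φ - ψ‖) := by
    rintro ⟨i, j⟩
    by_cases hji : j = i
    · exact ⟨1, 0, one_pos, le_rfl, fun h => absurd hji h⟩
    · obtain ⟨r, C, hr, hC, h⟩ :=
        exists_second_difference_le_of_ne hΩ hab hx hρ0 hD hρD hψ₀ hji
      refine ⟨r, C, hr, hC, fun _ φ hφ ψ hψ s hs => ?_⟩
      have := h φ hφ ψ hψ s hs
      simpa [Δ, G, excessMass] using this
  choose r C hr hC hoff using hoff
  obtain ⟨r₀, hr₀, hrle⟩ := exists_pos_forall_le hr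
  let C₀ : ℝ := ∑ q, C q
  have hC₀ : 0 ≤ C₀ := Finset.sum_nonneg fun q _ => hC q
  have hoff' : ∀ i j, j ≠ i → ∀ φ ∈ Metric.ball ψ₀ r₀, ∀ ψ ∈ Metric.ball ψ₀ r₀,
      ∀ s ∈ Set.Icc 0 r₀, |Δ φ ψ (EuclideanSpace.single j s) i| ≤ C₀ * s * ‖φ - ψ‖ := by
    intro i j hji φ hφ ψ hψ s hs
    refine (hoff (i, j) hji φ (Metric.ball_subset_ball (hrle _) hφ) ψ
      (Metric.ball_subset_ball (hrle _) hψ) s ⟨hs.1, hs.2.trans (hrle _)⟩).trans ?_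
    have h1 : C (i, j) ≤ C₀ := Finset.single_le_sum (fun q _ => hC q) (Finset.mem_univ (i, j))
    have h2 := hs.1
    gcongr
  have hsum0 : ∀ φ ψ v, ∑ i, Δ φ ψ v i = 0 := by
    intro φ ψ v
    have : Δ φ ψ v ∈ zeroMeanSubmodule n :=
      Submodule.sub_mem _ (Submodule.sub_mem _ (sum_excessMass hΩ hx hwsum _)
        (sum_excessMass hΩ hx hwsum _)) (Submodule.sub_mem _ (sum_excessMass hΩ hx hwsum _)
        (sum_excessMass hΩ hx hwsum _))
    exact this
  have hcoord : ∀ j, ∀ φ ∈ Metric.ball ψ₀ r₀, ∀ ψ ∈ Metric.ball ψ₀ r₀, ∀ s ∈ Set.Icc 0 r₀,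
      ‖Δ φ ψ (EuclideanSpace.single j s)‖ ≤ 2 * n * C₀ * s * ‖φ - ψ‖ := by
    intro j φ hφ ψ hψ s hs
    set u := Δ φ ψ (EuclideanSpace.single j s) with hu
    have h1 : ∑ i ∈ Finset.univ.erase j, |u i| ≤ n * (C₀ * s * ‖φ - ψ‖) := by
      refine (Finset.sum_le_card_nsmul _ _ _ fun i hi =>
        hoff' i j (Finset.ne_of_mem_erase hi).symm φ hφ ψ hψ s hs).trans ?_
      rw [nsmul_eq_mul]
      refine mul_le_mul_of_nonneg_right ?_ ?_
      · have := Finset.card_le_univ (Finset.univ.erase j)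
        rw [Fintype.card_fin] at this
        exact_mod_cast this
      · have := hs.1
        positivity
    have h2 : u j = -∑ i ∈ Finset.univ.erase j, u i := by
      have := hsum0 φ ψ (EuclideanSpace.single j s)
      rw [← Finset.add_sum_erase _ _ (Finset.mem_univ j)] at this
      exact eq_neg_of_add_eq_zero_left this
    have h3 : |u j| ≤ ∑ i ∈ Finset.univ.erase j, |u i| := by
      rw [h2, abs_neg]
      exact Finset.abs_sum_le_sum_abs _ _
    refine (EuclideanSpace.norm_le_sum_abs u).trans ?_
    rw [← Finset.add_sum_erase _ _ (Finset.mem_univ j)]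
    linarith
  have hcoord' : ∀ j, ∀ φ ∈ Metric.ball ψ₀ (r₀ / 2), ∀ ψ ∈ Metric.ball ψ₀ (r₀ / 2), ∀ s : ℝ,
      |s| ≤ r₀ / 2 → ‖Δ φ ψ (EuclideanSpace.single j s)‖ ≤ 2 * n * C₀ * |s| * ‖φ - ψ‖ := by
    intro j φ hφ ψ hψ s hs
    rw [mem_ball_iff_norm] at hφ hψ
    rcases le_total 0 s with h0 | h0
    · rw [abs_of_nonneg h0] at hs ⊢
      exact hcoord j φ (mem_ball_iff_norm.2 (by linarith)) ψ (mem_ball_iff_norm.2 (by linarith)) s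
        ⟨h0, by linarith⟩
    · rw [abs_of_nonpos h0] at hs ⊢
      have hn : ‖(EuclideanSpace.single j s : EuclideanSpace ℝ (Fin n))‖ ≤ r₀ / 2 := by
        rw [PiLp.norm_single, Real.norm_eq_abs, abs_of_nonpos h0]; exact hs
      have hmem : ∀ χ : EuclideanSpace ℝ (Fin n), ‖χ - ψ₀‖ < r₀ / 2 →
          χ + EuclideanSpace.single j s ∈ Metric.ball ψ₀ r₀ := by
        intro χ hχ
        rw [mem_ball_iff_norm, add_sub_right_comm]
        exact (norm_add_le _ _).trans_lt (by linarith)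
      have h1 := hcoord j _ (hmem φ hφ) _ (hmem ψ hψ) (-s) ⟨by linarith, by linarith⟩
      rw [add_sub_add_right_eq_sub] at h1
      have h2 : (EuclideanSpace.single j s : EuclideanSpace ℝ (Fin n)) +
          EuclideanSpace.single j (-s) = 0 := by
        ext i
        by_cases hi : i = j <;> simp [hi]
      have h3 : Δ (φ + EuclideanSpace.single j s) (ψ + EuclideanSpace.single j s)
          (EuclideanSpace.single j (-s)) = -Δ φ ψ (EuclideanSpace.single j s) := by
        simp only [Δ, add_assoc, h2, add_zero]
        abel
      rwa [h3, norm_neg] at h1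
  have hn : (0 : ℝ) < n := by
    have : 0 < n := Fin.pos_iff_nonempty.2 inferInstance
    positivity
  refine ⟨min (r₀ / 2 / 2) (r₀ / 2 / 2 / n), 2 * n * C₀ * n, by positivity, by positivity,
    fun φ hφ ψ hψ v hv => ?_⟩
  have hv1 : ∑ i, |v i| ≤ n * ‖v‖ := by
    refine (Finset.sum_le_card_nsmul _ _ ‖v‖ fun i _ => ?_).trans ?_
    · simpa using PiLp.norm_apply_le v i
    · simp
  have hv2 : n * ‖v‖ ≤ r₀ / 2 / 2 := by
    have := hv.le.trans (min_le_right _ _)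
    rwa [le_div_iff₀' hn] at this
  refine (second_difference_le_of_single hcoord'
    (Metric.ball_subset_ball (min_le_left _ _) hφ) (Metric.ball_subset_ball (min_le_left _ _) hψ)
    (hv1.trans hv2)).trans ?_
  calc 2 * n * C₀ * (∑ i, |v i|) * ‖φ - ψ‖ ≤ 2 * n * C₀ * (n * ‖v‖) * ‖φ - ψ‖ := by gcongr
    _ = _ := by ring

end SecondDifferencesOfMasses

/-! ## Positivity of the Hessian -/

/-- The derivative of a gradient is symmetric. -/
theorem inner_fderiv_gradient_comm {E : Type*} [NormedAddCommGroup E] [InnerProductSpace ℝ E]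
    [CompleteSpace E] {f : E → ℝ} (hf : Differentiable ℝ f) {ψ : E}
    (hG : DifferentiableAt ℝ (gradient f) ψ) (u v : E) :
    inner ℝ (fderiv ℝ (gradient f) ψ u) v = inner ℝ (fderiv ℝ (gradient f) ψ v) u := by
  have h1 : ∀ φ, HasFDerivAt f (innerSL ℝ (gradient f φ)) φ := fun φ =>
    (hf φ).hasGradientAt.hasFDerivAt
  have h2 : HasFDerivAt (fun φ => innerSL ℝ (gradient f φ))
      ((innerSL ℝ).comp (fderiv ℝ (gradient f) ψ)) ψ :=
    (innerSL ℝ).hasFDerivAt.comp ψ hG.hasFDerivAt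
  exact second_derivative_symmetric h1 h2 u v

/-- A symmetric positive semidefinite operator that is injective on a subspace is positive definite
there. -/
theorem exists_pos_inner_ge_of_injOn {E : Type*} [NormedAddCommGroup E] [InnerProductSpace ℝ E]
    [FiniteDimensional ℝ E] {A : E →L[ℝ] E} (hsymm : ∀ u v, inner ℝ (A u) v = inner ℝ (A v) u)
    (hnonneg : ∀ v, 0 ≤ inner ℝ (A v) v) {Z : Submodule ℝ E} (hZ : ∀ v ∈ Z, v ≠ 0 → A v ≠ 0) :
    ∃ m : ℝ, 0 < m ∧ ∀ v ∈ Z, m * ‖v‖ ^ 2 ≤ inner ℝ (A v) v := by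
  have hpos : ∀ v ∈ Z, v ≠ 0 → 0 < inner ℝ (A v) v := by
    intro v hv hv0
    refine lt_of_le_of_ne (hnonneg v) fun h0 => hZ v hv hv0 ?_
    set u := A v with hu
    have hq : ∀ s : ℝ, 0 ≤ inner ℝ (A u) u * (s * s) + 2 * ‖u‖ ^ 2 * s + 0 := by
      intro s
      have := hnonneg (v + s • u)
      rw [map_add, map_smul, inner_add_left, inner_add_right, inner_add_right, inner_smul_left,
        inner_smul_left, inner_smul_right, inner_smul_right, ← h0, hsymm u v, ← hu,
        real_inner_self_eq_norm_sq] at this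
      simp only [conj_trivial] at this
      linarith
    have hd := discrim_le_zero hq
    rw [discrim] at hd
    have h4 : ‖u‖ ^ 2 = 0 := by nlinarith [sq_nonneg (‖u‖ ^ 2)]
    exact norm_eq_zero.1 (by simpa using h4)
  have hcont : Continuous fun v : E => (inner ℝ (A v) v : ℝ) := by fun_prop
  have hK : IsCompact (Metric.sphere (0 : E) 1 ∩ (Z : Set E)) :=
    (isCompact_sphere _ _).inter_right Z.closed_of_finiteDimensional
  rcases (Metric.sphere (0 : E) 1 ∩ (Z : Set E)).eq_empty_or_nonempty with he | hne
  · refine ⟨1, one_pos, fun v hv => ?_⟩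
    by_cases hv0 : v = 0
    · simp [hv0]
    · have : ‖v‖⁻¹ • v ∈ Metric.sphere (0 : E) 1 ∩ (Z : Set E) :=
        ⟨by simp [norm_smul, hv0], Z.smul_mem _ hv⟩
      rw [he] at this
      exact absurd this (Set.notMem_empty _)
  · obtain ⟨v₀, hv₀, hmin⟩ := hK.exists_isMinOn hne hcont.continuousOn
    have hv₀0 : v₀ ≠ 0 := fun h => by
      have := hv₀.1
      rw [h] at this
      simp at this
    refine ⟨inner ℝ (A v₀) v₀, hpos v₀ hv₀.2 hv₀0, fun v hv => ?_⟩
    by_cases hv0 : v = 0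
    · simp [hv0]
    · have hmem : ‖v‖⁻¹ • v ∈ Metric.sphere (0 : E) 1 ∩ (Z : Set E) :=
        ⟨by simp [norm_smul, hv0], Z.smul_mem _ hv⟩
      have h1 : inner ℝ (A v₀) v₀ ≤ inner ℝ (A (‖v‖⁻¹ • v)) (‖v‖⁻¹ • v) := hmin hmem
      rw [map_smul, inner_smul_left, inner_smul_right] at h1
      simp only [conj_trivial] at h1
      have hvn : 0 < ‖v‖ := norm_pos_iff.2 hv0
      calc inner ℝ (A v₀) v₀ * ‖v‖ ^ 2 ≤ ‖v‖⁻¹ * (‖v‖⁻¹ * inner ℝ (A v) v) * ‖v‖ ^ 2 := by gcongr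
        _ = inner ℝ (A v) v := by field_simp

/-- A `C^1` function on a compact convex set is Lipschitz. -/
theorem exists_lipschitzOnWith_of_contDiffOn {E : Type*} [NormedAddCommGroup E] [NormedSpace ℝ E]
    {f : E → ℝ} {s : Set E} (hs : IsCompact s) (hsc : Convex ℝ s) (hf : ContDiffOn ℝ 1 f s) :
    ∃ K, LipschitzOnWith K f s := by
  refine LocallyLipschitzOn.exists_lipschitzOnWith_of_compact hs fun y hy => ?_
  obtain ⟨K, t, ht, h⟩ := (hf y hy).exists_lipschitzOnWith hsc
  exact ⟨K, t, ht, h⟩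

theorem IsConvexPolyhedron.convex {d : ℕ} {Ω : Set (EuclideanSpace ℝ (Fin d))}
    (h : IsConvexPolyhedron Ω) : Convex ℝ Ω := by
  obtain ⟨m, a, b, rfl⟩ := h
  intro y hy z hz s t hs ht hst j
  rw [inner_add_right, inner_smul_right, inner_smul_right]
  calc _ ≤ s * b j + t * b j := add_le_add (mul_le_mul_of_nonneg_left (hy j) hs)
        (mul_le_mul_of_nonneg_left (hz j) ht)
    _ = b j := by rw [← add_mul, hst, one_mul]

theorem mainTheorem2 {d n : ℕ}
    (Ω : Set (EuclideanSpace ℝ (Fin d))) (hΩ : IsCompact Ω) (hΩpoly : IsConvexPolyhedron Ω)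
    (ρ : EuclideanSpace ℝ (Fin d) → ℝ) (hρmeas : AEMeasurable ρ (volume.restrict Ω))
    (ρmin ρmax : ℝ) (hρmin : 0 < ρmin) (hρ : ∀ y ∈ Ω, ρmin ≤ ρ y ∧ ρ y ≤ ρmax)
    (hμ : IsProbabilityMeasure (sourceMeasure Ω ρ))
    (x : Fin n → EuclideanSpace ℝ (Fin d)) (hxΩ : ∀ i, x i ∈ Ω) (hx : Function.Injective x)
    (w : Fin n → ℝ) (hw : ∀ i, 0 < w i) (hwsum : ∑ i, w i = 1) :
    Differentiable ℝ (dualFunctional Ω ρ x w) ∧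
    ∃ ψopt : EuclideanSpace ℝ (Fin n),
      -- `ψopt` is the unique maximizer of `g` with zero mean
      (IsZeroMean ψopt ∧ (∀ φ, dualFunctional Ω ρ x w φ ≤ dualFunctional Ω ρ x w ψopt) ∧
        ∀ ψ', IsZeroMean ψ' →
          (∀ φ, dualFunctional Ω ρ x w φ ≤ dualFunctional Ω ρ x w ψ') → ψ' = ψopt) ∧
      -- the method is well defined: away from `ψopt` the operator is invertible and
      -- Wolfe steps exist
      (∀ c₁ c₂ : ℝ, 0 < c₁ → c₁ < c₂ → c₂ < 1 →
        ∀ ψ : EuclideanSpace ℝ (Fin n), IsZeroMean ψ → ψ ≠ ψopt →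
          (regularizedHessian (negDualFunctional Ω ρ x w) ψ).IsInvertible ∧
          ∃ t : ℝ, 0 < t ∧ WolfeConditions (negDualFunctional Ω ρ x w) c₁ c₂ ψ
            (newtonDirection (negDualFunctional Ω ρ x w) ψ) t) ∧
      -- global convergence, for every zero-mean starting point and all Wolfe steps
      (∀ c₁ c₂ : ℝ, 0 < c₁ → c₁ < c₂ → c₂ < 1 →
        ∀ (ψ : ℕ → EuclideanSpace ℝ (Fin n)) (t : ℕ → ℝ), IsZeroMean (ψ 0) →
          IsRegularizedNewtonRun (negDualFunctional Ω ρ x w) c₁ c₂ ψ t →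
          (∀ k, IsZeroMean (ψ k)) ∧ Tendsto ψ atTop (𝓝 ψopt)) ∧
      -- quadratic convergence near `ψopt`, when the unit step is taken whenever it is admissible
      (ContDiffOn ℝ 1 ρ Ω →
        ∃ C : ℝ, ∀ c₁ c₂ : ℝ, 0 < c₁ → c₁ < 1 / 2 → c₁ < c₂ → c₂ < 1 →
          ∃ r : ℝ, 0 < r ∧
            ∀ (ψ : ℕ → EuclideanSpace ℝ (Fin n)) (t : ℕ → ℝ), IsZeroMean (ψ 0) →
              IsRegularizedNewtonRun (negDualFunctional Ω ρ x w) c₁ c₂ ψ t →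
              (∀ k, WolfeConditions (negDualFunctional Ω ρ x w) c₁ c₂ (ψ k)
                (newtonDirection (negDualFunctional Ω ρ x w) (ψ k)) 1 → t k = 1) →
              ∀ k, ‖ψ k - ψopt‖ < r →
                t k = 1 ∧ ‖ψ (k + 1) - ψopt‖ ≤ C * ‖ψ k - ψopt‖ ^ 2) := by
  classical
  have hΩc : Convex ℝ Ω := hΩpoly.convex
  have hn : Nonempty (Fin n) := by
    by_contra h
    rw [not_nonempty_iff] at h
    simp at hwsum
  have hρle : ∀ y ∈ Ω, ρ y ≤ ρmax := fun y hy => (hρ y hy).2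
  have hρge : ∀ y ∈ Ω, ρmin ≤ ρ y := fun y hy => (hρ y hy).1
  set f := negDualFunctional Ω ρ x w with hfdef
  have hgrad : ∀ ψ, HasGradientAt f (excessMass Ω ρ x w ψ) ψ :=
    hasGradientAt_negDualFunctional hΩ hx hρle
  have hgradeq : gradient f = excessMass Ω ρ x w := funext fun ψ => (hgrad ψ).gradient
  have hf : Differentiable ℝ f := fun ψ => (hgrad ψ).differentiableAt
  obtain ⟨L, hL⟩ := exists_lipschitzWith_excessMass (w := w) hΩ hx hρle
  have hmono : ∀ φ ψ, 0 ≤ inner ℝ (gradient f φ - gradient f ψ) (φ - ψ) := by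
    rw [hgradeq]; exact excessMass_monotone hΩ hx
  have hZ : ∀ ψ, gradient f ψ ∈ zeroMeanSubmodule n := by
    rw [hgradeq]; exact sum_excessMass hΩ hx hwsum
  have hneg : ∀ φ, f φ = -dualFunctional Ω ρ x w φ := fun φ => rfl
  obtain ⟨ψopt, hoptZ, hmin⟩ := exists_isMinOn_negDualFunctional hΩ hx hρle hw hwsum
  have hcrit : ∀ ψ, (∀ φ, f ψ ≤ f φ) → gradient f ψ = 0 := by
    intro ψ hψ
    have h1 : IsLocalMin f ψ := Eventually.of_forall hψ
    have h2 := h1.hasFDerivAt_eq_zero (hf ψ).hasGradientAt.hasFDerivAt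
    rw [gradient, show fderiv ℝ f ψ = 0 by simpa using h2, map_zero]
  have hopt : gradient f ψopt = 0 := hcrit ψopt hmin
  have huniq : ∀ φ ∈ zeroMeanSubmodule n, gradient f φ = 0 → φ = ψopt := by
    intro φ hφ hφ0
    rw [hgradeq] at hφ0 hopt
    exact eq_of_excessMass_eq_zero hΩ hΩc hx hρmin hρge hw hφ hoptZ hφ0 hopt
  have hL' : LipschitzWith L (gradient f) := by rw [hgradeq]; exact hL
  refine ⟨?_, ψopt, ⟨hoptZ, fun φ => ?_, fun ψ' hψ' hmax => ?_⟩, ?_, ?_, ?_⟩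
  · have h1 : dualFunctional Ω ρ x w = fun φ => -f φ := by
      funext φ; rw [hneg, neg_neg]
    rw [h1]
    exact hf.neg
  · have h1 := hmin φ
    simp only [negDualFunctional] at h1
    linarith
  · refine huniq ψ' hψ' (hcrit ψ' fun φ => ?_)
    rw [hneg, hneg]
    exact neg_le_neg (hmax φ)
  · intro c₁ c₂ hc₁ hc hc₂ ψ hψ hne
    have h0 : gradient f ψ ≠ 0 := fun h => hne (huniq ψ hψ h)
    exact ⟨regularizedHessian_isInvertible hf hmono h0,
      exists_wolfeConditions hf hmin hc₁ hc hc₂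
        (inner_gradient_newtonDirection_neg hf hmono hL' h0)⟩
  · intro c₁ c₂ hc₁ hc hc₂ ψ t h0 hrun
    exact ⟨fun k => hrun.mem hf hmono hZ h0 k, hrun.tendsto hf hmono hL' hZ hmin
      (exists_norm_le_of_negDualFunctional_le hΩ hx hw hwsum) huniq hc₁ hc₂ h0⟩
  · intro hρC
    obtain ⟨KD, hKD⟩ := exists_lipschitzOnWith_of_contDiffOn hΩ hΩc hρC
    have hmass : ∀ i, 0 < (sourceMeasure Ω ρ).real (laguerreCell Ω x ψopt i) := by
      intro i
      have h1 : excessMass Ω ρ x w ψopt i = 0 := by rw [← hgradeq, hopt]; rfl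
      rw [sub_eq_zero.1 h1]
      exact hw i
    have hvol : ∀ i, 0 < volume (laguerreCell Ω x ψopt i) := fun i => by
      refine pos_iff_ne_zero.2 fun h0 => ?_
      have := hmass i
      rw [measureReal_def, sourceMeasure_absolutelyContinuous h0] at this
      simp at this
    obtain ⟨r, K, hr, hK, hsecond⟩ := exists_second_difference_excessMass_le (w := w) hΩ hΩpoly hx
      hwsum (fun y hy => hρmin.le.trans (hρge y hy)) hKD hvol
    obtain ⟨hdiff, hlip⟩ := differentiableAt_and_lipschitz_fderiv_of_second_difference hL hr hK
      hsecond
    have hoptr := Metric.mem_ball_self hr (x := ψopt)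
    have hinj : ∀ v ∈ zeroMeanSubmodule n, v ≠ 0 → fderiv ℝ (gradient f) ψopt v ≠ 0 := by
      rw [hgradeq]
      exact fun v hv hv0 =>
        fderiv_excessMass_ne_zero hΩ hΩc hx hρmin hρge hmass (hdiff ψopt hoptr) hv hv0
    rw [← hgradeq] at hdiff hlip
    obtain ⟨m, hm, hpos⟩ := exists_pos_inner_ge_of_injOn
      (inner_fderiv_gradient_comm hf (hdiff ψopt hoptr))
      (inner_fderiv_nonneg_of_monotone hmono ψopt) hinj
    let r₀ := min r (m / (2 * (K + 1)))
    have hr₀ : 0 < r₀ := by positivity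
    have hsub : Metric.ball ψopt r₀ ⊆ Metric.ball ψopt r :=
      Metric.ball_subset_ball (min_le_left _ _)
    have htay : ∀ ψ ∈ Metric.ball ψopt r₀, ∀ φ ∈ Metric.ball ψopt r₀,
        ‖gradient f φ - gradient f ψ - fderiv ℝ (gradient f) ψ (φ - ψ)‖ ≤ K * ‖φ - ψ‖ ^ 2 := by
      intro ψ hψ φ hφ
      have hseg : segment ℝ ψ φ ⊆ Metric.ball ψopt r :=
        (convex_ball ψopt r).segment_subset (hsub hψ) (hsub hφ)
      have h1 := (convex_segment ψ φ).norm_image_sub_le_of_norm_fderiv_le' (𝕜 := ℝ)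
        (f := gradient f) (φ := fderiv ℝ (gradient f) ψ) (C := K * ‖φ - ψ‖)
        (fun χ hχ => hdiff χ (hseg hχ)) (fun χ hχ => ?_)
        (left_mem_segment ℝ ψ φ) (right_mem_segment ℝ ψ φ)
      · refine h1.trans (le_of_eq (by ring))
      · refine (hlip χ (hseg hχ) ψ (hsub hψ)).trans (mul_le_mul_of_nonneg_left ?_ hK)
        rw [← dist_eq_norm, ← dist_eq_norm, dist_comm φ]
        have := mem_segment_iff_wbtw.1 hχ
        have h3 := this.dist_add_dist
        rw [dist_comm χ ψ]
        linarith [dist_nonneg (x := χ) (y := φ)]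
    have hpos' : ∀ ψ ∈ Metric.ball ψopt r₀, ∀ v ∈ zeroMeanSubmodule n,
        m / 2 * ‖v‖ ^ 2 ≤ inner ℝ (fderiv ℝ (gradient f) ψ v) v := by
      intro ψ hψ v hv
      have h1 := hlip ψ (hsub hψ) ψopt hoptr
      have h2 : K * ‖ψ - ψopt‖ ≤ m / 2 := by
        have h3 : ‖ψ - ψopt‖ < m / (2 * (K + 1)) :=
          (mem_ball_iff_norm.1 hψ).trans_le (min_le_right _ _)
        rw [lt_div_iff₀ (by positivity)] at h3
        nlinarith [norm_nonneg (ψ - ψopt)]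
      have h3 := abs_le.1 ((abs_real_inner_le_norm
        ((fderiv ℝ (gradient f) ψ - fderiv ℝ (gradient f) ψopt) v) v).trans
        (mul_le_mul_of_nonneg_right ((ContinuousLinearMap.le_opNorm _ v).trans
          (mul_le_mul_of_nonneg_right (h1.trans h2) (norm_nonneg v))) (norm_nonneg v)))
      rw [sub_apply, inner_sub_left] at h3
      have h4 := hpos v hv
      linarith [h3.1]
    obtain ⟨C, hC⟩ := exists_newton_quadratic hf hmono hL' hZ hopt hoptZ hr₀ hK (half_pos hm)
      htay hpos'
    refine ⟨C, fun c₁ c₂ hc₁ hc₁' hc hc₂ => ?_⟩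
    obtain ⟨r', hr', h⟩ := hC c₁ c₂ hc₁' (hc₁.trans hc)
    refine ⟨r', hr', fun ψ t h0 hrun hunit k hk => ?_⟩
    obtain ⟨hW, hquad⟩ := h (ψ k) (hrun.mem hf hmono hZ h0 k) hk
    have ht := hunit k hW
    refine ⟨ht, ?_⟩
    rw [(hrun k).2.2, ht, one_smul]
    exact hquad
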